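/- A \emph{strictly increasing binary tree of size $n$} is a plane binary tree with $n$ nodes, each having either no child or a left and a right child, whose nodes are labelled bijectively by $1,\dots,n$ so that labels increase from the root to the leaves. Let $t_n$ be their number ($t_n=0$ for even $n$). \emph{Model.} A randomized algorithm reads independent fair random bits, each in one unit of time; the bits read so far determine whether it stops and with which outcome. In the algorithm below, natural numbers are stored in words of $w$ bits; adding, subtracting, multiplying, dividing with remainder or comparing $a$ and $b$ costs $(1+\lfloor |a|/w\rfloor)(1+\lfloor |b|/w\rfloor)$, where $|a|$ is the number of binary digits of $a$, and each call of a recursive procedure or iteration of a loop costs one unit. For input $n$, $w$ is the number of binary digits of $n$, so operations on numbers of $O(\log n)$ bits cost $O(1)$. Running time means expected running time. \emph{Left size.} For a tree of odd size $n=2l-1\ge 3$ put $f_k=(4^k-1)\zeta(2k)(4^{l-k}-1)\zeta(2(l-k))$, $1\le k\le l-1$. The Monte-Carlo procedure draws $X$ uniform in $\{1,\dots,l-1\}$ (by rejection from a power of two) and $U$ uniform in $[0,1]$, returns $2X-1$ if $Uf_1\le f_X$, and otherwise starts again. The comparison is lazy: in round $r=1,2,\dots$ the first $2r$ bits of $U$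 are known, and $f_1,f_X$ are enclosed between fixed-point numbers, obtained by truncating the zeta series after $2^r$ terms and enclosing its tail between two integrals; if this does not decide the comparison, the next bits are read. \emph{Recursive sampler.} Given $n$ and an increasing list of $n$ labels (initially $1,\dots,n$): if $n=1$, return the leaf with this label. Otherwise the smallest label goes to the root; draw the size $m$ of the left subtree with the Monte-Carlo procedure; choose a uniform random set of $m$ of the other $n-1$ labels for the left subtree, the rest going to the right one (scanning the list and deciding for each label by a Bernoulli variable with the appropriate rational parameter, compared lazily bit by bit); generate the subtrees, of sizes $m$ and $n-1-m$, recursively. \textbf{Theorem.} \begin{enumerate} \item For all $l\ge 2$ and $1\le k\le l-1$, the Monte-Carlo procedure for size $2l-1$ returns $2k-1$ with probability $f_k/\sum_{j=1}^{l-1}f_j$. \item For every odd $n$ the recursive sampler is a randomized algorithm in the above sense and returns each strictly increasing binary tree of size $n$ with probability $1/t_n$. \item Its expected running time is $O(n\log n)$: there is a constant $C>0$ such that it is at most $C\,n\log n$ for all odd $n\ge 3$. \item This is optimal: for every odd $n$, every randomized algorithm in the above sense (reading a bit taking at least one unit of time) that returns each strictly increasing binary tree of size $n$ with probability $1/t_n$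 reads at least $\log_2 t_n$ random bits in expectation, so that its expected running time is at least $\log_2 t_n$; and $\log_2 t_n=\Omega(n\log n)$: there is $c>0$ with $\log_2 t_n\ge c\,n\log n$ for all odd $n\ge 3$. \end{enumerate} -/

import Mathlib

open scoped ENNReal

namespace RandTree

/-! ## Strictly increasing binary trees -/

/-- Plane binary trees in which every node carries a label and has either no child (a leaf)
or a left and a right child. -/
inductive BTree (α : Type) : Type where
  | leaf (a : α) : BTree α
  | node (a : α) (l r : BTree α) : BTree α

namespace BTree

/-- The labels of all nodes, in prefix order. -/
def labels {α : Type} : BTree α → List α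
  | leaf a => [a]
  | node a l r => a :: (l.labels ++ r.labels)

/-- Every node has a smaller label than each of its descendants. -/
def IsIncreasing : BTree ℕ → Prop
  | leaf _ => True
  | node a l r => (∀ b ∈ l.labels ++ r.labels, a < b) ∧ l.IsIncreasing ∧ r.IsIncreasing

/-- Apply a function to every label. -/
def map {α β : Type} (f : α → β) : BTree α → BTree β
  | leaf a => leaf (f a)
  | node a l r => node (f a) (l.map f) (r.map f)

end BTree

/-- The strictly increasing binary trees of size `n`: trees with `n` nodes, labelled by
`1, …, n` (each label once), with labels increasing from the root to the leaves. -/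
def incTrees (n : ℕ) : Set (BTree ℕ) :=
  {T | T.IsIncreasing ∧ T.labels.Perm (List.range' 1 n)}

/-- `t_n`, the number of strictly increasing binary trees of size `n`. -/
noncomputable def treeCount (n : ℕ) : ℕ := (incTrees n).ncard

/-! ## Randomized computations with a step count -/

/-- A completed run of a randomized computation: the random bits that it has read, the value
that it has returned, and the time that it has taken. -/
@[ext]
structure Run (α : Type) : Type where
  bits : List Bool
  value : α
  time : ℕ

/-- A randomized computation, given by the set of its completed runs. -/
def RComp (α : Type) : Type := Set (Run α)

namespace RComp

variable {α β : Type}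

/-- The completed runs of a computation. -/
def runs (f : RComp α) : Set (Run α) := f

/-- Sequential composition: the bits read are concatenated, the times are added. `pure` reads no
bit and takes no time. -/
instance : Monad RComp where
  pure a := ({⟨[], a, 0⟩} : Set (Run _))
  bind f g := {ρ : Run _ | ∃ σ ∈ f.runs, ∃ τ ∈ (g σ.value).runs,
    ρ = ⟨σ.bits ++ τ.bits, τ.value, σ.time + τ.time⟩}

/-- Let time `c` pass. -/
def tick (c : ℕ) : RComp Unit := ({⟨[], (), c⟩} : Set (Run Unit))

/-- Read one random bit, in one unit of time. -/
def flip : RComp Bool := ({ρ | ∃ b : Bool, ρ = ⟨[b], b, 1⟩} : Set (Run Bool))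

/-- The runs of the recursive procedure with body `F` in which the calls are nested at most
`k` deep. Each call takes one unit of time. -/
def unroll (F : (α → RComp β) → α → RComp β) : ℕ → α → RComp β
  | 0 => fun _ => (∅ : Set (Run β))
  | k + 1 => fun a => do
      tick 1
      F (unroll F k) a

/-- The recursive procedure with body `F`, called with the argument `a`. -/
def fix (F : (α → RComp β) → α → RComp β) (a : α) : RComp β :=
  ({ρ | ∃ k : ℕ, ρ ∈ (unroll F k a).runs} : Set (Run β))

/-- What is required of an arbitrary randomized algorithm that is fed with random bits: the bits
read so far determine whether it stops and with which outcome (so that no completed run continues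
another one), and reading a bit takes at least one unit of time. -/
structure IsAlgorithm (f : RComp α) : Prop where
  prefixFree : ∀ ρ ∈ f.runs, ∀ σ ∈ f.runs, ρ.bits <+: σ.bits → ρ = σ
  bits_le_time : ∀ ρ ∈ f.runs, ρ.bits.length ≤ ρ.time

/-- The probability that the computation stops and returns `a`, if the random bits are
independent and fair: a run that reads `j` bits has probability `2⁻ʲ`. -/
noncomputable def prob (f : RComp α) (a : α) : ℝ≥0∞ :=
  ∑' ρ : {ρ : Run α // ρ ∈ f.runs ∧ ρ.value = a}, (2⁻¹ : ℝ≥0∞) ^ ρ.1.bits.length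

/-- The expected running time (of a computation that stops almost surely). -/
noncomputable def expectedTime (f : RComp α) : ℝ≥0∞ :=
  ∑' ρ : {ρ : Run α // ρ ∈ f.runs}, (2⁻¹ : ℝ≥0∞) ^ ρ.1.bits.length * (ρ.1.time : ℝ≥0∞)

/-- The expected number of random bits read (by a computation that stops almost surely). -/
noncomputable def expectedBits (f : RComp α) : ℝ≥0∞ :=
  ∑' ρ : {ρ : Run α // ρ ∈ f.runs}, (2⁻¹ : ℝ≥0∞) ^ ρ.1.bits.length * (ρ.1.bits.length : ℝ≥0∞)

end RComp

/-- `f` returns every strictly increasing binary tree of size `n` with probability `1 / t_n`, and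
nothing else. -/
def IsUniformSampler (n : ℕ) (f : RComp (BTree ℕ)) : Prop :=
  (∀ T ∈ incTrees n, f.prob T = (treeCount n : ℝ≥0∞)⁻¹) ∧ ∀ T ∉ incTrees n, f.prob T = 0

open RComp

/-! ## Multi-precision arithmetic

A natural number is stored in blocks of `w` bits. Programs handle numbers only through the
operations below; each of them takes a time equal to the product of the numbers of blocks of its
two arguments (schoolbook arithmetic). Numbers of `O(w)` bits are thus handled in time `O(1)`. -/

/-- A natural number in a machine with words of `w` bits. -/
structure BigNat (w : ℕ) : Type where
  val : ℕ

namespace BigNat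

variable {w : ℕ}

/-- The number of words that the number takes. -/
def blocks (a : BigNat w) : ℕ := 1 + Nat.size a.val / w

/-- A number returned by a binary operation on `a` and `b`. -/
def op (f : ℕ → ℕ → ℕ) (a b : BigNat w) : RComp (BigNat w) := do
  tick (a.blocks * b.blocks)
  pure ⟨f a.val b.val⟩

/-- Addition. -/
def add (a b : BigNat w) : RComp (BigNat w) := op (fun x y => x + y) a b

/-- Truncated subtraction. -/
def sub (a b : BigNat w) : RComp (BigNat w) := op (fun x y => x - y) a b

/-- Multiplication. -/
def mul (a b : BigNat w) : RComp (BigNat w) := op (fun x y => x * y) a b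

/-- Division with rounding down. -/
def div (a b : BigNat w) : RComp (BigNat w) := op (fun x y => x / y) a b

/-- Comparison. -/
def le (a b : BigNat w) : RComp Bool := do
  tick (a.blocks * b.blocks)
  pure (decide (a.val ≤ b.val))

/-- A random bit, as a number. -/
def bit : RComp (BigNat w) := do
  let b ← flip
  pure ⟨b.toNat⟩

end BigNat

open BigNat

/-! ## The algorithm

Every loop is a recursive procedure `fix`. Apart from the arithmetic operations and the random
bits, which are charged separately, one call makes at most a constant number of elementary list
and tree operations, and these are covered by the unit of time charged for the call. -/

section Algorithm

variable {w : ℕ}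

/-- A uniform random element of `{0, …, m - 1}`, by rejection from the next power of two: `s` is a
power of two and `r` is uniform in `{0, …, s - 1}`. -/
def uniformBelow (m : BigNat w) : RComp (BigNat w) :=
  fix (fun self (x : BigNat w × BigNat w) => do
    let s := x.1
    let r := x.2
    if ← le m s then
      if ← le m r then self (⟨1⟩, ⟨0⟩) else pure r
    else
      let b ← bit
      let s' ← add s s
      let r' ← add r r
      let r'' ← add r' b
      self (s', r'')) (⟨1⟩, ⟨0⟩)

/-- `⌊t / dᶜ⌋`, by successive divisions. -/
def divPow (t d c : BigNat w) : RComp (BigNat w) :=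
  fix (fun self (x : BigNat w × BigNat w) => do
    let t := x.1
    let c := x.2
    if ← le t ⟨0⟩ then pure t
    else if ← le c ⟨0⟩ then pure t
    else
      let t' ← div t d
      let c' ← sub c ⟨1⟩
      self (t', c')) (t, c)

/-- `D + ∑_{2 ≤ i ≤ N} ⌊D / i ^ (2k)⌋`. -/
def zetaSum (D k N : BigNat w) : RComp (BigNat w) :=
  fix (fun self (x : BigNat w × BigNat w) => do
    let i := x.1
    let S := x.2
    if ← le i N then
      let d ← mul i i
      let t ← divPow D d k
      let S' ← add S t
      let i' ← add i ⟨1⟩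
      self (i', S')
    else pure S) (⟨2⟩, D)

/-- `⌊D / ((2k - 1) i ^ (2k - 1))⌋`. -/
def zetaTail (D k i : BigNat w) : RComp (BigNat w) := do
  let t ← div D i
  let d ← mul i i
  let c ← sub k ⟨1⟩
  let t' ← divPow t d c
  let e ← add k c
  div t' e

/-- Integers below and above `D ζ(2k)`: the series is truncated after `N` terms, and its tail is
compared with an integral. -/
def zetaBounds (D k N : BigNat w) : RComp (BigNat w × BigNat w) := do
  let S ← zetaSum D k N
  let N' ← add N ⟨1⟩
  let a ← zetaTail D k N'
  let b ← zetaTail D k N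
  let lo ← add S a
  let S' ← add S N
  let hi ← add S' b
  pure (lo, hi)

/-- Integers below and above `D² (1 - 4⁻ᵏ) ζ(2k)`. -/
def factorBounds (D k N : BigNat w) : RComp (BigNat w × BigNat w) := do
  let z ← zetaBounds D k N
  let v ← divPow D ⟨4⟩ k
  let a ← sub D v
  let b ← sub a ⟨1⟩
  let lo ← mul z.1 b
  let hi ← mul z.2 a
  pure (lo, hi)

/-- Integers below and above `D⁴ 4⁻ˡ f_k`, where `f_k` is the weight
`(4ᵏ - 1) ζ(2k) (4ˡ⁻ᵏ - 1) ζ(2(l - k))`. -/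
def weightBounds (l D N k : BigNat w) : RComp (BigNat w × BigNat w) := do
  let x ← factorBounds D k N
  let k' ← sub l k
  let y ← factorBounds D k' N
  let lo ← mul x.1 y.1
  let hi ← mul x.2 y.2
  pure (lo, hi)

/-- The test `U f_1 ≤ f_k` for a uniform random number `U` of `[0, 1]`, with lazy evaluation. In
the `r`-th round `N = 2ʳ`, the first `2r` bits of `U` are known and form the integer `u`, and the
weights are computed with the precision that corresponds to `N`. If this does not decide the
comparison, the next bits are added. -/
def accept (l k : BigNat w) : RComp Bool :=
  fix (fun self (x : BigNat w × BigNat w) => do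
    let N ← add x.1 x.1
    let b₁ ← bit
    let b₂ ← bit
    let u₁ ← mul ⟨2⟩ x.2
    let u₂ ← add u₁ b₁
    let u₃ ← mul ⟨2⟩ u₂
    let u ← add u₃ b₂
    let B ← mul N N
    let D ← mul B B
    let p ← weightBounds l D N ⟨1⟩
    let q ← weightBounds l D N k
    let u' ← add u ⟨1⟩
    let a ← mul u' p.2
    let b ← mul B q.1
    if ← le a b then pure true
    else
      let c ← mul u p.1
      let d ← mul B q.2
      if ← le c d then self (N, u) else pure false) (⟨1⟩, ⟨0⟩)

/-- The Monte-Carlo procedure for the size of the left subtree of a random tree of size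
`n = 2l - 1 ≥ 3`: draw `X` uniformly in `{1, …, l - 1}` and a uniform `U` in `[0, 1]`, return
`2X - 1` if `U f_1 ≤ f_X`, and start again otherwise. -/
def leftSize (n : BigNat w) : RComp (BigNat w) := do
  let n' ← add n ⟨1⟩
  let l ← div n' ⟨2⟩
  let m ← sub l ⟨1⟩
  fix (fun self (_ : Unit) => do
    let x ← uniformBelow m
    let X ← add x ⟨1⟩
    if ← accept l X then
      let Y ← add X X
      sub Y ⟨1⟩
    else self ()) ()

/-- Returns `true` with probability `a / s`, for `a ≤ s`: the bits of a uniform random number are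
compared one by one with the binary digits of `a / s`. -/
def biasedCoin (a s : BigNat w) : RComp Bool :=
  fix (fun self (a : BigNat w) => do
    let a' ← add a a
    let b ← flip
    if ← le s a' then
      if b then
        let a'' ← sub a' s
        self a''
      else pure true
    else
      if b then pure false else self a') a

/-- Splits the list `L` of length `s` into a uniform random sublist of length `r` and the
complementary sublist. -/
def shuffle (r s : BigNat w) (L : List (BigNat w)) : RComp (List (BigNat w) × List (BigNat w)) :=
  fix (fun self (x : BigNat w × BigNat w × List (BigNat w)) =>
    match x with
    | (_, _, []) => pure ([], [])
    | (r, s, a :: L) => do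
      let s' ← sub s ⟨1⟩
      if ← biasedCoin r s then
        let r' ← sub r ⟨1⟩
        let p ← self (r', s', L)
        pure (a :: p.1, p.2)
      else
        let p ← self (r, s', L)
        pure (p.1, a :: p.2)) (r, s, L)

/-- The list `1, …, n`. -/
def upTo (n : BigNat w) : RComp (List (BigNat w)) :=
  fix (fun self (x : BigNat w × List (BigNat w)) => do
    if ← le x.1 ⟨0⟩ then pure x.2
    else
      let i ← sub x.1 ⟨1⟩
      self (i, x.1 :: x.2)) (n, [])

/-- The recursive method, for a tree of size `n` whose labels are the members of the increasing
list `L` of length `n`. The smallest label goes to the root. If `n > 1`, the size of the left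
subtree is drawn, the other labels are shuffled among the two subtrees, and these are generated
recursively. (The empty list does not occur.) -/
def recursiveMethod (n : BigNat w) (L : List (BigNat w)) : RComp (BTree (BigNat w)) :=
  fix (fun self (x : BigNat w × List (BigNat w)) =>
    match x with
    | (_, []) => pure (BTree.leaf ⟨0⟩)
    | (n, a :: L) => do
      if ← le n ⟨1⟩ then pure (BTree.leaf a)
      else
        let m ← leftSize n
        let s ← sub n ⟨1⟩
        let p ← shuffle m s L
        let T' ← self (m, p.1)
        let m' ← sub s m
        let T'' ← self (m', p.2)
        pure (BTree.node a T' T'')) (n, L)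

end Algorithm

/-- The sampler for strictly increasing binary trees of size `n`, on a machine whose words have as
many bits as `n`. -/
def sampler (n : ℕ) : RComp (BTree ℕ) := do
  let L ← upTo (⟨n⟩ : BigNat (Nat.size n))
  let T ← recursiveMethod ⟨n⟩ L
  pure (T.map BigNat.val)

/-- The weight `f_k = (4ᵏ - 1) ζ(2k) (4ˡ⁻ᵏ - 1) ζ(2(l - k))`. -/
noncomputable def weight (l k : ℕ) : ℝ :=
  ((4 : ℝ) ^ k - 1) * (riemannZeta (2 * (k : ℂ))).re *
    (((4 : ℝ) ^ (l - k) - 1) * (riemannZeta (2 * ((l - k : ℕ) : ℂ))).re)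

end RandTree

open RandTree

namespace RandTree

namespace RComp

variable {α β γ δ : Type}

/-! ## Algebra of computations -/

/-! Exactness. Write λ(k) = (1 - 4⁻ᵏ) ζ(2k), which is `oddZeta k`, and τ_k = 2 · 4ᵏ λ(k) / π²ᵏ,
which is `tangentCoeff k`. By Euler's formula for ζ(2k), the τ_k are up to sign the coefficients of
tanh, and tanh' = 1 - tanh² becomes ∑ τ_k τ_{l-k} = (2l - 1) τ_l (`sum_tangentCoeff`). Since f_k =
4ˡ λ(k) λ(l - k), the product τ_k τ_{l-k} is f_k times a factor free of k. So the law of the left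
size, times the probability of one split of the labels, times 1/T_k and 1/T_{l-k}, is 1/T_l with T_l
= (2l - 1)! τ_l (`sizeProb_mul`), and by induction every tree has probability 1/T_l
(`prob_recursiveMethod`). The trees are never counted by a separate recursion: the sampler stops
almost surely, hence t_n = T_l for n = 2l - 1 (`finite_incTrees_and_treeCount`).

Cost of a left size. All f_k lie between 16/25 f_1 and f_1 (`weightRatio_bounds`), so a bounded
expected number of proposals suffices, and a uniform proposal costs O(w). In the comparison, the
enclosures at precision N = 2ʳ have relative width O(1/N²), while the bits read place U in one of N²
cells; hence only a bounded number of the 4ʳ cells stay undecided (`card_undecided_le`). Round r is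
reached with probability O(4⁻ʳ) and costs O(r³ 2ʳ), uniformly in l and k: a power is divided out
only until the quotient vanishes, so large exponents do no harm. The comparison thus takes O(1)
expected time (`exists_expectedTime_accept_le`), and a left size takes O(w).

Cost of the recursion. A node of size n costs O(w) for its left size and O(n) for the distribution
of labels. Each left size has probability at least (16/25)/(l - 1), so x log x loses a fixed
fraction of n in expectation when n is split (`sum_sizeProb_mul_le`). A potential 1500 x log x + b x
therefore pays for the linear work, with b = O(w) paying for the rest; w stays of order log n at all
levels.

Lower bound. In a uniform sampler a single run reading j bits contributes 2⁻ʲ to an outcome of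
probability 1/t_n, so every completed run, not only the average one, reads at least log₂ t_n bits.
One term of the recurrence yields t_{2m+1} ≥ 2ᵐ m!.

Formal frame. A computation is its set of completed runs. Prefix-freeness makes the factorization of
a run of a composition unique, so expectations compose (`wsum_bind`). Recursion is a Kleene fixed
point (`fix_eq`), and time bounds pass to it from finite unrollings (`expectedTime_fix_induction`).
Such sums ignore computations that never stop, so almost sure termination is proved separately
through `mass`. -/

theorem ext_runs {f g : RComp α} (h : ∀ ρ, ρ ∈ f.runs ↔ ρ ∈ g.runs) : f = g := Set.ext h

theorem mem_pure {a : α} {ρ : Run α} : ρ ∈ (pure a : RComp α).runs ↔ ρ = ⟨[], a, 0⟩ := Iff.rfl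

theorem mem_bind {f : RComp α} {g : α → RComp β} {ρ : Run β} :
    ρ ∈ (f >>= g).runs ↔ ∃ σ ∈ f.runs, ∃ τ ∈ (g σ.value).runs,
      ρ = ⟨σ.bits ++ τ.bits, τ.value, σ.time + τ.time⟩ := Iff.rfl

theorem mem_tick {c : ℕ} {ρ : Run Unit} : ρ ∈ (tick c).runs ↔ ρ = ⟨[], (), c⟩ := Iff.rfl

theorem mem_flip {ρ : Run Bool} : ρ ∈ flip.runs ↔ ∃ b : Bool, ρ = ⟨[b], b, 1⟩ := Iff.rfl

theorem pure_bind' (a : α) (g : α → RComp β) : (pure a >>= g) = g a := by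
  refine ext_runs fun ρ => ?_
  simp only [mem_bind, mem_pure]
  constructor
  · rintro ⟨_, rfl, τ, hτ, rfl⟩
    simpa using hτ
  · intro h
    exact ⟨_, rfl, ρ, h, by simp⟩

theorem bind_assoc' (f : RComp α) (g : α → RComp β) (h : β → RComp γ) :
    (f >>= g >>= h) = f >>= fun a => g a >>= h := by
  refine ext_runs fun ρ => ?_
  simp only [mem_bind]
  constructor
  · rintro ⟨_, ⟨σ, hσ, τ, hτ, rfl⟩, υ, hυ, rfl⟩
    exact ⟨σ, hσ, _, ⟨τ, hτ, υ, hυ, rfl⟩, by simp [add_assoc]⟩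
  · rintro ⟨σ, hσ, _, ⟨τ, hτ, υ, hυ, rfl⟩, rfl⟩
    exact ⟨_, ⟨σ, hσ, τ, hτ, rfl⟩, υ, hυ, by simp [add_assoc]⟩

/-- The computation `f`, started after time `c`. -/
def delay (c : ℕ) (f : RComp α) : RComp α := tick c >>= fun _ => f

theorem mem_delay {c : ℕ} {f : RComp α} {ρ : Run α} :
    ρ ∈ (delay c f).runs ↔ ∃ τ ∈ f.runs, ρ = ⟨τ.bits, τ.value, c + τ.time⟩ := by
  simp only [delay, mem_bind, mem_tick]
  constructor
  · rintro ⟨_, rfl, τ, hτ, rfl⟩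
    exact ⟨τ, hτ, by simp⟩
  · rintro ⟨τ, hτ, rfl⟩
    exact ⟨_, rfl, τ, hτ, by simp⟩

theorem delay_bind (c : ℕ) (f : RComp α) (g : α → RComp β) :
    delay c f >>= g = delay c (f >>= g) := bind_assoc' _ _ _

theorem delay_delay (c d : ℕ) (f : RComp α) : delay c (delay d f) = delay (c + d) f := by
  refine ext_runs fun ρ => ?_
  simp only [mem_delay]
  constructor
  · rintro ⟨_, ⟨τ, hτ, rfl⟩, rfl⟩
    exact ⟨τ, hτ, by simp [add_assoc]⟩
  · rintro ⟨τ, hτ, rfl⟩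
    exact ⟨_, ⟨τ, hτ, rfl⟩, by simp [add_assoc]⟩

/-! ## Algorithms -/

theorem isAlgorithm_pure (a : α) : (pure a : RComp α).IsAlgorithm where
  prefixFree := by
    rintro _ rfl _ rfl _
    rfl
  bits_le_time := by
    rintro _ rfl
    simp

theorem isAlgorithm_tick (c : ℕ) : (tick c).IsAlgorithm where
  prefixFree := by
    rintro _ rfl _ rfl _
    rfl
  bits_le_time := by
    rintro _ rfl
    simp

theorem isAlgorithm_flip : flip.IsAlgorithm where
  prefixFree := by
    rintro _ ⟨b, rfl⟩ _ ⟨c, rfl⟩ h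
    simp only [List.cons_prefix_cons] at h
    rw [h.1]
  bits_le_time := by
    rintro _ ⟨b, rfl⟩
    simp

/-- The first parts of two comparable runs are prefixes of one bit string, hence comparable
themselves, hence equal. Cancelling them leaves a comparison of two runs of the same continuation.
-/
theorem IsAlgorithm.bind {f : RComp α} {g : α → RComp β} (hf : f.IsAlgorithm)
    (hg : ∀ a, (g a).IsAlgorithm) : (f >>= g).IsAlgorithm where
  prefixFree := by
    rintro _ ⟨σ, hσ, τ, hτ, rfl⟩ _ ⟨σ', hσ', τ', hτ', rfl⟩ h
    have h' : σ.bits ++ τ.bits <+: σ'.bits ++ τ'.bits := h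
    have : σ = σ' := by
      rcases List.prefix_or_prefix_of_prefix ((List.prefix_append _ _).trans h')
        (List.prefix_append σ'.bits τ'.bits) with h₁ | h₁
      · exact hf.prefixFree _ hσ _ hσ' h₁
      · exact (hf.prefixFree _ hσ' _ hσ h₁).symm
    subst this
    rw [List.prefix_append_right_inj] at h'
    rw [(hg _).prefixFree _ hτ _ hτ' h']
  bits_le_time := by
    rintro _ ⟨σ, hσ, τ, hτ, rfl⟩
    have h₁ := hf.bits_le_time _ hσ
    have h₂ := (hg _).bits_le_time _ hτ
    simp only [List.length_append]
    omega

theorem IsAlgorithm.delay {f : RComp α} (hf : f.IsAlgorithm) (c : ℕ) :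
    (delay c f).IsAlgorithm := (isAlgorithm_tick c).bind fun _ => hf

/-- A computation that depends on a procedure `s` monotonically, so that every run makes finitely
many calls of `s`, and which is an algorithm if all calls are. -/
structure Admissible (e : (α → RComp β) → RComp γ) : Prop where
  mono : ∀ s t : α → RComp β, (∀ a, (s a).runs ⊆ (t a).runs) → (e s).runs ⊆ (e t).runs
  cont : ∀ s : ℕ → α → RComp β, (∀ a, Monotone fun k => (s k a).runs) →
    ∀ ρ ∈ (e fun a => ({ρ | ∃ k, ρ ∈ (s k a).runs} : Set (Run β))).runs, ∃ k, ρ ∈ (e (s k)).runs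
  alg : ∀ s : α → RComp β, (∀ a, (s a).IsAlgorithm) → (e s).IsAlgorithm

theorem admissible_const {f : RComp γ} (hf : f.IsAlgorithm) :
    Admissible fun _ : α → RComp β => f :=
  ⟨fun _ _ _ => le_rfl, fun _ _ _ h => ⟨0, h⟩, fun _ _ => hf⟩

theorem admissible_self (a : α) : Admissible fun s : α → RComp β => s a :=
  ⟨fun _ _ h => h a, fun _ _ _ h => h, fun _ h => h a⟩

/-- A composed run uses two finite stages of the approximation; monotonicity lifts both parts to the
larger one. -/
theorem Admissible.bind {e : (α → RComp β) → RComp γ} {g : γ → (α → RComp β) → RComp δ}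
    (he : Admissible e) (hg : ∀ c, Admissible (g c)) :
    Admissible fun s => e s >>= fun c => g c s where
  mono := by
    rintro s t h _ ⟨σ, hσ, τ, hτ, rfl⟩
    exact ⟨σ, he.mono _ _ h hσ, τ, (hg _).mono _ _ h hτ, rfl⟩
  cont := by
    rintro s h _ ⟨σ, hσ, τ, hτ, rfl⟩
    obtain ⟨i, hi⟩ := he.cont s h _ hσ
    obtain ⟨j, hj⟩ := (hg _).cont s h _ hτ
    exact ⟨max i j, σ, he.mono _ _ (fun a => h a (le_max_left i j)) hi, τ,
      (hg _).mono _ _ (fun a => h a (le_max_right i j)) hj, rfl⟩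
  alg s h := (he.alg s h).bind fun _ => (hg _).alg s h

theorem Admissible.delay {e : (α → RComp β) → RComp γ} (he : Admissible e) (c : ℕ) :
    Admissible fun s => delay c (e s) := (admissible_const (isAlgorithm_tick c)).bind fun _ => he

theorem Admissible.ite {e e' : (α → RComp β) → RComp γ} (p : Prop) [Decidable p]
    (he : Admissible e) (he' : Admissible e') : Admissible fun s => if p then e s else e' s := by
  by_cases h : p <;> simp [h, he, he']

section Fix

variable {F : (α → RComp β) → α → RComp β}

theorem mem_fix {a : α} {ρ : Run β} : ρ ∈ (fix F a).runs ↔ ∃ k, ρ ∈ (unroll F k a).runs := Iff.rfl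

theorem unroll_mono (hF : ∀ a, Admissible fun s => F s a) (a : α) :
    Monotone fun k => (unroll F k a).runs := by
  refine monotone_nat_of_le_succ fun k => ?_
  induction k generalizing a with
  | zero => exact fun _ h => h.elim
  | succ k ih => exact ((hF a).delay 1).mono _ _ ih

theorem isAlgorithm_unroll (hF : ∀ a, Admissible fun s => F s a) (k : ℕ) (a : α) :
    (unroll F k a).IsAlgorithm := by
  induction k generalizing a with
  | zero => exact ⟨fun _ h => h.elim, fun _ h => h.elim⟩
  | succ k ih => exact ((hF a).delay 1).alg _ ih

/-- Any two runs already occur in a common finite unrolling, because unrollings increase with the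
depth. -/
theorem isAlgorithm_fix (hF : ∀ a, Admissible fun s => F s a) (a : α) :
    (fix F a).IsAlgorithm where
  prefixFree := by
    rintro ρ ⟨i, hi⟩ σ ⟨j, hj⟩ h
    exact (isAlgorithm_unroll hF (max i j) a).prefixFree _
      (unroll_mono hF a (le_max_left i j) hi) _ (unroll_mono hF a (le_max_right i j) hj) h
  bits_le_time := by
    rintro ρ ⟨i, hi⟩
    exact (isAlgorithm_unroll hF i a).bits_le_time _ hi

/-- Kleene's fixed point equation: monotonicity gives one inclusion, continuity the other, since a
run calls the procedure only to a finite depth. All later analysis goes through this equation, never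
through `unroll`. -/
theorem fix_eq (hF : ∀ a, Admissible fun s => F s a) (a : α) :
    fix F a = delay 1 (F (fix F) a) := by
  refine ext_runs fun ρ => ?_
  constructor
  · rintro ⟨k, hk⟩
    cases k with
    | zero => exact hk.elim
    | succ k => exact ((hF a).delay 1).mono _ _ (fun _ _ h => mem_fix.2 ⟨k, h⟩) hk
  · intro h
    obtain ⟨k, hk⟩ := ((hF a).delay 1).cont (unroll F) (unroll_mono hF) ρ h
    exact ⟨k + 1, hk⟩

end Fix

/-! ## Weighted sums over the runs -/

/-- The sum of `H ρ.value ρ.time` over all runs, each with its probability. -/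
noncomputable def wsum (f : RComp α) (H : α → ℕ → ℝ≥0∞) : ℝ≥0∞ :=
  ∑' ρ : f.runs, (2⁻¹ : ℝ≥0∞) ^ ρ.1.bits.length * H ρ.1.value ρ.1.time

theorem expectedTime_eq_wsum (f : RComp α) : f.expectedTime = f.wsum fun _ t => t := rfl

/-- Probability, mass and expected time are all instances of `wsum`, so their composition rules
follow from the one for `wsum`. -/
theorem prob_eq_wsum [DecidableEq α] (f : RComp α) (a : α) :
    f.prob a = f.wsum fun b _ => if b = a then 1 else 0 := by
  unfold prob wsum
  rw [tsum_subtype f.runs (fun ρ : Run α => (2⁻¹ : ℝ≥0∞) ^ ρ.bits.length *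
    if ρ.value = a then 1 else 0)]
  refine (tsum_subtype {ρ : Run α | ρ ∈ f.runs ∧ ρ.value = a}
    (fun ρ : Run α => (2⁻¹ : ℝ≥0∞) ^ ρ.bits.length)).trans (tsum_congr fun ρ => ?_)
  by_cases h₁ : ρ ∈ f.runs <;> by_cases h₂ : ρ.value = a <;> simp [h₁, h₂]

theorem wsum_mono {f : RComp α} {H H' : α → ℕ → ℝ≥0∞} (h : ∀ a t, H a t ≤ H' a t) :
    f.wsum H ≤ f.wsum H' := ENNReal.tsum_le_tsum fun _ => by gcongr; exact h _ _

theorem wsum_add (f : RComp α) (H H' : α → ℕ → ℝ≥0∞) :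
    (f.wsum fun a t => H a t + H' a t) = f.wsum H + f.wsum H' := by
  simp only [wsum, mul_add, ENNReal.tsum_add]

theorem wsum_mul (f : RComp α) (c : ℝ≥0∞) (H : α → ℕ → ℝ≥0∞) :
    (f.wsum fun a t => H a t * c) = f.wsum H * c := by
  simp only [wsum, ← mul_assoc, ENNReal.tsum_mul_right]

theorem wsum_tsum {ι : Type} (f : RComp α) (H : ι → α → ℕ → ℝ≥0∞) :
    (f.wsum fun a t => ∑' i, H i a t) = ∑' i, f.wsum (H i) := by
  simp only [wsum, ← ENNReal.tsum_mul_left]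
  rw [ENNReal.tsum_comm]

/-- The expectation of a function of the value. -/
theorem wsum_value (f : RComp α) (φ : α → ℝ≥0∞) :
    (f.wsum fun a _ => φ a) = ∑' a, f.prob a * φ a := by
  classical
  simp only [prob_eq_wsum, ← wsum_mul, ← wsum_tsum]
  congr 1
  ext a t
  rw [tsum_eq_single a]
  · simp
  · intro b hb
    simp [hb.symm]

theorem wsum_pure (a : α) (H : α → ℕ → ℝ≥0∞) : (pure a : RComp α).wsum H = H a 0 := by
  have := tsum_subtype ({⟨[], a, 0⟩} : Set (Run α))
    (fun ρ : Run α => (2⁻¹ : ℝ≥0∞) ^ ρ.bits.length * H ρ.value ρ.time)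
  refine this.trans ?_
  rw [tsum_eq_single ⟨[], a, 0⟩]
  · simp
  · intro b hb
    simp [hb]

theorem wsum_tick (c : ℕ) (H : Unit → ℕ → ℝ≥0∞) : (tick c).wsum H = H () c := by
  have := tsum_subtype ({⟨[], (), c⟩} : Set (Run Unit))
    (fun ρ : Run Unit => (2⁻¹ : ℝ≥0∞) ^ ρ.bits.length * H ρ.value ρ.time)
  refine this.trans ?_
  rw [tsum_eq_single ⟨[], (), c⟩]
  · simp
  · intro b hb
    simp [hb]

theorem wsum_flip (H : Bool → ℕ → ℝ≥0∞) :
    flip.wsum H = 2⁻¹ * (H true 1 + H false 1) := by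
  have hi : Function.Injective fun b : Bool => (⟨[b], b, 1⟩ : Run Bool) := by
    intro a b h
    simpa using congrArg Run.value h
  have hr : flip.runs = Set.range fun b : Bool => (⟨[b], b, 1⟩ : Run Bool) := by
    ext ρ
    simp [mem_flip, eq_comm (a := ρ)]
  unfold wsum
  rw [hr, tsum_range (fun ρ : Run Bool => (2⁻¹ : ℝ≥0∞) ^ ρ.bits.length * H ρ.value ρ.time) hi]
  simp [tsum_fintype, mul_add]

/-- Concatenation of runs is injective because the first computation is prefix-free, so the sum over
composed runs is an iterated sum. The weights multiply since lengths add. -/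
theorem wsum_bind {f : RComp α} (hf : f.IsAlgorithm) (g : α → RComp β) (H : β → ℕ → ℝ≥0∞) :
    (f >>= g).wsum H = f.wsum fun a t => (g a).wsum fun b s => H b (t + s) := by
  let m : (Σ σ : f.runs, (g σ.1.value).runs) → Run β := fun p =>
    ⟨p.1.1.bits ++ p.2.1.bits, p.2.1.value, p.1.1.time + p.2.1.time⟩
  have hm : Function.Injective m := by
    rintro ⟨⟨σ, hσ⟩, τ, hτ⟩ ⟨⟨σ', hσ'⟩, τ', hτ'⟩ h
    simp only [m, Run.mk.injEq] at h
    obtain ⟨h₁, h₂, h₃⟩ := h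
    have : σ = σ' := by
      rcases List.prefix_or_prefix_of_prefix (List.prefix_append σ.bits τ.bits)
        (h₁ ▸ List.prefix_append σ'.bits τ'.bits) with h | h
      · exact hf.prefixFree _ hσ _ hσ' h
      · exact (hf.prefixFree _ hσ' _ hσ h).symm
    subst this
    have : τ = τ' := Run.ext (by simpa using h₁) h₂ (by simpa using h₃)
    subst this
    rfl
  have hr : (f >>= g).runs = Set.range m := by
    ext ρ
    simp only [mem_bind, Set.mem_range, m]
    constructor
    · rintro ⟨σ, hσ, τ, hτ, rfl⟩
      exact ⟨⟨⟨σ, hσ⟩, τ, hτ⟩, rfl⟩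
    · rintro ⟨⟨⟨σ, hσ⟩, τ, hτ⟩, rfl⟩
      exact ⟨σ, hσ, τ, hτ, rfl⟩
  unfold wsum
  rw [hr, tsum_range (fun ρ : Run β => (2⁻¹ : ℝ≥0∞) ^ ρ.bits.length * H ρ.value ρ.time) hm,
    ENNReal.tsum_sigma' _]
  refine tsum_congr fun σ => ?_
  rw [← ENNReal.tsum_mul_left]
  refine tsum_congr fun τ => ?_
  simp only [m, List.length_append, pow_add]
  ring

theorem wsum_delay (c : ℕ) (f : RComp α) (H : α → ℕ → ℝ≥0∞) :
    (delay c f).wsum H = f.wsum fun a t => H a (c + t) := by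
  rw [delay, wsum_bind (isAlgorithm_tick c), wsum_tick]

/-- The probability that the computation stops. -/
noncomputable def mass (f : RComp α) : ℝ≥0∞ := f.wsum fun _ _ => 1

theorem mass_eq_tsum (f : RComp α) : f.mass = ∑' a, f.prob a := by
  rw [mass, wsum_value f fun _ => 1]
  simp only [mul_one]

/-- Kraft's inequality. -/
theorem sum_le_one_of_prefixFree (S : Finset (List Bool))
    (h : ∀ x ∈ S, ∀ y ∈ S, x <+: y → x = y) : ∑ x ∈ S, (2⁻¹ : ℝ≥0∞) ^ x.length ≤ 1 := by
  obtain ⟨n, hn⟩ : ∃ n, ∀ x ∈ S, x.length ≤ n := ⟨S.sup List.length, fun x hx =>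
    Finset.le_sup (f := List.length) hx⟩
  induction n generalizing S with
  | zero =>
    have : S ⊆ {[]} := fun x hx => by simpa using hn x hx
    exact (Finset.sum_le_sum_of_subset this).trans (by simp)
  | succ n ih =>
    -- The empty word is a prefix of everything, so it can only occur alone. Otherwise the words are
    -- separated by their first bit, and each half loses one bit and a factor 1/2.
    by_cases h0 : [] ∈ S
    · have : S ⊆ {[]} := fun x hx => by simpa using (h _ h0 x hx List.nil_prefix).symm
      exact (Finset.sum_le_sum_of_subset this).trans (by simp)
    let t : Bool → Finset (List Bool) := fun b =>
      S.preimage (List.cons b) (List.cons_injective.injOn)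
    have ht : ∀ b, ∑ x ∈ t b, (2⁻¹ : ℝ≥0∞) ^ x.length ≤ 1 := fun b => by
      refine ih (t b) (fun x hx y hy hxy => ?_) (fun x hx => ?_)
      · simpa using h _ (Finset.mem_preimage.1 hx) _ (Finset.mem_preimage.1 hy)
          (List.cons_prefix_cons.2 ⟨rfl, hxy⟩)
      · simpa using hn _ (Finset.mem_preimage.1 hx)
    have hS : S ⊆ (t true).image (List.cons true) ∪ (t false).image (List.cons false) := by
      intro x hx
      match x, hx with
      | [], hx => exact (h0 hx).elim
      | true :: x, hx => simp [t, hx]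
      | false :: x, hx => simp [t, hx]
    have key : ∀ b, ∑ x ∈ (t b).image (List.cons b), (2⁻¹ : ℝ≥0∞) ^ x.length ≤ 2⁻¹ := fun b => by
      rw [Finset.sum_image (List.cons_injective.injOn)]
      simp only [List.length_cons, pow_succ, ← Finset.sum_mul]
      exact (mul_le_mul_left (ht b) _).trans (by simp)
    calc ∑ x ∈ S, (2⁻¹ : ℝ≥0∞) ^ x.length
        ≤ ∑ x ∈ (t true).image (List.cons true) ∪ (t false).image (List.cons false),
          (2⁻¹ : ℝ≥0∞) ^ x.length := Finset.sum_le_sum_of_subset hS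
      _ ≤ ∑ x ∈ (t true).image (List.cons true), (2⁻¹ : ℝ≥0∞) ^ x.length +
          ∑ x ∈ (t false).image (List.cons false), (2⁻¹ : ℝ≥0∞) ^ x.length := by
        rw [← Finset.sum_union_inter]
        exact le_self_add
      _ ≤ 2⁻¹ + 2⁻¹ := add_le_add (key _) (key _)
      _ = 1 := ENNReal.inv_two_add_inv_two

/-- Kraft's inequality on finite sets of runs; the bits determine the run, so no word is counted
twice. -/
theorem IsAlgorithm.mass_le_one {f : RComp α} (hf : f.IsAlgorithm) : f.mass ≤ 1 := by
  classical
  unfold mass wsum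
  rw [ENNReal.tsum_eq_iSup_sum]
  refine iSup_le fun S => ?_
  have hinj : Set.InjOn (fun ρ : f.runs => ρ.1.bits) S := fun ρ _ σ _ h =>
    Subtype.ext (hf.prefixFree _ ρ.2 _ σ.2 (by simp [show ρ.1.bits = σ.1.bits from h]))
  have := sum_le_one_of_prefixFree (S.image fun ρ => ρ.1.bits) (by
    intro x hx y hy hxy
    obtain ⟨ρ, -, rfl⟩ := Finset.mem_image.1 hx
    obtain ⟨σ, -, rfl⟩ := Finset.mem_image.1 hy
    rw [hf.prefixFree _ ρ.2 _ σ.2 hxy])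
  rw [Finset.sum_image hinj] at this
  simpa using this

theorem IsAlgorithm.prob_le_one {f : RComp α} (hf : f.IsAlgorithm) (a : α) : f.prob a ≤ 1 :=
  (ENNReal.le_tsum a).trans (f.mass_eq_tsum ▸ hf.mass_le_one)

theorem IsAlgorithm.prob_ne_top {f : RComp α} (hf : f.IsAlgorithm) (a : α) : f.prob a ≠ ⊤ :=
  ((hf.prob_le_one a).trans_lt ENNReal.one_lt_top).ne

theorem prob_pure [DecidableEq α] (a b : α) :
    (pure a : RComp α).prob b = if a = b then 1 else 0 := by
  rw [prob_eq_wsum, wsum_pure]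

theorem prob_delay (c : ℕ) (f : RComp α) (a : α) : (delay c f).prob a = f.prob a := by
  classical
  rw [prob_eq_wsum, prob_eq_wsum, wsum_delay]

theorem mass_delay (c : ℕ) (f : RComp α) : (delay c f).mass = f.mass := by
  rw [mass, mass, wsum_delay]

theorem mass_pure (a : α) : (pure a : RComp α).mass = 1 := by
  rw [mass, wsum_pure]

theorem prob_flip_bind (g : Bool → RComp α) (a : α) :
    (flip >>= g).prob a = 2⁻¹ * ((g true).prob a + (g false).prob a) := by
  classical
  simp only [prob_eq_wsum]
  rw [wsum_bind isAlgorithm_flip, wsum_flip]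

theorem prob_bind {f : RComp α} (hf : f.IsAlgorithm) (g : α → RComp β) (b : β) :
    (f >>= g).prob b = ∑' a, f.prob a * (g a).prob b := by
  classical
  rw [← wsum_value, prob_eq_wsum, wsum_bind hf]
  simp only [← prob_eq_wsum]

theorem mass_bind {f : RComp α} (hf : f.IsAlgorithm) (g : α → RComp β) :
    (f >>= g).mass = ∑' a, f.prob a * (g a).mass := by
  rw [← wsum_value, mass, wsum_bind hf]
  rfl

theorem expectedTime_pure (a : α) : (pure a : RComp α).expectedTime = 0 := by
  rw [expectedTime_eq_wsum, wsum_pure, Nat.cast_zero]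

/-- Only an inequality: the delay is charged to completed runs, whose total mass may be below 1. -/
theorem expectedTime_delay_le {f : RComp α} (hf : f.IsAlgorithm) (c : ℕ) :
    (delay c f).expectedTime ≤ c + f.expectedTime := by
  simp only [expectedTime_eq_wsum, wsum_delay, Nat.cast_add, wsum_add]
  gcongr
  have := f.wsum_mul c fun _ _ => 1
  simp only [one_mul] at this
  rw [this]
  exact (mul_le_mul_left hf.mass_le_one _).trans (by simp)

theorem expectedTime_bind_le {f : RComp α} (hf : f.IsAlgorithm) {g : α → RComp β}
    (hg : ∀ a, (g a).IsAlgorithm) :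
    (f >>= g).expectedTime ≤ f.expectedTime + ∑' a, f.prob a * (g a).expectedTime := by
  rw [← wsum_value, expectedTime_eq_wsum, expectedTime_eq_wsum, wsum_bind hf, ← wsum_add]
  refine wsum_mono fun a t => ?_
  have := expectedTime_delay_le (hg a) t
  rwa [expectedTime_eq_wsum, wsum_delay] at this

/-- The bound on the continuation is needed only at values that occur with positive probability,
which later allows the use of invariants of the first stage. -/
theorem expectedTime_bind_le_add {f : RComp α} (hf : f.IsAlgorithm) {g : α → RComp β}
    (hg : ∀ a, (g a).IsAlgorithm) {C : ℝ≥0∞} (h : ∀ a, f.prob a ≠ 0 → (g a).expectedTime ≤ C) :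
    (f >>= g).expectedTime ≤ f.expectedTime + C := by
  refine (expectedTime_bind_le hf hg).trans ?_
  gcongr
  calc ∑' a, f.prob a * (g a).expectedTime ≤ ∑' a, f.prob a * C :=
        ENNReal.tsum_le_tsum fun a => by
          by_cases h0 : f.prob a = 0
          · simp [h0]
          · gcongr
            exact h a h0
    _ = f.mass * C := by rw [ENNReal.tsum_mul_right, mass_eq_tsum]
    _ ≤ C := (mul_le_mul_left hf.mass_le_one _).trans (by simp)

theorem expectedTime_flip_bind_le {g : Bool → RComp α} (hg : ∀ a, (g a).IsAlgorithm) :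
    (flip >>= g).expectedTime ≤
      1 + 2⁻¹ * ((g true).expectedTime + (g false).expectedTime) := by
  rw [expectedTime_eq_wsum, wsum_bind isAlgorithm_flip, wsum_flip]
  have h : ∀ b, ((g b).wsum fun _ s => ((1 + s : ℕ) : ℝ≥0∞)) ≤ 1 + (g b).expectedTime := fun b => by
    have := expectedTime_delay_le (hg b) 1
    rwa [expectedTime_eq_wsum, wsum_delay, Nat.cast_one] at this
  calc _ ≤ 2⁻¹ * ((1 + (g true).expectedTime) + (1 + (g false).expectedTime)) := by
        gcongr
        · exact h true
        · exact h false
    _ = 2⁻¹ * (2 + ((g true).expectedTime + (g false).expectedTime)) := by ring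
    _ = _ := by
      rw [mul_add, ENNReal.inv_mul_cancel (by simp) (by simp)]

/-- Induction for bounds on the expected running time of a recursive procedure. -/
theorem expectedTime_fix_induction {F : (α → RComp β) → α → RComp β}
    (hF : ∀ a, Admissible fun s => F s a) (P : (α → ℝ≥0∞) → Prop) (h0 : P fun _ => 0)
    (hP : ∀ s : α → RComp β, (∀ a, (s a).IsAlgorithm) → P (fun a => (s a).expectedTime) →
      P fun a => (delay 1 (F s a)).expectedTime)
    {a : α} {C : ℝ≥0∞} (hC : ∀ T, P T → T a ≤ C) : (fix F a).expectedTime ≤ C := by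
  classical
  have hk : ∀ k, P fun a => (unroll F k a).expectedTime := fun k => by
    induction k with
    | zero =>
      have : (fun a => (unroll F 0 a).expectedTime) = fun _ => 0 := by
        ext a
        unfold expectedTime
        rw [ENNReal.tsum_eq_zero]
        rintro ⟨ρ, hρ⟩
        exact hρ.elim
      rwa [this]
    | succ k ih => exact hP _ (isAlgorithm_unroll hF k) ih
  have hk' := fun k => hC _ (hk k)
  rw [expectedTime, ENNReal.tsum_eq_iSup_sum]
  refine iSup_le fun S => ?_
  -- Finitely many runs of the recursive procedure fit into one unrolling, whose expected time then
  -- dominates this partial sum.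
  obtain ⟨k, hS⟩ : ∃ k, ∀ ρ ∈ S, ρ.1 ∈ (unroll F k a).runs := by
    induction S using Finset.induction_on with
    | empty => exact ⟨0, by simp⟩
    | insert ρ S _ ih =>
      obtain ⟨i, hi⟩ := ih
      obtain ⟨j, hj⟩ := ρ.2
      refine ⟨max i j, fun σ hσ => ?_⟩
      rcases Finset.mem_insert.1 hσ with rfl | h
      · exact unroll_mono hF a (le_max_right i j) hj
      · exact unroll_mono hF a (le_max_left i j) (hi σ h)
  refine le_trans ?_ (hk' k)
  unfold expectedTime
  let w : Run β → ℝ≥0∞ := fun ρ => (2⁻¹ : ℝ≥0∞) ^ ρ.bits.length * (ρ.time : ℝ≥0∞)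
  let S' : Finset (unroll F k a).runs :=
    S.attach.image fun ρ => ⟨ρ.1.1, hS ρ.1 ρ.2⟩
  have : ∑ ρ ∈ S', w ρ.1 = ∑ ρ ∈ S, w ρ.1 := by
    rw [Finset.sum_image, Finset.sum_attach S fun ρ => w ρ.1]
    intro x _ y _ h
    exact Subtype.ext (Subtype.ext (congrArg (fun z => z.1) h))
  exact this.symm.le.trans (ENNReal.sum_le_tsum S')

/-- A bound on the expected running time of a recursive procedure by a potential. -/
theorem expectedTime_fix_le {F : (α → RComp β) → α → RComp β}
    (hF : ∀ a, Admissible fun s => F s a) (Φ : α → ℝ≥0∞) (Q : α → Prop)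
    (hΦ : ∀ s : α → RComp β, (∀ a, (s a).IsAlgorithm) →
      (∀ a, Q a → (s a).expectedTime ≤ Φ a) → ∀ a, Q a → (F s a).expectedTime + 1 ≤ Φ a)
    {a : α} (ha : Q a) : (fix F a).expectedTime ≤ Φ a := by
  refine expectedTime_fix_induction hF (fun T => ∀ a, Q a → T a ≤ Φ a) (by simp) ?_
    fun T hT => hT a ha
  intro s hs h a ha
  refine (expectedTime_delay_le ((hF a).alg s hs) 1).trans ?_
  rw [Nat.cast_one, add_comm]
  exact hΦ s hs h a ha

end RComp

open RComp BigNat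

variable {α β γ : Type}

/-! ## Deterministic procedures -/

/-- The computation `f` reads no bits and returns `v` in time at most `c`. -/
def Returns (f : RComp α) (v : α) (c : ℕ) : Prop := ∃ d ≤ c, f = delay d (pure v)

namespace Returns

theorem pure (v : α) : Returns (Pure.pure v) v 0 :=
  ⟨0, le_rfl, ext_runs fun ρ => by simp [mem_delay, mem_pure]⟩

theorem bind {f : RComp α} {g : α → RComp β} {v : α} {u : β} {c d : ℕ} (hf : Returns f v c)
    (hg : Returns (g v) u d) : Returns (f >>= g) u (c + d) := by
  obtain ⟨c', hc, rfl⟩ := hf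
  obtain ⟨d', hd, hg⟩ := hg
  exact ⟨c' + d', add_le_add hc hd, by rw [delay_bind, pure_bind', hg, delay_delay]⟩

theorem map {f : RComp α} {k : α → β} {v : α} {c : ℕ} (hf : Returns f v c) {u : β}
    (h : k v = u) : Returns (f >>= fun a => Pure.pure (k a)) u c := by
  subst h
  exact hf.bind (g := fun a => Pure.pure (k a)) (Returns.pure _)

theorem mono {f : RComp α} {v : α} {c d : ℕ} (hf : Returns f v c) (h : c ≤ d) : Returns f v d := by
  obtain ⟨c', hc, rfl⟩ := hf
  exact ⟨c', hc.trans h, rfl⟩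

theorem delay {f : RComp α} {v : α} {c : ℕ} (hf : Returns f v c) (d : ℕ) :
    Returns (delay d f) v (d + c) := by
  obtain ⟨c', hc, rfl⟩ := hf
  exact ⟨d + c', by omega, delay_delay _ _ _⟩

theorem isAlgorithm {f : RComp α} {v : α} {c : ℕ} (hf : Returns f v c) : f.IsAlgorithm := by
  obtain ⟨c', hc, rfl⟩ := hf
  exact (isAlgorithm_pure v).delay c'

theorem bind_eq {f : RComp α} {v : α} {c : ℕ} (hf : Returns f v c) (g : α → RComp β) :
    ∃ d ≤ c, f >>= g = RComp.delay d (g v) := by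
  obtain ⟨c', hc, rfl⟩ := hf
  exact ⟨c', hc, by rw [delay_bind, pure_bind']⟩

end Returns

/-! ### Costs of arithmetic and values of the deterministic programs. -/

section Arithmetic

variable {w : ℕ}

/-- The number of words of `w` bits that `x` takes. -/
def words (w x : ℕ) : ℕ := 1 + Nat.size x / w

theorem one_le_words (w x : ℕ) : 1 ≤ words w x := Nat.le_add_right _ _

theorem blocks_le_words {a : BigNat w} {X : ℕ} (h : a.val ≤ X) : a.blocks ≤ words w X :=
  Nat.add_le_add_left (Nat.div_le_div_right (Nat.size_le_size h)) _

theorem blocks_mul_le {a b : BigNat w} {X : ℕ} (ha : a.val ≤ X) (hb : b.val ≤ X) :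
    a.blocks * b.blocks ≤ words w X ^ 2 := by
  rw [sq]
  exact Nat.mul_le_mul (blocks_le_words ha) (blocks_le_words hb)

/-- A single bound `X` for all operands lets a whole program be charged by its number of operations
times `words w X ^ 2`. -/
theorem returns_op (f : ℕ → ℕ → ℕ) {a b : BigNat w} {X : ℕ} (ha : a.val ≤ X) (hb : b.val ≤ X) :
    Returns (op f a b) ⟨f a.val b.val⟩ (words w X ^ 2) := ⟨_, blocks_mul_le ha hb, rfl⟩

theorem returns_add {a b : BigNat w} {X : ℕ} (ha : a.val ≤ X) (hb : b.val ≤ X) :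
    Returns (add a b) ⟨a.val + b.val⟩ (words w X ^ 2) := returns_op _ ha hb

theorem returns_sub {a b : BigNat w} {X : ℕ} (ha : a.val ≤ X) (hb : b.val ≤ X) :
    Returns (sub a b) ⟨a.val - b.val⟩ (words w X ^ 2) := returns_op _ ha hb

theorem returns_mul {a b : BigNat w} {X : ℕ} (ha : a.val ≤ X) (hb : b.val ≤ X) :
    Returns (mul a b) ⟨a.val * b.val⟩ (words w X ^ 2) := returns_op _ ha hb

theorem returns_div {a b : BigNat w} {X : ℕ} (ha : a.val ≤ X) (hb : b.val ≤ X) :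
    Returns (div a b) ⟨a.val / b.val⟩ (words w X ^ 2) := returns_op _ ha hb

theorem returns_le {a b : BigNat w} {X : ℕ} (ha : a.val ≤ X) (hb : b.val ≤ X) :
    Returns (le a b) (decide (a.val ≤ b.val)) (words w X ^ 2) := ⟨_, blocks_mul_le ha hb, rfl⟩

theorem isAlgorithm_op (f : ℕ → ℕ → ℕ) (a b : BigNat w) : (op f a b).IsAlgorithm :=
  (returns_op f (le_max_left _ _) (le_max_right _ _)).isAlgorithm

theorem isAlgorithm_le (a b : BigNat w) : (le a b).IsAlgorithm :=
  (returns_le (le_max_left _ _) (le_max_right _ _)).isAlgorithm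

theorem isAlgorithm_bit : (bit : RComp (BigNat w)).IsAlgorithm :=
  isAlgorithm_flip.bind fun _ => isAlgorithm_pure _

theorem isAlgorithm_divPow (t d c : BigNat w) : (divPow t d c).IsAlgorithm := by
  refine isAlgorithm_fix (fun x => ?_) _
  refine (admissible_const (isAlgorithm_le _ _)).bind fun _ => ?_
  refine Admissible.ite _ (admissible_const (isAlgorithm_pure _)) ?_
  refine (admissible_const (isAlgorithm_le _ _)).bind fun _ => ?_
  refine Admissible.ite _ (admissible_const (isAlgorithm_pure _)) ?_
  refine (admissible_const (isAlgorithm_op _ _ _)).bind fun _ => ?_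
  exact (admissible_const (isAlgorithm_op _ _ _)).bind fun _ => admissible_self _

theorem divPow_eq (t d c : BigNat w) : divPow t d c = RComp.delay 1 (le t ⟨0⟩ >>= fun b =>
    if b = true then Pure.pure t else le c ⟨0⟩ >>= fun b =>
      if b = true then Pure.pure t else div t d >>= fun t' => sub c ⟨1⟩ >>= fun c' =>
        divPow t' d c') := by
  refine fix_eq (fun x => ?_) _
  refine (admissible_const (isAlgorithm_le _ _)).bind fun _ => ?_
  refine Admissible.ite _ (admissible_const (isAlgorithm_pure _)) ?_
  refine (admissible_const (isAlgorithm_le _ _)).bind fun _ => ?_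
  refine Admissible.ite _ (admissible_const (isAlgorithm_pure _)) ?_
  refine (admissible_const (isAlgorithm_op _ _ _)).bind fun _ => ?_
  exact (admissible_const (isAlgorithm_op _ _ _)).bind fun _ => admissible_self _

/-- The cost depends on the bit length of `t` and not on the exponent: the loop stops as soon as the
quotient is 0, and each division by a number ≥ 2 removes a bit. This makes the time of the weights
independent of `k` and `l` apart from word sizes. -/
theorem returns_divPow {t d c : BigNat w} {X : ℕ} (ht : t.val ≤ X) (hd : d.val ≤ X)
    (hc : c.val ≤ X) (hX : 1 ≤ X) (hd2 : 2 ≤ d.val) :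
    Returns (divPow t d c) ⟨t.val / d.val ^ c.val⟩
      (5 * (Nat.size t.val + 1) * words w X ^ 2) := by
  have hQ : 1 ≤ words w X ^ 2 := Nat.one_le_pow _ _ (one_le_words w X)
  obtain ⟨c, rfl⟩ : ∃ k, c = ⟨k⟩ := ⟨c.val, rfl⟩
  induction c generalizing t with
  | zero =>
    rw [divPow_eq]
    refine (((returns_le ht (Nat.zero_le X)).bind
      (d := words w X ^ 2) ?_).delay 1).mono (by nlinarith)
    simp only [decide_eq_true_eq]
    split_ifs with h
    · simpa using (Returns.pure t).mono (Nat.zero_le _)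
    · refine ((returns_le hc (Nat.zero_le X)).bind (d := 0) ?_)
      simpa using Returns.pure t
  | succ c ih =>
    rw [divPow_eq]
    by_cases h : t.val = 0
    · refine (((returns_le ht (Nat.zero_le X)).bind (d := 0) ?_).delay 1).mono (by nlinarith)
      obtain ⟨t⟩ := t
      obtain rfl : t = 0 := h
      simpa using Returns.pure _
    · have hlt : Nat.size (t.val / d.val) + 1 ≤ Nat.size t.val := by
        have h1 : t.val < 2 ^ Nat.size t.val := Nat.lt_size_self _
        have h2 : 0 < Nat.size t.val := Nat.size_pos.2 (Nat.pos_of_ne_zero h)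
        obtain ⟨s, hs⟩ := Nat.exists_eq_succ_of_ne_zero h2.ne'
        rw [hs] at h1 ⊢
        refine Nat.succ_le_succ (Nat.size_le.2 ?_)
        rw [Nat.div_lt_iff_lt_mul (by omega)]
        calc t.val < 2 ^ (s + 1) := h1
          _ ≤ 2 ^ s * d.val := by rw [pow_succ]; gcongr
      have hc' : c ≤ X := (Nat.le_succ c).trans hc
      have ht' : t.val / d.val ≤ X := (Nat.div_le_self _ _).trans ht
      have := ih (t := ⟨t.val / d.val⟩) ht' hc'
      refine (((returns_le ht (Nat.zero_le X)).bind (d := words w X ^ 2 + (words w X ^ 2 +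
        (words w X ^ 2 + 5 * (Nat.size (t.val / d.val) + 1) * words w X ^ 2)))
        ?_).delay 1).mono (by nlinarith)
      simp only [nonpos_iff_eq_zero, h, decide_false, Bool.false_eq_true, if_false]
      refine (returns_le hc (Nat.zero_le X)).bind ?_
      simp only [nonpos_iff_eq_zero, Nat.add_eq_zero_iff, one_ne_zero, and_false, decide_false,
        Bool.false_eq_true, if_false]
      refine (returns_div ht hd).bind ((returns_sub hc hX).bind ?_)
      simpa [pow_succ', Nat.div_div_eq_div_mul] using this

/-- `D + ∑_{2 ≤ i ≤ N} ⌊D / i ^ (2k)⌋`. -/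
def zetaSumVal (D k N : ℕ) : ℕ := D + ∑ i ∈ Finset.Ico 2 (N + 1), D / (i * i) ^ k

/-- `⌊D / ((2k - 1) i ^ (2k - 1))⌋`. -/
def zetaTailVal (D k i : ℕ) : ℕ := D / i / (i * i) ^ (k - 1) / (k + (k - 1))

/-- The lower bound for `D ζ(2k)`. -/
def zetaLo (D k N : ℕ) : ℕ := zetaSumVal D k N + zetaTailVal D k (N + 1)

/-- The upper bound for `D ζ(2k)`. -/
def zetaHi (D k N : ℕ) : ℕ := zetaSumVal D k N + N + zetaTailVal D k N

/-- The lower bound for `D² (1 - 4⁻ᵏ) ζ(2k)`. -/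
def factorLo (D k N : ℕ) : ℕ := zetaLo D k N * (D - D / 4 ^ k - 1)

/-- The upper bound for `D² (1 - 4⁻ᵏ) ζ(2k)`. -/
def factorHi (D k N : ℕ) : ℕ := zetaHi D k N * (D - D / 4 ^ k)

/-- The lower bound for `D⁴ 4⁻ˡ f_k`. -/
def weightLo (l D N k : ℕ) : ℕ := factorLo D k N * factorLo D (l - k) N

/-- The upper bound for `D⁴ 4⁻ˡ f_k`. -/
def weightHi (l D N k : ℕ) : ℕ := factorHi D k N * factorHi D (l - k) N

theorem zetaTailVal_le (D k i : ℕ) : zetaTailVal D k i ≤ D :=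
  ((Nat.div_le_self _ _).trans (Nat.div_le_self _ _)).trans (Nat.div_le_self _ _)

theorem zetaSumVal_le (D k N : ℕ) : zetaSumVal D k N ≤ D * (N + 1) := by
  have : ∑ i ∈ Finset.Ico 2 (N + 1), D / (i * i) ^ k ≤ N * D := by
    refine (Finset.sum_le_card_nsmul _ _ D fun i _ => Nat.div_le_self _ _).trans ?_
    simp only [Nat.card_Ico, smul_eq_mul]
    gcongr
    omega
  unfold zetaSumVal
  linarith

/-- Crude sizes, used only to bound the operands; the precision of the enclosures is treated later.
-/
theorem zetaLo_le_zetaHi_aux {D N : ℕ} (k : ℕ) (hD : 1 ≤ D) :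
    zetaLo D k N ≤ D * (2 * N + 2) ∧ zetaHi D k N ≤ D * (2 * N + 2) := by
  have h1 := zetaSumVal_le D k N
  have h2 := zetaTailVal_le D k N
  have h3 := zetaTailVal_le D k (N + 1)
  unfold zetaLo zetaHi
  constructor <;> nlinarith

theorem factor_le {D N : ℕ} (k : ℕ) (hD : 1 ≤ D) :
    factorLo D k N ≤ D ^ 2 * (2 * N + 2) ∧ factorHi D k N ≤ D ^ 2 * (2 * N + 2) := by
  obtain ⟨h1, h2⟩ := zetaLo_le_zetaHi_aux (N := N) k hD
  have h3 : D ^ 2 * (2 * N + 2) = D * (2 * N + 2) * D := by ring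
  rw [h3]
  exact ⟨Nat.mul_le_mul h1 ((Nat.sub_le _ _).trans (Nat.sub_le _ _)),
    Nat.mul_le_mul h2 (Nat.sub_le _ _)⟩

theorem weight_le {D N : ℕ} (l k : ℕ) (hD : 1 ≤ D) :
    weightLo l D N k ≤ D ^ 4 * (2 * N + 2) ^ 2 ∧ weightHi l D N k ≤ D ^ 4 * (2 * N + 2) ^ 2 := by
  have h3 : D ^ 4 * (2 * N + 2) ^ 2 = D ^ 2 * (2 * N + 2) * (D ^ 2 * (2 * N + 2)) := by ring
  rw [h3]
  exact ⟨Nat.mul_le_mul (factor_le _ hD).1 (factor_le _ hD).1,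
    Nat.mul_le_mul (factor_le _ hD).2 (factor_le _ hD).2⟩

/-- Hiding the body behind an existential leaves three usable facts: the loop is a `fix`, its body
is admissible, and the body has the displayed equation. The other `_eq_fix` lemmas have the same
role. -/
theorem zetaSum_eq_fix (D k N : BigNat w) : ∃ F, zetaSum D k N = fix F (⟨2⟩, D) ∧
    (∀ a, Admissible fun s => F s a) ∧ ∀ s i S, F s (i, S) = (le i N >>= fun b =>
      if b = true then mul i i >>= fun d => divPow D d k >>= fun t => add S t >>= fun S' =>
        add i ⟨1⟩ >>= fun i' => s (i', S')
      else Pure.pure S) := by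
  refine ⟨_, rfl, fun x => ?_, fun _ _ _ => rfl⟩
  refine (admissible_const (isAlgorithm_le _ _)).bind fun _ => ?_
  refine Admissible.ite _ ?_ (admissible_const (isAlgorithm_pure _))
  refine (admissible_const (isAlgorithm_op _ _ _)).bind fun _ => ?_
  refine (admissible_const (isAlgorithm_divPow _ _ _)).bind fun _ => ?_
  refine (admissible_const (isAlgorithm_op _ _ _)).bind fun _ => ?_
  exact (admissible_const (isAlgorithm_op _ _ _)).bind fun _ => admissible_self _

theorem isAlgorithm_zetaSum (D k N : BigNat w) : (zetaSum D k N).IsAlgorithm := by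
  obtain ⟨F, h, hF, -⟩ := zetaSum_eq_fix D k N
  rw [h]
  exact isAlgorithm_fix hF _

theorem returns_zetaSum {D k N : BigNat w} {X : ℕ} (hk : k.val ≤ X) (hN1 : 1 ≤ N.val)
    (hD : 1 ≤ D.val) (hX : D.val * (2 * N.val + 2) ^ 2 ≤ X) :
    Returns (zetaSum D k N) ⟨zetaSumVal D.val k.val N.val⟩
      (5 * (N.val + 1) * (Nat.size D.val + 2) * words w X ^ 2) := by
  have hQ : 1 ≤ words w X ^ 2 := Nat.one_le_pow _ _ (one_le_words w X)
  obtain ⟨F, h, hF, hF'⟩ := zetaSum_eq_fix D k N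
  rw [h]
  have hNX : (N.val + 1) * (N.val + 1) ≤ X := by nlinarith
  have hDX : D.val * (N.val + 1) ≤ X := by nlinarith
  -- Here `j` is the number of indices still to be summed. The invariant on `S` reserves room for
  -- `j` further terms of size at most `D`, so all partial sums stay below `X`.
  have key : ∀ j i S : ℕ, 2 ≤ i → i + j = N.val + 1 → S + D.val * j ≤ D.val * (N.val + 1) →
      Returns (fix F (⟨i⟩, ⟨S⟩)) ⟨S + ∑ x ∈ Finset.Ico i (N.val + 1), D.val / (x * x) ^ k.val⟩
        (5 * (j + 1) * (Nat.size D.val + 2) * words w X ^ 2) := by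
    intro j
    induction j with
    | zero =>
      intro i S hi hij hS
      rw [fix_eq hF, hF']
      refine (((returns_le (X := X) ?_ ?_).bind (d := 0) ?_).delay 1).mono (by nlinarith)
      · show i ≤ X
        nlinarith
      · nlinarith
      · have h1 : N.val < i := by omega
        have h2 : Finset.Ico i (N.val + 1) = ∅ := Finset.Ico_eq_empty (by omega)
        simp only [not_le.2 h1, decide_false, Bool.false_eq_true, if_false, h2, Finset.sum_empty,
          add_zero]
        exact Returns.pure _
    | succ j ih =>
      intro i S hi hij hS
      have h1 : i ≤ N.val := by omega
      have hdiv : D.val / (i * i) ^ k.val ≤ D.val := Nat.div_le_self _ _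
      have hrec := ih (i + 1) (S + D.val / (i * i) ^ k.val) (by omega) (by omega) (by nlinarith)
      have hii : i * i ≤ X := by nlinarith
      have hiX : i ≤ X := by nlinarith
      have hDX' : D.val ≤ X := by nlinarith
      rw [fix_eq hF, hF']
      refine (((returns_le (X := X) hiX ?_).bind (d := words w X ^ 2 +
        (5 * (Nat.size D.val + 1) * words w X ^ 2 + (words w X ^ 2 + (words w X ^ 2 +
          5 * (j + 1) * (Nat.size D.val + 2) * words w X ^ 2)))) ?_).delay 1).mono (by nlinarith)
      · nlinarith
      simp only [h1, decide_true, if_true]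
      refine (returns_mul hiX hiX).bind
        ((returns_divPow hDX' hii hk (by omega) (by nlinarith)).bind
        ((returns_add ?_ ?_).bind ((returns_add hiX (by show 1 ≤ X; omega)).bind ?_)))
      · show S ≤ X
        nlinarith
      · exact hdiv.trans hDX'
      rwa [add_assoc, ← Finset.sum_eq_sum_Ico_succ_bot (by omega : i < N.val + 1)
        fun x => D.val / (x * x) ^ k.val] at hrec
  have := key (N.val - 1) 2 D.val le_rfl (by omega) (by
    obtain ⟨n, hn⟩ := Nat.exists_eq_add_of_le hN1
    rw [hn, Nat.add_sub_cancel_left]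
    nlinarith)
  refine this.mono ?_
  gcongr
  omega

theorem isAlgorithm_zetaTail (D k i : BigNat w) : (zetaTail D k i).IsAlgorithm :=
  (isAlgorithm_op _ _ _).bind fun _ => (isAlgorithm_op _ _ _).bind fun _ =>
    (isAlgorithm_op _ _ _).bind fun _ => (isAlgorithm_divPow _ _ _).bind fun _ =>
    (isAlgorithm_op _ _ _).bind fun _ => isAlgorithm_op _ _ _

theorem returns_zetaTail {D k i : BigNat w} {X : ℕ} (hi : 2 ≤ i.val) (hiX : i.val * i.val ≤ X)
    (hDX : D.val ≤ X) (hk : 2 * k.val ≤ X) :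
    Returns (zetaTail D k i) ⟨zetaTailVal D.val k.val i.val⟩
      (5 * (Nat.size D.val + 2) * words w X ^ 2) := by
  have hi' : i.val ≤ X := by nlinarith
  have h1 : D.val / i.val ≤ X := (Nat.div_le_self _ _).trans hDX
  have hs : Nat.size (D.val / i.val) ≤ Nat.size D.val := Nat.size_le_size (Nat.div_le_self _ _)
  have hk1 : k.val - 1 ≤ X := by omega
  refine ((returns_div hDX hi').bind ((returns_mul hi' hi').bind
    ((returns_sub (a := k) (b := ⟨1⟩) (X := X) (by omega) (by show 1 ≤ X; omega)).bind
    ((returns_divPow h1 hiX hk1 (by omega) (by show 2 ≤ i.val * i.val; nlinarith)).bind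
    ((returns_add (a := k) (X := X) (by omega) hk1).bind
    (returns_div (a := ⟨_⟩) (b := ⟨_⟩) (X := X) ?_ ?_)))))).mono (by nlinarith)
  · exact (Nat.div_le_self _ _).trans h1
  · show k.val + (k.val - 1) ≤ X
    omega

theorem isAlgorithm_zetaBounds (D k N : BigNat w) : (zetaBounds D k N).IsAlgorithm :=
  (isAlgorithm_zetaSum _ _ _).bind fun _ => (isAlgorithm_op _ _ _).bind fun _ =>
    (isAlgorithm_zetaTail _ _ _).bind fun _ => (isAlgorithm_zetaTail _ _ _).bind fun _ =>
    (isAlgorithm_op _ _ _).bind fun _ => (isAlgorithm_op _ _ _).bind fun _ =>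
    (isAlgorithm_op _ _ _).bind fun _ => isAlgorithm_pure _

theorem returns_zetaBounds {D k N : BigNat w} {X : ℕ} (hk : 2 * k.val ≤ X) (hN : 2 ≤ N.val)
    (hD : 1 ≤ D.val) (hX : D.val * (2 * N.val + 2) ^ 2 ≤ X) :
    Returns (zetaBounds D k N) (⟨zetaLo D.val k.val N.val⟩, ⟨zetaHi D.val k.val N.val⟩)
      (5 * (N.val + 4) * (Nat.size D.val + 2) * words w X ^ 2) := by
  have hNX : (N.val + 1) * (N.val + 1) ≤ X := by nlinarith
  have hDX : D.val * (N.val + 1) ≤ X := by nlinarith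
  have hDX' : D.val * (2 * N.val + 2) ≤ X := by nlinarith
  have h1 := (zetaSumVal_le D.val k.val N.val)
  have h2 := (zetaTailVal_le D.val k.val N.val)
  have h3 := (zetaTailVal_le D.val k.val (N.val + 1))
  have hDX1 : D.val ≤ X := by nlinarith
  have hNX1 : N.val ≤ X := by nlinarith
  refine ((returns_zetaSum (X := X) (by omega) (by omega) hD hX).bind
    ((returns_add (a := N) (b := ⟨1⟩) (X := X) hNX1 (by show 1 ≤ X; omega)).bind
    ((returns_zetaTail (i := ⟨_⟩) (X := X) (by show 2 ≤ N.val + 1; omega) hNX hDX1 hk).bind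
    ((returns_zetaTail (X := X) hN (by nlinarith) hDX1 hk).bind
    ((returns_add (a := ⟨_⟩) (b := ⟨_⟩) (X := X) (h1.trans hDX) (h3.trans hDX1)).bind
    ((returns_add (a := ⟨_⟩) (X := X) (h1.trans hDX) hNX1).bind
    ((returns_add (a := ⟨_⟩) (b := ⟨_⟩) (X := X) ?_ (h2.trans hDX1)).map rfl))))))).mono (by nlinarith [Nat.zero_le (words w X ^ 2)])
  show zetaSumVal D.val k.val N.val + N.val ≤ X
  nlinarith

theorem isAlgorithm_factorBounds (D k N : BigNat w) : (factorBounds D k N).IsAlgorithm :=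
  (isAlgorithm_zetaBounds _ _ _).bind fun _ => (isAlgorithm_divPow _ _ _).bind fun _ =>
    (isAlgorithm_op _ _ _).bind fun _ => (isAlgorithm_op _ _ _).bind fun _ =>
    (isAlgorithm_op _ _ _).bind fun _ => (isAlgorithm_op _ _ _).bind fun _ => isAlgorithm_pure _

theorem returns_factorBounds {D k N : BigNat w} {X : ℕ} (hk : 2 * k.val ≤ X) (hN : 2 ≤ N.val)
    (hD : 1 ≤ D.val) (hX : D.val * (2 * N.val + 2) ^ 2 ≤ X) :
    Returns (factorBounds D k N) (⟨factorLo D.val k.val N.val⟩, ⟨factorHi D.val k.val N.val⟩)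
      (5 * (N.val + 6) * (Nat.size D.val + 2) * words w X ^ 2) := by
  have hDX' : D.val * (2 * N.val + 2) ≤ X := by nlinarith
  have hDX : D.val ≤ X := by nlinarith
  have h4 : 4 ≤ X := by nlinarith
  obtain ⟨h1, h2⟩ := zetaLo_le_zetaHi_aux (N := N.val) k.val hD
  have h5 : D.val / 4 ^ k.val ≤ D.val := Nat.div_le_self _ _
  refine ((returns_zetaBounds hk hN hD hX).bind
    ((returns_divPow (d := ⟨4⟩) (X := X) hDX h4 (by omega) (by omega) (by norm_num)).bind
    ((returns_sub (b := ⟨_⟩) (X := X) hDX (h5.trans hDX)).bind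
    ((returns_sub (a := ⟨_⟩) (b := ⟨1⟩) (X := X) ?_ (by show 1 ≤ X; omega)).bind
    ((returns_mul (a := ⟨_⟩) (b := ⟨_⟩) (X := X) (h1.trans hDX') ?_).bind
    ((returns_mul (a := ⟨_⟩) (b := ⟨_⟩) (X := X) (h2.trans hDX') ?_).map rfl)))))).mono (by nlinarith [Nat.zero_le (words w X ^ 2)])
  · exact (Nat.sub_le _ _).trans hDX
  · exact ((Nat.sub_le _ _).trans (Nat.sub_le _ _)).trans hDX
  · exact (Nat.sub_le _ _).trans hDX

theorem isAlgorithm_weightBounds (l D N k : BigNat w) : (weightBounds l D N k).IsAlgorithm :=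
  (isAlgorithm_factorBounds _ _ _).bind fun _ => (isAlgorithm_op _ _ _).bind fun _ =>
    (isAlgorithm_factorBounds _ _ _).bind fun _ => (isAlgorithm_op _ _ _).bind fun _ =>
    (isAlgorithm_op _ _ _).bind fun _ => isAlgorithm_pure _

theorem returns_weightBounds {l D N k : BigNat w} {X : ℕ} (hl : 2 * l.val ≤ X)
    (hk : k.val ≤ l.val) (hN : 2 ≤ N.val) (hD : 1 ≤ D.val)
    (hX : D.val ^ 2 * (2 * N.val + 2) ^ 2 ≤ X) :
    Returns (weightBounds l D N k)
      (⟨weightLo l.val D.val N.val k.val⟩, ⟨weightHi l.val D.val N.val k.val⟩)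
      (10 * (N.val + 7) * (Nat.size D.val + 2) * words w X ^ 2) := by
  have hX' : D.val * (2 * N.val + 2) ^ 2 ≤ X := le_trans (by gcongr; nlinarith) hX
  have hX'' : D.val ^ 2 * (2 * N.val + 2) ≤ X := le_trans (by gcongr; nlinarith) hX
  obtain ⟨h1, h2⟩ := factor_le (N := N.val) k.val hD
  obtain ⟨h3, h4⟩ := factor_le (N := N.val) (l.val - k.val) hD
  refine ((returns_factorBounds (X := X) (by omega) hN hD hX').bind
    ((returns_sub (a := l) (b := k) (X := X) (by omega) (by omega)).bind
    ((returns_factorBounds (k := ⟨_⟩) (X := X) (by show 2 * (l.val - k.val) ≤ X; omega)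
      hN hD hX').bind
    ((returns_mul (a := ⟨_⟩) (b := ⟨_⟩) (X := X) (h1.trans hX'') (h3.trans hX'')).bind
    ((returns_mul (a := ⟨_⟩) (b := ⟨_⟩) (X := X) (h2.trans hX'') (h4.trans hX'')).map rfl))))).mono (by nlinarith [Nat.zero_le (words w X ^ 2)])

theorem upTo_eq_fix (n : BigNat w) : ∃ F, upTo n = fix F (n, []) ∧
    (∀ a, Admissible fun s => F s a) ∧ ∀ s i L, F s (i, L) = (le i ⟨0⟩ >>= fun b =>
      if b = true then Pure.pure L else sub i ⟨1⟩ >>= fun j => s (j, i :: L)) := by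
  refine ⟨_, rfl, fun x => ?_, fun _ _ _ => rfl⟩
  refine (admissible_const (isAlgorithm_le _ _)).bind fun _ => ?_
  refine Admissible.ite _ (admissible_const (isAlgorithm_pure _)) ?_
  exact (admissible_const (isAlgorithm_op _ _ _)).bind fun _ => admissible_self _

theorem returns_upTo (n : ℕ) : Returns (upTo (⟨n⟩ : BigNat w)) ((List.range' 1 n).map BigNat.mk)
    (3 * (n + 1) * words w (n + 1) ^ 2) := by
  have hQ : 1 ≤ words w (n + 1) ^ 2 := Nat.one_le_pow _ _ (one_le_words w _)
  obtain ⟨F, h, hF, hF'⟩ := upTo_eq_fix (⟨n⟩ : BigNat w)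
  rw [h]
  have key : ∀ i ≤ n, ∀ L : List (BigNat w), Returns (fix F (⟨i⟩, L))
      ((List.range' 1 i).map BigNat.mk ++ L) (3 * (i + 1) * words w (n + 1) ^ 2) := by
    intro i
    induction i with
    | zero =>
      intro _ L
      rw [fix_eq hF, hF']
      refine (((returns_le (X := n + 1) (Nat.zero_le _) (Nat.zero_le _)).bind (d := 0)
        ?_).delay 1).mono (by nlinarith)
      simpa using Returns.pure L
    | succ i ih =>
      intro hi L
      rw [fix_eq hF, hF']
      refine (((returns_le (X := n + 1) (Nat.le_succ_of_le hi) (Nat.zero_le _)).bind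
        (d := words w (n + 1) ^ 2 + 3 * (i + 1) * words w (n + 1) ^ 2) ?_).delay 1).mono
        (by nlinarith)
      simp only [nonpos_iff_eq_zero, Nat.add_eq_zero_iff, one_ne_zero, and_false, decide_false,
        Bool.false_eq_true, if_false]
      refine (returns_sub (X := n + 1) (Nat.le_succ_of_le hi) (Nat.le_add_left 1 n)).bind ?_
      simpa [List.range'_1_concat, add_comm] using ih (by omega) (⟨i + 1⟩ :: L)
  simpa using key n le_rfl []

end Arithmetic

/-! ## Values of the zeta function -/

/-- `ζ(2k)`. -/
noncomputable def evenZeta (k : ℕ) : ℝ := ∑' n : ℕ, 1 / ((n : ℝ) + 1) ^ (2 * k)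

/-- `(1 - 4⁻ᵏ) ζ(2k)`, the part of the series that belongs to odd numbers. -/
noncomputable def oddZeta (k : ℕ) : ℝ := ∑' n : ℕ, 1 / (2 * (n : ℝ) + 1) ^ (2 * k)

theorem riemannZeta_re {k : ℕ} (hk : 1 ≤ k) : (riemannZeta (2 * (k : ℂ))).re = evenZeta k := by
  have h : riemannZeta (2 * (k : ℂ)) = ((evenZeta k : ℝ) : ℂ) := by
    rw [← Nat.cast_two, ← Nat.cast_mul, zeta_nat_eq_tsum_of_gt_one (by omega), evenZeta,
      Complex.ofReal_tsum, tsum_eq_zero_add']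
    · have : 2 * k ≠ 0 := by omega
      simp [this]
    · have := (Complex.summable_one_div_nat_cpow (p := ((2 * k : ℕ) : ℂ))).2 (by
        rw [Complex.natCast_re]; exact_mod_cast (by omega : 1 < 2 * k))
      have := (summable_nat_add_iff 1).2 this
      simpa only [Complex.cpow_natCast] using this
  rw [h, Complex.ofReal_re]

theorem summable_evenZeta {k : ℕ} (hk : 1 ≤ k) :
    Summable fun n : ℕ => 1 / ((n : ℝ) + 1) ^ (2 * k) := by
  have := (summable_nat_add_iff 1).2
    (Real.summable_one_div_nat_pow (p := 2 * k) |>.2 (by omega))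
  simpa using this

theorem summable_oddZeta {k : ℕ} (hk : 1 ≤ k) :
    Summable fun n : ℕ => 1 / (2 * (n : ℝ) + 1) ^ (2 * k) := by
  refine (summable_evenZeta hk).of_nonneg_of_le (fun n => by positivity) fun n => ?_
  gcongr
  linarith [(Nat.cast_nonneg n : (0 : ℝ) ≤ n)]

/-- The even integers contribute 4⁻ᵏ ζ(2k) to the series. Summation is shifted by one, so odd
indices `n` belong to even integers `n + 1`. -/
theorem oddZeta_eq {k : ℕ} (hk : 1 ≤ k) : oddZeta k = (1 - 1 / 4 ^ k) * evenZeta k := by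
  have hs := summable_evenZeta hk
  have h := tsum_even_add_odd (f := fun n : ℕ => 1 / ((n : ℝ) + 1) ^ (2 * k))
    (by simpa using summable_oddZeta hk)
    (hs.comp_injective (i := fun n : ℕ => 2 * n + 1) fun a b h => by simpa using h)
  have h2 : ∑' n : ℕ, 1 / (((2 * n + 1 : ℕ) : ℝ) + 1) ^ (2 * k) = 1 / 4 ^ k * evenZeta k := by
    rw [evenZeta, ← tsum_mul_left]
    refine tsum_congr fun n => ?_
    have : (((2 * n + 1 : ℕ) : ℝ) + 1) = 2 * (n + 1) := by push_cast; ring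
    rw [this, mul_pow, pow_mul 2 2 k]
    norm_num
    ring
  have h1 : ∑' n : ℕ, 1 / (((2 * n : ℕ) : ℝ) + 1) ^ (2 * k) = oddZeta k := by simp [oddZeta]
  rw [h2, h1] at h
  change _ = evenZeta k at h
  linarith

theorem one_le_oddZeta {k : ℕ} (hk : 1 ≤ k) : 1 ≤ oddZeta k := by
  have := (summable_oddZeta hk).le_tsum 0 fun n _ => by positivity
  simpa [oddZeta] using this

theorem oddZeta_anti {j k : ℕ} (hj : 1 ≤ j) (h : j ≤ k) : oddZeta k ≤ oddZeta j := by
  refine (summable_oddZeta (hj.trans h)).tsum_le_tsum (fun n => ?_) (summable_oddZeta hj)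
  gcongr
  linarith [(Nat.cast_nonneg n : (0 : ℝ) ≤ n)]

theorem evenZeta_one : evenZeta 1 = Real.pi ^ 2 / 6 := by
  rw [← riemannZeta_re le_rfl, Nat.cast_one, mul_one, riemannZeta_two]
  norm_cast

theorem evenZeta_two : evenZeta 2 = Real.pi ^ 4 / 90 := by
  rw [← riemannZeta_re one_le_two, Nat.cast_two,
    show (2 : ℂ) * 2 = 4 by norm_num, riemannZeta_four]
  norm_cast

theorem oddZeta_one : oddZeta 1 = Real.pi ^ 2 / 8 := by
  rw [oddZeta_eq le_rfl, evenZeta_one]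
  ring

theorem oddZeta_two : oddZeta 2 = Real.pi ^ 4 / 96 := by
  rw [oddZeta_eq one_le_two, evenZeta_two]
  ring

theorem oddZeta_le {k : ℕ} (hk : 1 ≤ k) : oddZeta k ≤ 5 / 4 := by
  refine (oddZeta_anti le_rfl hk).trans ?_
  rw [oddZeta_one]
  nlinarith [Real.pi_lt_d2, Real.pi_pos]

theorem evenZeta_le {k : ℕ} (hk : 1 ≤ k) : evenZeta k ≤ 2 := by
  have h : evenZeta k ≤ evenZeta 1 := by
    refine (summable_evenZeta hk).tsum_le_tsum (fun n => ?_) (summable_evenZeta le_rfl)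
    gcongr
    linarith [(Nat.cast_nonneg n : (0 : ℝ) ≤ n)]
  refine h.trans ?_
  rw [evenZeta_one]
  nlinarith [Real.pi_lt_d2, Real.pi_pos]

/-- This is f_k ≤ f_1, which makes the acceptance probability at most 1. Unless k or l - k is 1, the
product is at most λ(2)² = (π⁴/96)², which is below λ(1) = π²/8, and λ(l - 1) ≥ 1. -/
theorem oddZeta_mul_le {l k : ℕ} (hk : 1 ≤ k) (hkl : k < l) :
    oddZeta k * oddZeta (l - k) ≤ oddZeta 1 * oddZeta (l - 1) := by
  rcases Nat.eq_or_lt_of_le hk with rfl | hk1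
  · rfl
  rcases Nat.eq_or_lt_of_le (by omega : 1 ≤ l - k) with h | hl
  · rw [← h, show k = l - 1 by omega, mul_comm]
  have h2 : ∀ j, 2 ≤ j → oddZeta j ≤ oddZeta 2 := fun j hj => oddZeta_anti one_le_two hj
  have h0 : (0 : ℝ) ≤ oddZeta (l - k) := zero_le_one.trans (one_le_oddZeta (by omega))
  calc oddZeta k * oddZeta (l - k) ≤ oddZeta 2 * oddZeta 2 :=
        mul_le_mul (h2 _ hk1) (h2 _ hl) h0 (zero_le_one.trans (one_le_oddZeta one_le_two))
    _ ≤ oddZeta 1 * 1 := by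
      rw [oddZeta_two, oddZeta_one]
      have h1 : Real.pi ^ 2 ≤ 10 := by nlinarith [Real.pi_lt_d2, Real.pi_pos]
      have h2 : Real.pi ^ 4 ≤ 100 := by nlinarith [sq_nonneg Real.pi]
      have h4 : Real.pi ^ 4 * Real.pi ^ 4 ≤ 1000 * Real.pi ^ 2 := by
        have : Real.pi ^ 4 * Real.pi ^ 4 = Real.pi ^ 4 * (Real.pi ^ 2 * Real.pi ^ 2) := by ring
        rw [this]
        have := mul_le_mul h2 (mul_le_mul_of_nonneg_right h1 (sq_nonneg Real.pi))
          (by positivity) (by norm_num)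
        linarith
      nlinarith [sq_nonneg Real.pi]
    _ ≤ oddZeta 1 * oddZeta (l - 1) := by
      gcongr
      · exact zero_le_one.trans (one_le_oddZeta le_rfl)
      · exact one_le_oddZeta (by omega)

/-- The factor 4ˡ does not depend on `k`; what remains is a product of two numbers in [1, 5/4]. -/
theorem weight_eq {l k : ℕ} (hk : 1 ≤ k) (hkl : k < l) :
    weight l k = 4 ^ l * (oddZeta k * oddZeta (l - k)) := by
  rw [weight, riemannZeta_re hk, riemannZeta_re (by omega), oddZeta_eq hk, oddZeta_eq (by omega)]
  have : (4 : ℝ) ^ l = 4 ^ k * 4 ^ (l - k) := by rw [← pow_add]; congr 1; omega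
  rw [this]
  field_simp

/-! ## Comparison of the tail of the series with integrals -/

/-- Induction on `u ^ (p + 1) - v ^ (p + 1) = u (u ^ p - v ^ p) + v ^ p (u - v)`. It is meant for `u
= 1 / x`, `v = 1 / (x + 1)`, for which `u - v = u v`; together with its upper counterpart it
replaces an integral comparison. -/
theorem mul_pow_le_pow_sub_pow {u v : ℝ} (hv : 0 ≤ v) (h : v ≤ u) (huv : u - v = u * v) (p : ℕ) :
    p * v ^ p * u ≤ u ^ p - v ^ p := by
  induction p with
  | zero => simp
  | succ p ih =>
    have hu : 0 ≤ u := hv.trans h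
    have h1 : u ^ (p + 1) - v ^ (p + 1) = u * (u ^ p - v ^ p) + v ^ p * (u * v) := by
      rw [← huv]; ring
    have h2 : (p : ℝ) * v ^ p * u * v ≤ p * v ^ p * u * u := by gcongr
    have h3 := mul_le_mul_of_nonneg_left ih hu
    push_cast
    rw [h1, pow_succ]
    linarith

theorem pow_sub_pow_le_mul_pow {u v : ℝ} (hv : 0 ≤ v) (h : v ≤ u) (huv : u - v = u * v) (p : ℕ) :
    u ^ p - v ^ p ≤ p * u ^ p * v := by
  induction p with
  | zero => simp
  | succ p ih =>
    have hu : 0 ≤ u := hv.trans h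
    have h1 : u ^ (p + 1) - v ^ (p + 1) = u * (u ^ p - v ^ p) + v ^ p * (u * v) := by
      rw [← huv]; ring
    have h2 : v ^ p * (u * v) ≤ u ^ p * (u * v) := by gcongr
    have h3 := mul_le_mul_of_nonneg_left ih hu
    push_cast
    rw [h1, pow_succ]
    linarith

/-- `∫ t ^ (-(p + 1))` from `x` to infinity. -/
noncomputable def tailIntegral (p : ℕ) (x : ℝ) : ℝ := 1 / (p * x ^ p)

/-- The difference is the integral of a decreasing function over a unit interval, so it lies between
the values at the two ends. -/
theorem tailIntegral_sub {p : ℕ} (hp : 1 ≤ p) {x : ℝ} (hx : 0 < x) :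
    1 / (x + 1) ^ (p + 1) ≤ tailIntegral p x - tailIntegral p (x + 1) ∧
      tailIntegral p x - tailIntegral p (x + 1) ≤ 1 / x ^ (p + 1) := by
  have hv : (0 : ℝ) ≤ 1 / (x + 1) := by positivity
  have h : 1 / (x + 1) ≤ 1 / x := by gcongr; linarith
  have huv : 1 / x - 1 / (x + 1) = 1 / x * (1 / (x + 1)) := by field_simp; ring
  have h1 := mul_pow_le_pow_sub_pow hv h huv p
  have h2 := pow_sub_pow_le_mul_pow hv h huv p
  have hp' : (0 : ℝ) < p := by exact_mod_cast hp
  have he : tailIntegral p x - tailIntegral p (x + 1) =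
      ((1 / x) ^ p - (1 / (x + 1)) ^ p) / p := by
    unfold tailIntegral
    rw [one_div_pow, one_div_pow]
    field_simp
  rw [he, le_div_iff₀ hp', div_le_iff₀ hp']
  constructor
  · calc 1 / (x + 1) ^ (p + 1) * p = p * (1 / (x + 1)) ^ p * (1 / (x + 1)) := by
          rw [one_div_pow, pow_succ]; field_simp
      _ ≤ p * (1 / (x + 1)) ^ p * (1 / x) := by gcongr
      _ ≤ _ := h1
  · calc _ ≤ _ := h2
      _ ≤ p * (1 / x) ^ p * (1 / x) := by gcongr
      _ = _ := by rw [one_div_pow, pow_succ]; field_simp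

theorem tendsto_tailIntegral {p : ℕ} (hp : 1 ≤ p) (a : ℕ) :
    Filter.Tendsto (fun n : ℕ => tailIntegral p ((n : ℝ) + a)) Filter.atTop (nhds 0) := by
  have h : Filter.Tendsto (fun n : ℕ => (((n + a : ℕ) : ℝ))⁻¹) Filter.atTop (nhds 0) :=
    tendsto_inv_atTop_nhds_zero_nat.comp (Filter.tendsto_add_atTop_nat a)
  have h2 := (h.pow p).const_mul ((p : ℝ)⁻¹)
  rw [zero_pow (by omega), mul_zero] at h2
  refine h2.congr fun n => ?_
  rw [tailIntegral]
  push_cast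
  rw [inv_pow, one_div, mul_inv]

/-- By `tailIntegral_sub`, the partial sum with the tail from N + 1 increases with N, and the one
with the tail from N decreases. Both tend to ζ(2k). -/
theorem evenZeta_bounds {k N : ℕ} (hk : 1 ≤ k) (hN : 1 ≤ N) :
    ∑ i ∈ Finset.range N, 1 / ((i : ℝ) + 1) ^ (2 * k) + tailIntegral (2 * k - 1) (N + 1) ≤
      evenZeta k ∧ evenZeta k ≤
    ∑ i ∈ Finset.range N, 1 / ((i : ℝ) + 1) ^ (2 * k) + tailIntegral (2 * k - 1) N := by
  have hp : 1 ≤ 2 * k - 1 := by omega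
  have hp1 : 2 * k - 1 + 1 = 2 * k := by omega
  have ht := (summable_evenZeta hk).hasSum.tendsto_sum_nat
  constructor
  · have hm : Monotone fun n : ℕ => ∑ i ∈ Finset.range n, 1 / ((i : ℝ) + 1) ^ (2 * k) +
        tailIntegral (2 * k - 1) (n + 1) := by
      refine monotone_nat_of_le_succ fun n => ?_
      have := (tailIntegral_sub hp (x := n + 1) (by positivity)).2
      rw [hp1] at this
      rw [Finset.sum_range_succ]
      push_cast
      linarith
    have := ht.add (tendsto_tailIntegral hp 1)
    rw [add_zero] at this
    exact hm.ge_of_tendsto (by simpa [evenZeta] using this) N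
  · have hm : Antitone fun n : ℕ => ∑ i ∈ Finset.range (n + 1), 1 / ((i : ℝ) + 1) ^ (2 * k) +
        tailIntegral (2 * k - 1) (n + 1) := by
      refine antitone_nat_of_succ_le fun n => ?_
      have := (tailIntegral_sub hp (x := n + 1) (by positivity)).1
      rw [hp1] at this
      rw [Finset.sum_range_succ _ (n + 1)]
      push_cast
      linarith
    have := (ht.comp (Filter.tendsto_add_atTop_nat 1)).add (tendsto_tailIntegral hp 1)
    rw [add_zero] at this
    obtain ⟨n, rfl⟩ := Nat.exists_eq_add_of_le' hN
    have := hm.le_of_tendsto (by simpa using this) n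
    simpa [evenZeta] using this

/-! ## The enclosure of the weights -/

theorem natCast_div_bounds (a b : ℕ) :
    ((a / b : ℕ) : ℝ) ≤ (a : ℝ) / b ∧ (a : ℝ) / b ≤ ((a / b : ℕ) : ℝ) + 1 := by
  rw [← Nat.floor_div_eq_div (K := ℝ)]
  exact ⟨Nat.floor_le (by positivity), (Nat.lt_floor_add_one _).le⟩

/-- Successive floor divisions equal one floor division by the product, so the tail suffers a single
rounding error. -/
theorem zetaTailVal_bounds (D : ℕ) {k : ℕ} (hk : 1 ≤ k) (i : ℕ) :
    (zetaTailVal D k i : ℝ) ≤ D * tailIntegral (2 * k - 1) i ∧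
      D * tailIntegral (2 * k - 1) i ≤ zetaTailVal D k i + 1 := by
  have h1 : zetaTailVal D k i = D / ((2 * k - 1) * i ^ (2 * k - 1)) := by
    rw [zetaTailVal, Nat.div_div_eq_div_mul, Nat.div_div_eq_div_mul]
    obtain ⟨j, rfl⟩ := Nat.exists_eq_add_of_le' hk
    have e1 : 2 * (j + 1) - 1 = 2 * j + 1 := by omega
    rw [e1, Nat.add_sub_cancel]
    congr 1
    ring
  have h2 := natCast_div_bounds D ((2 * k - 1) * i ^ (2 * k - 1))
  rw [h1, tailIntegral, mul_one_div]
  simpa using h2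

/-- Each floor loses less than 1, and the first term, `D` itself, is exact; hence `N - 1` and not
`N`. -/
theorem zetaSumVal_bounds (D k : ℕ) {N : ℕ} (hN : 1 ≤ N) :
    (zetaSumVal D k N : ℝ) ≤ D * ∑ i ∈ Finset.range N, 1 / ((i : ℝ) + 1) ^ (2 * k) ∧
      D * ∑ i ∈ Finset.range N, 1 / ((i : ℝ) + 1) ^ (2 * k) ≤ zetaSumVal D k N + (N - 1) := by
  induction N, hN using Nat.le_induction with
  | base => simp [zetaSumVal]
  | succ n hn ih =>
    have hz : zetaSumVal D k (n + 1) = zetaSumVal D k n + D / ((n + 1) * (n + 1)) ^ k := by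
      rw [zetaSumVal, zetaSumVal, Finset.sum_Ico_succ_top (by omega), add_assoc]
    have h2 := natCast_div_bounds D (((n + 1) * (n + 1)) ^ k)
    have h3 : (D : ℝ) / (((n + 1) * (n + 1)) ^ k : ℕ) = D * (1 / ((n : ℝ) + 1) ^ (2 * k)) := by
      push_cast
      rw [← sq, ← pow_mul, mul_one_div]
    rw [h3] at h2
    rw [hz, Finset.sum_range_succ, mul_add (D : ℝ)]
    push_cast at h2 ⊢
    constructor <;> linarith [ih.1, ih.2, h2.1, h2.2]

/-- The width has two sources: roundings, at most N + 1, and the gap between the tails from N and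
from N + 1, at most D / N² by `tailIntegral_sub`. -/
theorem zeta_enclosure (D : ℕ) {k N : ℕ} (hk : 1 ≤ k) (hN : 1 ≤ N) :
    (D : ℝ) ≤ zetaLo D k N ∧ (zetaLo D k N : ℝ) ≤ D * evenZeta k ∧
      D * evenZeta k ≤ zetaHi D k N ∧
      (zetaHi D k N : ℝ) - zetaLo D k N ≤ N + 1 + D / N ^ 2 := by
  have hs := zetaSumVal_bounds D k hN
  have ha := zetaTailVal_bounds D hk (N + 1)
  have hb := zetaTailVal_bounds D hk N
  have hz := evenZeta_bounds hk hN
  have hD : (0 : ℝ) ≤ D := Nat.cast_nonneg D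
  have hd1 : (D : ℝ) ≤ zetaSumVal D k N := by
    rw [zetaSumVal]
    exact_mod_cast Nat.le_add_right _ _
  have hz1 := mul_le_mul_of_nonneg_left hz.1 hD
  have hz2 := mul_le_mul_of_nonneg_left hz.2 hD
  have hN' : (1 : ℝ) ≤ N := by exact_mod_cast hN
  have hw := (tailIntegral_sub (p := 2 * k - 1) (x := N) (by omega) (by linarith)).2
  have hw' : 1 / (N : ℝ) ^ (2 * k - 1 + 1) ≤ 1 / N ^ 2 := by
    gcongr
    omega
  have hw2 := mul_le_mul_of_nonneg_left (hw.trans hw') hD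
  rw [mul_one_div] at hw2
  rw [mul_add] at hz1 hz2
  rw [mul_sub] at hw2
  push_cast [zetaLo, zetaHi] at ha ⊢
  have h0 : (0 : ℝ) ≤ zetaTailVal D k (N + 1) := Nat.cast_nonneg _
  refine ⟨by linarith, by linarith [hs.1, ha.1], by linarith [hs.2, hb.2], by
    linarith [hb.1, ha.2]⟩

/-- With D = N⁴ the rounding error N + 1 is absorbed by D / N² = N². The relative width O(1/N²)
matches the resolution of the 2r bits of U when N = 2ʳ. -/
theorem factor_enclosure {k N : ℕ} (hk : 1 ≤ k) (hN : 2 ≤ N) {D : ℕ} (hD : D = N ^ 4) :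
    (D : ℝ) ^ 2 / 2 ≤ factorLo D k N ∧ (factorLo D k N : ℝ) ≤ D ^ 2 * oddZeta k ∧
      D ^ 2 * oddZeta k ≤ factorHi D k N ∧
      (factorHi D k N : ℝ) - factorLo D k N ≤ 5 * D ^ 2 / N ^ 2 := by
  obtain ⟨h1, h2, h3, h4⟩ := zeta_enclosure D hk (by omega : 1 ≤ N)
  have hD16 : 2 ^ 4 ≤ D := by
    rw [hD]
    gcongr
  have hv := natCast_div_bounds D (4 ^ k)
  have hv4 : D / 4 ^ k ≤ D / 4 := Nat.div_le_div_left (by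
    calc 4 = 4 ^ 1 := rfl
      _ ≤ 4 ^ k := Nat.pow_le_pow_right (by norm_num) hk) (by norm_num)
  have hsub : ((D - D / 4 ^ k : ℕ) : ℝ) = D - (D / 4 ^ k : ℕ) := by
    rw [Nat.cast_sub (Nat.div_le_self _ _)]
  have hlt : 1 ≤ D - D / 4 ^ k := Nat.le_sub_of_add_le (by
    have : D / 4 ^ k ≤ D / 4 := hv4
    generalize D / 4 ^ k = y at *
    omega)
  have hsub1 : ((D - D / 4 ^ k - 1 : ℕ) : ℝ) = D - (D / 4 ^ k : ℕ) - 1 := by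
    rw [Nat.cast_sub hlt, hsub, Nat.cast_one]
  have hv4' : ((D / 4 ^ k : ℕ) : ℝ) ≤ D / 4 :=
    le_trans (by exact_mod_cast hv4) (natCast_div_bounds D 4).1
  have hD16' : (16 : ℝ) ≤ D := by exact_mod_cast hD16
  have hz2 := evenZeta_le hk
  rw [oddZeta_eq hk]
  push_cast at hv
  rw [factorLo, factorHi, Nat.cast_mul, Nat.cast_mul, hsub1, hsub]
  set v : ℝ := ((D / 4 ^ k : ℕ) : ℝ)
  set lo : ℝ := (zetaLo D k N : ℝ)
  set hi : ℝ := (zetaHi D k N : ℝ)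
  have hv0 : 0 ≤ v := Nat.cast_nonneg _
  have heq : (D : ℝ) ^ 2 * ((1 - 1 / 4 ^ k) * evenZeta k) =
      (D * evenZeta k) * (D - D / 4 ^ k) := by ring
  have hN2 : (2 : ℝ) ≤ N := by exact_mod_cast hN
  have hDN : (D : ℝ) = N ^ 4 := by exact_mod_cast hD
  have hz0 : 0 ≤ evenZeta k := tsum_nonneg fun n => by positivity
  rw [heq]
  refine ⟨?_, ?_, ?_, ?_⟩
  · nlinarith
  · exact mul_le_mul h2 (by linarith) (by linarith) (by positivity)
  · exact mul_le_mul h3 (by linarith) (by linarith) (by linarith)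
  · have e1 : hi * (D - v) - lo * (D - v - 1) = (hi - lo) * (D - v) + lo := by ring
    have e2 : (hi - lo) * (D - v) ≤ (N + 1 + D / N ^ 2) * D := by
      gcongr
      · linarith
      · linarith
    have e3 : lo ≤ 2 * D := by nlinarith
    rw [e1]
    have hDN2 : (D : ℝ) / N ^ 2 = N ^ 2 := by rw [hDN]; field_simp
    have e4 : 5 * (D : ℝ) ^ 2 / N ^ 2 = 5 * D * N ^ 2 := by rw [hDN]; field_simp
    rw [hDN2] at e2
    rw [e4]
    have e5 : (N + 1 + N ^ 2) * (D : ℝ) + 2 * D ≤ 5 * D * N ^ 2 := by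
      have : (N : ℝ) + 3 ≤ 4 * N ^ 2 := by nlinarith
      nlinarith
    linarith

/-- Both factors have size of order D² and error at most 5 D² / N². With factors at most 3 D² above
and 2 D² below, the product rule gives 5 · 3 + 2 · 5 = 25 and the upper bound 3 · 3 = 9. -/
theorem weight_enclosure {l k N : ℕ} (hk : 1 ≤ k) (hkl : k < l) (hN : 2 ≤ N) {D : ℕ}
    (hD : D = N ^ 4) :
    (D : ℝ) ^ 4 / 4 ≤ weightLo l D N k ∧
      (weightLo l D N k : ℝ) ≤ D ^ 4 * (oddZeta k * oddZeta (l - k)) ∧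
      D ^ 4 * (oddZeta k * oddZeta (l - k)) ≤ weightHi l D N k ∧
      (weightHi l D N k : ℝ) - weightLo l D N k ≤ 25 * D ^ 4 / N ^ 2 ∧
      (weightHi l D N k : ℝ) ≤ 9 * D ^ 4 := by
  have hN2 : (2 : ℝ) ≤ N := by exact_mod_cast hN
  have hD0 : (0 : ℝ) ≤ D ^ 2 := by positivity
  have key : ∀ j, 1 ≤ j → (D : ℝ) ^ 2 / 2 ≤ factorLo D j N ∧
      (factorLo D j N : ℝ) ≤ D ^ 2 * oddZeta j ∧ D ^ 2 * oddZeta j ≤ factorHi D j N ∧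
      (factorHi D j N : ℝ) - factorLo D j N ≤ D ^ 2 * (5 / N ^ 2) ∧
      (factorHi D j N : ℝ) ≤ D ^ 2 * 3 ∧ (factorLo D j N : ℝ) ≤ D ^ 2 * 2 := fun j hj => by
    obtain ⟨h1, h2, h3, h4⟩ := factor_enclosure hj hN hD
    have h5 := mul_le_mul_of_nonneg_left (oddZeta_le hj) hD0
    have h6 : (5 : ℝ) / N ^ 2 ≤ 5 / 4 := by
      gcongr
      nlinarith
    have h7 := mul_le_mul_of_nonneg_left h6 hD0
    have h8 : 5 * (D : ℝ) ^ 2 / N ^ 2 = D ^ 2 * (5 / N ^ 2) := by ring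
    rw [h8] at h4
    exact ⟨h1, h2, h3, h4, by linarith, by linarith⟩
  obtain ⟨a1, a2, a3, a4, a5, a6⟩ := key k hk
  obtain ⟨b1, b2, b3, b4, b5, b6⟩ := key (l - k) (by omega)
  have o1 : (0 : ℝ) ≤ oddZeta k := zero_le_one.trans (one_le_oddZeta hk)
  have o2 : (0 : ℝ) ≤ oddZeta (l - k) := zero_le_one.trans (one_le_oddZeta (by omega))
  rw [weightLo, weightHi, Nat.cast_mul, Nat.cast_mul]
  set xl : ℝ := (factorLo D k N : ℝ)
  set xh : ℝ := (factorHi D k N : ℝ)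
  set yl : ℝ := (factorLo D (l - k) N : ℝ)
  set yh : ℝ := (factorHi D (l - k) N : ℝ)
  have xl0 : 0 ≤ xl := Nat.cast_nonneg _
  have yl0 : 0 ≤ yl := Nat.cast_nonneg _
  have xh0 : 0 ≤ xh := Nat.cast_nonneg _
  have yh0 : 0 ≤ yh := Nat.cast_nonneg _
  have e : (D : ℝ) ^ 4 * (oddZeta k * oddZeta (l - k)) =
      (D ^ 2 * oddZeta k) * (D ^ 2 * oddZeta (l - k)) := by ring
  rw [e]
  refine ⟨?_, mul_le_mul a2 b2 yl0 (by positivity), mul_le_mul a3 b3 (by positivity) xh0, ?_, ?_⟩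
  · calc (D : ℝ) ^ 4 / 4 = D ^ 2 / 2 * (D ^ 2 / 2) := by ring
      _ ≤ xl * yl := mul_le_mul a1 b1 (by positivity) xl0
  · have e1 : xh * yh - xl * yl = (xh - xl) * yh + xl * (yh - yl) := by ring
    have p0 : (0 : ℝ) ≤ D ^ 2 * (5 / N ^ 2) := by positivity
    have e2 : (xh - xl) * yh ≤ D ^ 2 * (5 / N ^ 2) * (D ^ 2 * 3) := mul_le_mul a4 b5 yh0 p0
    have e3 : xl * (yh - yl) ≤ xl * (D ^ 2 * (5 / N ^ 2)) := mul_le_mul_of_nonneg_left b4 xl0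
    have e4 : xl * (D ^ 2 * (5 / N ^ 2)) ≤ D ^ 2 * 2 * (D ^ 2 * (5 / N ^ 2)) :=
      mul_le_mul_of_nonneg_right a6 p0
    calc _ ≤ D ^ 2 * (5 / N ^ 2) * (D ^ 2 * 3) + D ^ 2 * 2 * (D ^ 2 * (5 / (N : ℝ) ^ 2)) := by
          rw [e1]; linarith
      _ = _ := by ring
  · calc xh * yh ≤ D ^ 2 * 3 * (D ^ 2 * 3) := mul_le_mul a5 b5 yh0 (by positivity)
      _ = _ := by ring

/-! ## Tangent numbers -/

section Tanh

open PowerSeries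

/-- The power series of the hyperbolic tangent, in terms of Bernoulli numbers. -/
noncomputable def tanhSeries : PowerSeries ℝ := PowerSeries.mk fun n =>
  coeff (n + 1) (rescale 4 (bernoulliPowerSeries ℝ) - rescale 2 (bernoulliPowerSeries ℝ) + X)

/-- The constant coefficients of the two rescaled Bernoulli series cancel, so the right side is
divisible by `X` and the shift in the definition loses nothing. -/
theorem X_mul_tanhSeries : X * tanhSeries =
    rescale 4 (bernoulliPowerSeries ℝ) - rescale 2 (bernoulliPowerSeries ℝ) + X := by
  ext n
  cases n with
  | zero =>
    simp only [coeff_zero_X_mul, map_add, map_sub, coeff_rescale, pow_zero, one_mul, sub_self,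
      coeff_zero_X, add_zero]
  | succ n => rw [coeff_succ_X_mul, tanhSeries, coeff_mk]

theorem exp_sub_one_ne_zero : (exp ℝ ^ 2 - 1 : PowerSeries ℝ) ≠ 0 := by
  intro h
  have := congrArg (coeff 1) h
  rw [exp_pow_eq_rescale_exp] at this
  simp [coeff_rescale, coeff_exp, coeff_one] at this

/-- With B(x) = x / (eˣ - 1) this is x tanh x = B(4x) - B(2x) + x, by e⁴ˣ - 1 = (e²ˣ - 1)(e²ˣ + 1).
-/
theorem tanhSeries_mul : tanhSeries * (exp ℝ ^ 2 + 1) = exp ℝ ^ 2 - 1 := by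
  have h := bernoulliPowerSeries_mul_exp_sub_one ℝ
  have h2 := congrArg (rescale (2 : ℝ)) h
  have h4 := congrArg (rescale (4 : ℝ)) h
  have e2 := exp_pow_eq_rescale_exp (A := ℝ) 2
  have e4 := exp_pow_eq_rescale_exp (A := ℝ) 4
  push_cast at e2 e4
  rw [map_mul, map_sub, map_one, ← e2, rescale_X] at h2
  rw [map_mul, map_sub, map_one, ← e4, rescale_X] at h4
  have c2 : (C (2 : ℝ) : PowerSeries ℝ) = 2 := map_ofNat _ 2
  have c4 : (C (4 : ℝ) : PowerSeries ℝ) = 4 := map_ofNat _ 4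
  rw [c2] at h2
  rw [c4] at h4
  have hX : (X : PowerSeries ℝ) * (exp ℝ ^ 2 - 1) ≠ 0 :=
    mul_ne_zero X_ne_zero exp_sub_one_ne_zero
  refine mul_left_cancel₀ hX ?_
  have e : X * (exp ℝ ^ 2 - 1) * (tanhSeries * (exp ℝ ^ 2 + 1)) =
      (X * tanhSeries) * (exp ℝ ^ 4 - 1) := by ring
  rw [e, X_mul_tanhSeries]
  linear_combination h4 - (exp ℝ ^ 2 + 1) * h2

/-- Differentiate the defining identity and cancel the factor e²ˣ + 1, whose constant coefficient is
2. This differential equation encodes the decomposition of a tree at its root. -/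
theorem derivative_tanhSeries : derivative ℝ tanhSeries = 1 - tanhSeries ^ 2 := by
  have h := tanhSeries_mul
  have hd := congrArg (derivative ℝ) h
  have hE : derivative ℝ (exp ℝ ^ 2) = 2 * exp ℝ ^ 2 := by
    rw [derivative_pow, derivative_exp]
    push_cast
    ring
  have h1 : derivative ℝ (1 : PowerSeries ℝ) = 0 := derivative_one
  rw [Derivation.leibniz, map_add, map_sub, h1, hE, smul_eq_mul, smul_eq_mul] at hd
  have hne : (exp ℝ ^ 2 + 1 : PowerSeries ℝ) ≠ 0 := by
    intro h
    have := congrArg constantCoeff h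
    simp at this
  refine mul_right_cancel₀ hne ?_
  linear_combination hd + (tanhSeries - 1) * h

theorem coeff_tanhSeries (n : ℕ) : coeff n tanhSeries =
    (4 ^ (n + 1) - 2 ^ (n + 1)) * ((bernoulli (n + 1) : ℚ) / (n + 1).factorial) +
      if n = 0 then 1 else 0 := by
  rw [tanhSeries, coeff_mk, map_add, map_sub, coeff_rescale, coeff_rescale, coeff_X]
  simp only [bernoulliPowerSeries, coeff_mk, map_div₀, map_natCast, eq_ratCast, Nat.add_eq_right]
  ring

theorem coeff_tanhSeries_of_even {n : ℕ} (hn : Even n) : coeff n tanhSeries = 0 := by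
  rw [coeff_tanhSeries]
  rcases Nat.eq_zero_or_pos n with rfl | h
  · norm_num [bernoulli_one]
  · rw [bernoulli_eq_zero_of_odd hn.add_one (by omega)]
    simp [h.ne']

/-- The number of strictly increasing binary trees of size `2k - 1`, divided by `(2k - 1)!`. -/
noncomputable def tangentCoeff (k : ℕ) : ℝ := 2 * 4 ^ k * oddZeta k / Real.pi ^ (2 * k)

theorem evenZeta_eq {k : ℕ} (hk : 1 ≤ k) : evenZeta k = (-1) ^ (k + 1) * 2 ^ (2 * k - 1) *
    Real.pi ^ (2 * k) * bernoulli (2 * k) / (2 * k).factorial := by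
  have := (hasSum_nat_add_iff' 1).2 (hasSum_zeta_nat (k := k) (by omega))
  have h0 : 2 * k ≠ 0 := by omega
  simpa [evenZeta, h0] using this.tsum_eq

/-- Euler's formula turns the Bernoulli number into ζ(2k), and 4²ᵏ - 2²ᵏ = 4ᵏ (4ᵏ - 1) supplies the
factor for the odd integers. -/
theorem coeff_tanhSeries_of_odd {k : ℕ} (hk : 1 ≤ k) :
    coeff (2 * k - 1) tanhSeries = (-1) ^ (k + 1) * tangentCoeff k := by
  have h1 : 2 * k - 1 + 1 = 2 * k := by omega
  have h2 : 2 * k - 1 ≠ 0 := by omega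
  have h3 : ((-1 : ℝ) ^ (k + 1)) * (-1) ^ (k + 1) = 1 := by rw [← mul_pow]; norm_num
  have h4 : (2 : ℝ) ^ (2 * k) = 2 * 2 ^ (2 * k - 1) := by rw [← pow_succ', h1]
  have h5 : (2 : ℝ) ^ (2 * k) = 4 ^ k := by rw [pow_mul]; norm_num
  have h6 : (4 : ℝ) ^ (2 * k) = 4 ^ k * 4 ^ k := by rw [← pow_add]; congr 1; omega
  rw [coeff_tanhSeries, h1, if_neg h2, tangentCoeff, oddZeta_eq hk, evenZeta_eq hk, h6, h5]
  have h7 : (2 : ℝ) ^ (2 * k - 1) = 4 ^ k / 2 := by rw [← h5, h4]; ring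
  rw [h7]
  have hpi := Real.pi_ne_zero
  field_simp
  linear_combination (-(4 ^ k - 1) * 4 ^ k * (bernoulli (2 * k) : ℝ)) * h3

end Tanh

theorem tangentCoeff_pos {k : ℕ} (hk : 1 ≤ k) : 0 < tangentCoeff k := by
  have := one_le_oddZeta hk
  unfold tangentCoeff
  positivity

theorem tangentCoeff_one : tangentCoeff 1 = 1 := by
  rw [tangentCoeff, oddZeta_one]
  have := Real.pi_ne_zero
  field_simp
  norm_num

/-- The powers of π combine to π²ˡ, so the factor in front of the weight depends on `l` only: the
zeta weights have the same ratios as the products of tangent coefficients. -/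
theorem tangentCoeff_mul {l k : ℕ} (hk : 1 ≤ k) (hkl : k < l) :
    tangentCoeff k * tangentCoeff (l - k) = 4 / Real.pi ^ (2 * l) * weight l k := by
  have h1 : (4 : ℝ) ^ l = 4 ^ k * 4 ^ (l - k) := by rw [← pow_add]; congr 1; omega
  have h2 : Real.pi ^ (2 * l) = Real.pi ^ (2 * k) * Real.pi ^ (2 * (l - k)) := by
    rw [← pow_add]; congr 1; omega
  rw [weight_eq hk hkl, tangentCoeff, tangentCoeff, h1, h2]
  have := Real.pi_ne_zero
  field_simp
  ring

/-- The recurrence of the tangent numbers. -/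
theorem sum_tangentCoeff {l : ℕ} (hl : 2 ≤ l) :
    ∑ k ∈ Finset.Icc 1 (l - 1), tangentCoeff k * tangentCoeff (l - k) =
      (2 * l - 1) * tangentCoeff l := by
  have h := congrArg (PowerSeries.coeff (2 * l - 2)) derivative_tanhSeries
  rw [PowerSeries.coeff_derivative, map_sub, PowerSeries.coeff_one, if_neg (by omega), sq,
    PowerSeries.coeff_mul, show 2 * l - 2 + 1 = 2 * l - 1 by omega,
    coeff_tanhSeries_of_odd (by omega)] at h
  -- Even coefficients of tanh vanish, so only pairs of odd degrees 2k - 1 and 2(l - k) - 1 survive,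
  -- and their signs multiply to (-1)ˡ.
  have hs : ∑ p ∈ Finset.HasAntidiagonal.antidiagonal (2 * l - 2),
      PowerSeries.coeff p.1 tanhSeries * PowerSeries.coeff p.2 tanhSeries =
      ∑ k ∈ Finset.Icc 1 (l - 1), (-1) ^ l * (tangentCoeff k * tangentCoeff (l - k)) := by
    symm
    refine Finset.sum_of_injOn (fun k => (2 * k - 1, 2 * (l - k) - 1)) ?_ ?_ ?_ ?_
    · intro a ha b hb hab
      simp only [Finset.coe_Icc, Set.mem_Icc, Prod.mk.injEq] at ha hb hab
      omega
    · intro a ha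
      simp only [Finset.coe_Icc, Set.mem_Icc] at ha
      simp only [Finset.mem_coe, Finset.HasAntidiagonal.mem_antidiagonal]
      omega
    · rintro ⟨i, j⟩ hij hn
      simp only [Finset.HasAntidiagonal.mem_antidiagonal] at hij
      rcases Nat.even_or_odd i with hi | hi
      · rw [coeff_tanhSeries_of_even hi, zero_mul]
      · obtain ⟨k, hk⟩ := hi
        refine (hn ⟨k + 1, ?_, ?_⟩).elim
        · simp only [Finset.coe_Icc, Set.mem_Icc]
          omega
        · simp only [Prod.mk.injEq]
          omega
    · intro k hk
      simp only [Finset.mem_Icc] at hk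
      rw [coeff_tanhSeries_of_odd hk.1, coeff_tanhSeries_of_odd (by omega : 1 ≤ l - k)]
      have : ((-1 : ℝ)) ^ l = (-1) ^ (k + 1) * (-1) ^ (l - k + 1) := by
        rw [← pow_add, show k + 1 + (l - k + 1) = l + 2 by omega, pow_add]
        norm_num
      rw [this]
      ring
  rw [hs, ← Finset.mul_sum] at h
  have h3 : ((-1 : ℝ)) ^ l * (-1) ^ l = 1 := by rw [← mul_pow]; norm_num
  have h4 : ((2 * l - 2 : ℕ) : ℝ) = 2 * l - 2 := by
    rw [Nat.cast_sub (by omega)]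
    push_cast
    ring
  rw [h4, pow_succ] at h
  linear_combination ((-1 : ℝ) ^ l) * h - ((∑ k ∈ Finset.Icc 1 (l - 1),
    tangentCoeff k * tangentCoeff (l - k)) - (2 * l - 1) * tangentCoeff l) * h3

/-! ## Biased coins -/

/-- The computation `f` waits at most for time `c` and then continues as `g`. -/
def Delays (f g : RComp α) (c : ℕ) : Prop := ∃ d ≤ c, f = delay d g

namespace Delays

theorem refl (f : RComp α) : Delays f f 0 :=
  ⟨0, le_rfl, ext_runs fun ρ => by simp [mem_delay]⟩

theorem trans {f g h : RComp α} {c d : ℕ} (h₁ : Delays f g c) (h₂ : Delays g h d) :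
    Delays f h (c + d) := by
  obtain ⟨c', hc, rfl⟩ := h₁
  obtain ⟨d', hd, rfl⟩ := h₂
  exact ⟨c' + d', add_le_add hc hd, delay_delay _ _ _⟩

theorem mono {f g : RComp α} {c d : ℕ} (h : Delays f g c) (hcd : c ≤ d) : Delays f g d := by
  obtain ⟨c', hc, rfl⟩ := h
  exact ⟨c', hc.trans hcd, rfl⟩

theorem delay (c : ℕ) (f : RComp α) : Delays (delay c f) f c := ⟨c, le_rfl, rfl⟩

theorem prob_eq {f g : RComp α} {c : ℕ} (h : Delays f g c) (a : α) : f.prob a = g.prob a := by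
  obtain ⟨c', hc, rfl⟩ := h
  exact prob_delay _ _ _

theorem mass_eq {f g : RComp α} {c : ℕ} (h : Delays f g c) : f.mass = g.mass := by
  obtain ⟨c', hc, rfl⟩ := h
  exact mass_delay _ _

theorem expectedTime_le {f g : RComp α} {c : ℕ} (h : Delays f g c) (hg : g.IsAlgorithm) :
    f.expectedTime ≤ c + g.expectedTime := by
  obtain ⟨d, hd, rfl⟩ := h
  refine (expectedTime_delay_le hg d).trans ?_
  gcongr

end Delays

theorem Returns.delays {f : RComp α} {v : α} {c : ℕ} (hf : Returns f v c) (g : α → RComp β) :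
    Delays (f >>= g) (g v) c := hf.bind_eq g

theorem Returns.delays' {f : RComp α} {v : α} {c : ℕ} (hf : Returns f v c) {g : α → RComp β}
    {h : RComp β} (e : g v = h) : Delays (f >>= g) h c := e ▸ hf.bind_eq g

theorem half_add_half (x : ℝ≥0∞) : 2⁻¹ * (x + x) = x := by
  rw [← two_mul, ← mul_assoc, ENNReal.inv_mul_cancel (by simp) (by simp), one_mul]

section

variable {w : ℕ}

theorem biasedCoin_eq_fix (s : BigNat w) : ∃ F, (∀ a, biasedCoin a s = fix F a) ∧
    (∀ a, Admissible fun self => F self a) ∧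
    ∀ self a, F self a = (add a a >>= fun a' => flip >>= fun b => le s a' >>= fun c =>
      if c = true then (if b = true then sub a' s >>= fun a'' => self a'' else pure true)
      else if b = true then pure false else self a') := by
  refine ⟨_, fun _ => rfl, fun a => ?_, fun _ _ => rfl⟩
  refine (admissible_const (isAlgorithm_op _ _ _)).bind fun _ => ?_
  refine (admissible_const isAlgorithm_flip).bind fun _ => ?_
  refine (admissible_const (isAlgorithm_le _ _)).bind fun _ => ?_
  refine Admissible.ite _ (Admissible.ite _ ?_ (admissible_const (isAlgorithm_pure _)))
    (Admissible.ite _ (admissible_const (isAlgorithm_pure _)) (admissible_self _))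
  exact (admissible_const (isAlgorithm_op _ _ _)).bind fun _ => admissible_self _

theorem isAlgorithm_biasedCoin (a s : BigNat w) : (biasedCoin a s).IsAlgorithm := by
  obtain ⟨F, h, hF, -⟩ := biasedCoin_eq_fix s
  rw [h]
  exact isAlgorithm_fix hF _

theorem biasedCoin_body (self : BigNat w → RComp Bool) {a s : BigNat w} (ha : a.val ≤ s.val) :
    Delays (add a a >>= fun a' => flip >>= fun b => le s a' >>= fun c =>
      if c = true then (if b = true then sub a' s >>= fun a'' => self a'' else pure true)
      else if b = true then pure false else self a')
      (flip >>= fun b => le s ⟨a.val + a.val⟩ >>= fun c => if c = true then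
        (if b = true then sub ⟨a.val + a.val⟩ s >>= fun a'' => self a'' else pure true)
        else if b = true then pure false else self ⟨a.val + a.val⟩)
      (words w (2 * s.val) ^ 2) :=
  (returns_add (X := 2 * s.val) (by omega) (by omega)).delays _

theorem biasedCoin_branch (self : BigNat w → RComp Bool) {a s : BigNat w} (ha : a.val ≤ s.val)
    (b : Bool) : Delays (le s ⟨a.val + a.val⟩ >>= fun c => if c = true then
        (if b = true then sub ⟨a.val + a.val⟩ s >>= fun a'' => self a'' else pure true)
        else if b = true then pure false else self ⟨a.val + a.val⟩)
      (if s.val ≤ a.val + a.val then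
        (if b = true then self ⟨a.val + a.val - s.val⟩ else pure true)
        else if b = true then pure false else self ⟨a.val + a.val⟩)
      (2 * words w (2 * s.val) ^ 2) := by
  have h2 : a.val + a.val ≤ 2 * s.val := by omega
  have := ((returns_le (a := s) (b := ⟨a.val + a.val⟩) (X := 2 * s.val) (by omega) h2).delays
    fun c => if c = true then
        (if b = true then sub ⟨a.val + a.val⟩ s >>= fun a'' => self a'' else pure true)
        else if b = true then pure false else self ⟨a.val + a.val⟩)
  rw [two_mul]
  refine this.trans ?_
  by_cases h : s.val ≤ a.val + a.val <;> cases b <;>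
    simp only [h, decide_true, decide_false, if_true, if_false, Bool.false_eq_true]
  · exact (Delays.refl _).mono (Nat.zero_le _)
  · exact (returns_sub (X := 2 * s.val) h2 (by omega)).delays _
  · exact (Delays.refl _).mono (Nat.zero_le _)
  · exact (Delays.refl _).mono (Nat.zero_le _)

/-- The current binary digit of a / s is 1 exactly if s ≤ 2a. A random bit different from the digit
decides the comparison; an equal bit passes to the remaining fraction. -/
theorem prob_biasedCoin_step {a s : BigNat w} (ha : a.val ≤ s.val) (c : Bool) :
    (biasedCoin a s).prob c = if s.val ≤ a.val + a.val then
      2⁻¹ * ((biasedCoin ⟨a.val + a.val - s.val⟩ s).prob c + if true = c then 1 else 0)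
      else 2⁻¹ * ((if false = c then 1 else 0) + (biasedCoin ⟨a.val + a.val⟩ s).prob c) := by
  obtain ⟨F, h, hF, hF'⟩ := biasedCoin_eq_fix s
  rw [h, h, h, fix_eq hF, prob_delay, hF', (biasedCoin_body _ ha).prob_eq, prob_flip_bind,
    (biasedCoin_branch _ ha true).prob_eq, (biasedCoin_branch _ ha false).prob_eq]
  split_ifs <;> simp_all [prob_pure]

/-- The probability of the outcome `c` of a coin that shows `true` with probability `x`. -/
def coinProb (x : ℝ) (c : Bool) : ℝ := if c then x else 1 - x

/-- The desired probability satisfies the same recursion, and each round halves the discrepancy. A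
bound 2⁻ᵏ uniform in `a` holds for every k, so the discrepancy is 0. -/
theorem prob_biasedCoin {a s : BigNat w} (ha : a.val ≤ s.val) (hs : 1 ≤ s.val) (c : Bool) :
    (biasedCoin a s).prob c = ENNReal.ofReal (coinProb (a.val / s.val) c) := by
  have hs' : (0 : ℝ) < s.val := by exact_mod_cast hs
  have key : ∀ k : ℕ, ∀ a : ℕ, a ≤ s.val →
      |((biasedCoin ⟨a⟩ s).prob c).toReal - coinProb (a / s.val) c| ≤ (1 / 2) ^ k := by
    intro k
    induction k with
    | zero =>
      intro a ha
      have h1 : ((biasedCoin ⟨a⟩ s).prob c).toReal ≤ 1 :=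
        ENNReal.toReal_mono ENNReal.one_ne_top ((isAlgorithm_biasedCoin _ _).prob_le_one c)
      have h2 : (a : ℝ) / s.val ≤ 1 := by
        rw [div_le_one hs']
        exact_mod_cast ha
      have h3 : (0 : ℝ) ≤ a / s.val := by positivity
      have h4 := ENNReal.toReal_nonneg (a := (biasedCoin ⟨a⟩ s).prob c)
      rw [pow_zero, abs_le, coinProb]
      split_ifs <;> constructor <;> linarith
    | succ k ih =>
      intro a ha
      rw [prob_biasedCoin_step (a := ⟨a⟩) ha c]
      have hne : ∀ x, (biasedCoin (⟨x⟩ : BigNat w) s).prob c ≠ ⊤ := fun x =>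
        (isAlgorithm_biasedCoin _ _).prob_ne_top c
      split_ifs with h1 h2 h2
      · have hi := ih (a + a - s.val) (by omega)
        rw [Nat.cast_sub h1, Nat.cast_add, sub_div, div_self hs'.ne'] at hi
        subst h2
        simp only [coinProb, if_true] at hi ⊢
        rw [ENNReal.toReal_mul, ENNReal.toReal_add (hne _) ENNReal.one_ne_top, pow_succ]
        simp only [ENNReal.toReal_inv, ENNReal.toReal_ofNat, ENNReal.toReal_one]
        rw [abs_le] at hi ⊢
        constructor <;> linarith [hi.1, hi.2, add_div (a : ℝ) a s.val]
      · have hi := ih (a + a - s.val) (by omega)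
        rw [Nat.cast_sub h1, Nat.cast_add, sub_div, div_self hs'.ne'] at hi
        have hc : c = false := by simpa using Ne.symm h2
        subst hc
        simp only [coinProb, Bool.false_eq_true, if_false] at hi ⊢
        rw [ENNReal.toReal_mul, add_zero, pow_succ]
        simp only [ENNReal.toReal_inv, ENNReal.toReal_ofNat]
        rw [abs_le] at hi ⊢
        constructor <;> linarith [hi.1, hi.2, add_div (a : ℝ) a s.val]
      · have hi := ih (a + a) (by simpa using (not_le.1 h1).le)
        rw [Nat.cast_add] at hi
        subst h2
        simp only [coinProb, Bool.false_eq_true, if_false] at hi ⊢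
        rw [ENNReal.toReal_mul, ENNReal.toReal_add ENNReal.one_ne_top (hne _), pow_succ]
        simp only [ENNReal.toReal_inv, ENNReal.toReal_ofNat, ENNReal.toReal_one]
        rw [abs_le] at hi ⊢
        constructor <;> linarith [hi.1, hi.2, add_div (a : ℝ) a s.val]
      · have hi := ih (a + a) (by simpa using (not_le.1 h1).le)
        rw [Nat.cast_add] at hi
        have hc : c = true := by simpa using Ne.symm h2
        subst hc
        simp only [coinProb, if_true] at hi ⊢
        rw [ENNReal.toReal_mul, zero_add, pow_succ]
        simp only [ENNReal.toReal_inv, ENNReal.toReal_ofNat]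
        rw [abs_le] at hi ⊢
        constructor <;> linarith [hi.1, hi.2, add_div (a : ℝ) a s.val]
  have h0 : |((biasedCoin a s).prob c).toReal - coinProb (a.val / s.val) c| ≤ 0 :=
    ge_of_tendsto' (tendsto_pow_atTop_nhds_zero_of_lt_one (by norm_num) (by norm_num))
      fun k => key k a.val ha
  rw [← ENNReal.ofReal_toReal ((isAlgorithm_biasedCoin a s).prob_ne_top c),
    sub_eq_zero.1 (abs_nonpos_iff.1 h0)]

/-- A round costs at most 2 + 3Q and the loop continues with probability 1/2, hence twice that cost.
-/
theorem expectedTime_biasedCoin_le {a s : BigNat w} (ha : a.val ≤ s.val) :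
    (biasedCoin a s).expectedTime ≤ (4 + 6 * words w (2 * s.val) ^ 2 : ℕ) := by
  obtain ⟨F, h, hF, hF'⟩ := biasedCoin_eq_fix s
  rw [h]
  refine expectedTime_fix_le hF
    (fun _ => ((4 + 6 * words w (2 * s.val) ^ 2 : ℕ) : ℝ≥0∞)) (fun a => a.val ≤ s.val) ?_ ha
  intro self hself hT a ha
  rw [hF']
  set Q := words w (2 * s.val) ^ 2
  have hbody : ∀ b : Bool, (if s.val ≤ a.val + a.val then
        (if b = true then self ⟨a.val + a.val - s.val⟩ else pure true)
        else if b = true then pure false else self ⟨a.val + a.val⟩ : RComp Bool).IsAlgorithm := by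
    intro b
    split_ifs
    · exact hself _
    · exact isAlgorithm_pure _
    · exact isAlgorithm_pure _
    · exact hself _
  have hbranch : ∀ b : Bool, (le s ⟨a.val + a.val⟩ >>= fun c => if c = true then
        (if b = true then sub ⟨a.val + a.val⟩ s >>= fun a'' => self a'' else pure true)
        else if b = true then pure false else self ⟨a.val + a.val⟩).IsAlgorithm := by
    intro b
    obtain ⟨d, -, h⟩ := biasedCoin_branch self ha b
    rw [h]
    exact (hbody b).delay d
  have h1 := (biasedCoin_body self ha).expectedTime_le (isAlgorithm_flip.bind hbranch)
  have h2 := expectedTime_flip_bind_le hbranch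
  have h3 := fun b => (biasedCoin_branch self ha b).expectedTime_le (hbody b)
  have h4 : (if s.val ≤ a.val + a.val then
        (if true = true then self ⟨a.val + a.val - s.val⟩ else pure true)
        else if true = true then pure false else self ⟨a.val + a.val⟩ : RComp Bool).expectedTime +
      (if s.val ≤ a.val + a.val then
        (if false = true then self ⟨a.val + a.val - s.val⟩ else pure true)
        else if false = true then pure false else self ⟨a.val + a.val⟩ : RComp Bool).expectedTime
      ≤ (4 + 6 * Q : ℕ) := by
    by_cases h : s.val ≤ a.val + a.val <;> simp only [h, if_true, Bool.false_eq_true, if_false]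
    · rw [expectedTime_pure, add_zero]
      exact hT _ (by simp; omega)
    · rw [expectedTime_pure, zero_add]
      exact hT _ (not_le.1 h).le
  calc _ ≤ ((Q : ℕ) : ℝ≥0∞) + (1 + 2⁻¹ * (((2 * Q : ℕ) : ℝ≥0∞) + ((2 * Q : ℕ) : ℝ≥0∞) +
        (4 + 6 * Q : ℕ))) + 1 := by
        refine add_le_add_left (h1.trans (add_le_add_right (h2.trans (add_le_add_right
          (mul_le_mul_right ?_ _) _)) _)) _
        refine (add_le_add (h3 true) (h3 false)).trans ?_
        rw [add_add_add_comm]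
        exact add_le_add_right h4 _
    _ = (4 + 6 * Q : ℕ) := by
      have : ((2 * Q : ℕ) : ℝ≥0∞) + ((2 * Q : ℕ) : ℝ≥0∞) + (4 + 6 * Q : ℕ) =
          ((2 + 5 * Q : ℕ) : ℝ≥0∞) + (2 + 5 * Q : ℕ) := by
        push_cast; ring
      rw [this, half_add_half]
      push_cast
      ring

/-! ## Uniform random numbers -/

theorem sum_range_two_mul {M : Type*} [AddCommMonoid M] (f : ℕ → M) (n : ℕ) :
    ∑ r ∈ Finset.range (2 * n), f r = ∑ r ∈ Finset.range n, (f (2 * r) + f (2 * r + 1)) := by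
  induction n with
  | zero => simp
  | succ n ih =>
    rw [show 2 * (n + 1) = 2 * n + 1 + 1 by ring, Finset.sum_range_succ, Finset.sum_range_succ, ih,
      Finset.sum_range_succ, add_assoc]

theorem uniformBelow_eq_fix (m : BigNat w) : ∃ F, uniformBelow m = fix F (⟨1⟩, ⟨0⟩) ∧
    (∀ a, Admissible fun s => F s a) ∧
    ∀ self s r, F self (s, r) = (le m s >>= fun c =>
      if c = true then le m r >>= fun c => if c = true then self (⟨1⟩, ⟨0⟩) else pure r
      else bit >>= fun b => add s s >>= fun s' => add r r >>= fun r' => add r' b >>= fun r'' =>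
        self (s', r'')) := by
  refine ⟨_, rfl, fun x => ?_, fun _ _ _ => rfl⟩
  refine (admissible_const (isAlgorithm_le _ _)).bind fun _ => Admissible.ite _ ?_ ?_
  · refine (admissible_const (isAlgorithm_le _ _)).bind fun _ => ?_
    exact Admissible.ite _ (admissible_self _) (admissible_const (isAlgorithm_pure _))
  · refine (admissible_const isAlgorithm_bit).bind fun _ => ?_
    refine (admissible_const (isAlgorithm_op _ _ _)).bind fun _ => ?_
    refine (admissible_const (isAlgorithm_op _ _ _)).bind fun _ => ?_
    exact (admissible_const (isAlgorithm_op _ _ _)).bind fun _ => admissible_self _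

theorem isAlgorithm_uniformBelow (m : BigNat w) : (uniformBelow m).IsAlgorithm := by
  obtain ⟨F, h, hF, -⟩ := uniformBelow_eq_fix m
  rw [h]
  exact isAlgorithm_fix hF _

theorem uniformBelow_body_big (self : BigNat w × BigNat w → RComp (BigNat w)) {m : BigNat w}
    {s r : ℕ} {X : ℕ} (hs : s ≤ X) (hr : r ≤ X) (hm : m.val ≤ s) :
    Delays (le m ⟨s⟩ >>= fun c =>
      if c = true then le m ⟨r⟩ >>= fun c => if c = true then self (⟨1⟩, ⟨0⟩) else pure ⟨r⟩
      else bit >>= fun b => add ⟨s⟩ ⟨s⟩ >>= fun s' => add ⟨r⟩ ⟨r⟩ >>= fun r' => add r' b >>=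
        fun r'' => self (s', r''))
      (if m.val ≤ r then self (⟨1⟩, ⟨0⟩) else pure ⟨r⟩) (2 * words w X ^ 2) := by
  rw [two_mul]
  refine ((returns_le (X := X) (hm.trans hs) hs).delays _).trans ?_
  simp only [hm, decide_true, if_true]
  exact (returns_le (X := X) (hm.trans hs) hr).delays' (by simp only [decide_eq_true_eq])

theorem uniformBelow_body_small (self : BigNat w × BigNat w → RComp (BigNat w)) {m : BigNat w}
    {s r : ℕ} {X : ℕ} (hs : 2 * s ≤ X) (hm : s < m.val) (hmX : m.val ≤ X) :
    Delays (le m ⟨s⟩ >>= fun c =>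
      if c = true then le m ⟨r⟩ >>= fun c => if c = true then self (⟨1⟩, ⟨0⟩) else pure ⟨r⟩
      else bit >>= fun b => add ⟨s⟩ ⟨s⟩ >>= fun s' => add ⟨r⟩ ⟨r⟩ >>= fun r' => add r' b >>=
        fun r'' => self (s', r''))
      (flip >>= fun b => add ⟨s⟩ ⟨s⟩ >>= fun s' => add ⟨r⟩ ⟨r⟩ >>= fun r' => add r' ⟨b.toNat⟩ >>=
        fun r'' => self (s', r'')) (words w X ^ 2) := by
  refine (returns_le (X := X) hmX (by show s ≤ X; omega)).delays' ?_
  simp only [not_le.2 hm, decide_false, Bool.false_eq_true, if_false, bit, bind_assoc',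
    pure_bind']

theorem uniformBelow_branch (self : BigNat w × BigNat w → RComp (BigNat w))
    {s r : ℕ} {X : ℕ} (hs : 2 * s ≤ X) (hr : 2 * r + 1 ≤ X) (b : Bool) :
    Delays (add ⟨s⟩ ⟨s⟩ >>= fun s' => add ⟨r⟩ ⟨r⟩ >>= fun r' => add r' ⟨b.toNat⟩ >>=
        fun r'' => self (s', r'')) (self (⟨2 * s⟩, ⟨2 * r + b.toNat⟩)) (3 * words w X ^ 2) := by
  have e : 3 * words w X ^ 2 = words w X ^ 2 + (words w X ^ 2 + words w X ^ 2) := by ring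
  have hs' : s ≤ X := by omega
  have hr' : r ≤ X := by omega
  have hb : b.toNat ≤ X := (Bool.toNat_le b).trans (by omega)
  rw [e, two_mul, two_mul]
  refine ((returns_add (X := X) hs' hs').delays _).trans
    (((returns_add (X := X) hr' hr').delays _).trans
    (((returns_add (X := X) ?_ hb).delays _)))
  show r + r ≤ X
  omega

theorem two_pow_clog_bounds {m : ℕ} (hm : 1 ≤ m) :
    m ≤ 2 ^ Nat.clog 2 m ∧ 2 ^ Nat.clog 2 m ≤ 2 * m ∧ ∀ i < Nat.clog 2 m, 2 ^ i < m := by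
  have h3 : ∀ i < Nat.clog 2 m, 2 ^ i < m := fun i hi => by
    by_contra h
    exact absurd (Nat.clog_le_of_le_pow (not_lt.1 h)) (not_le.2 hi)
  refine ⟨Nat.le_pow_clog one_lt_two m, ?_, h3⟩
  rcases Nat.eq_zero_or_pos (Nat.clog 2 m) with h | h
  · rw [h]
    omega
  · obtain ⟨i, hi⟩ := Nat.exists_eq_add_of_le' h
    have := h3 i (by omega)
    rw [hi, pow_succ]
    omega

/-- With G the probability of outcome `j` from a state and I the number of bits read, the start
value is the average of G over the 2ᴵ final states. Of these, m - 1 or m return another number, at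
most one returns `j`, and 2ᴵ - m restart. The resulting linear equation reads m G(1, 0) = 1 if j <
m, and = 0 otherwise. -/
theorem prob_uniformBelow {m : BigNat w} (hm : 1 ≤ m.val) (j : ℕ) :
    (uniformBelow m).prob ⟨j⟩ = if j < m.val then ENNReal.ofReal (1 / m.val) else 0 := by
  classical
  obtain ⟨F, h, hF, hF'⟩ := uniformBelow_eq_fix m
  rw [h]
  obtain ⟨h1, h2, h3⟩ := two_pow_clog_bounds hm
  set I := Nat.clog 2 m.val
  set G : ℕ → ℕ → ℝ≥0∞ := fun s r => (fix F (⟨s⟩, ⟨r⟩)).prob ⟨j⟩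
  have hbig : ∀ s r, m.val ≤ s → G s r = if m.val ≤ r then G 1 0 else if r = j then 1 else 0 := by
    intro s r hs
    change (fix F (⟨s⟩, ⟨r⟩)).prob ⟨j⟩ = _
    rw [fix_eq hF, prob_delay, hF',
      (uniformBelow_body_big (X := max s r) _ (le_max_left _ _) (le_max_right _ _) hs).prob_eq]
    split_ifs <;> simp_all [prob_pure, G]
  have hsmall : ∀ s r, s < m.val → G s r = 2⁻¹ * (G (2 * s) (2 * r) + G (2 * s) (2 * r + 1)) := by
    intro s r hs
    change (fix F (⟨s⟩, ⟨r⟩)).prob ⟨j⟩ = _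
    have e1 : 2 * s ≤ max (2 * s) (max (2 * r + 1) m.val) := le_max_left _ _
    have e2 : 2 * r + 1 ≤ max (2 * s) (max (2 * r + 1) m.val) :=
      (le_max_left _ _).trans (le_max_right _ _)
    rw [fix_eq hF, prob_delay, hF', (uniformBelow_body_small _ e1 hs
      ((le_max_right _ _).trans (le_max_right _ _))).prob_eq, prob_flip_bind,
      (uniformBelow_branch _ e1 e2 true).prob_eq, (uniformBelow_branch _ e1 e2 false).prob_eq,
      add_comm]
    rfl
  have hsum : ∀ i ≤ I, ∑ r ∈ Finset.range (2 ^ (I - i)), G (2 ^ (I - i)) r =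
      2⁻¹ ^ i * ∑ r ∈ Finset.range (2 ^ I), G (2 ^ I) r := by
    intro i
    induction i with
    | zero => simp
    | succ i ih =>
      intro hi
      have e : 2 ^ (I - i) = 2 * 2 ^ (I - (i + 1)) := by
        rw [← pow_succ']
        congr 1
        omega
      rw [pow_succ', mul_assoc, ← ih (by omega), e, sum_range_two_mul, Finset.mul_sum]
      exact Finset.sum_congr rfl fun r _ => hsmall _ _ (h3 _ (by omega))
  have hq := hsum I le_rfl
  have hS : ∑ r ∈ Finset.range (2 ^ I), G (2 ^ I) r =
      (if j < m.val then 1 else 0) + (2 ^ I - m.val : ℕ) * G 1 0 := by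
    rw [Finset.range_eq_Ico, ← Finset.sum_Ico_consecutive _ (Nat.zero_le _) h1]
    congr 1
    · rw [← Finset.range_eq_Ico, Finset.sum_congr rfl fun r hr => (hbig _ r h1).trans
        (if_neg (not_le.2 (Finset.mem_range.1 hr)))]
      simp
    · rw [Finset.sum_congr rfl fun r hr => (hbig _ r h1).trans
        (if_pos (Finset.mem_Ico.1 hr).1)]
      simp
  rw [hS, Nat.sub_self, pow_zero, Finset.sum_range_one] at hq
  have hne : G 1 0 ≠ ⊤ := (isAlgorithm_fix hF _).prob_ne_top _
  have hqr := congrArg ENNReal.toReal hq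
  have hm' : (0 : ℝ) < m.val := by exact_mod_cast hm
  rw [ENNReal.toReal_mul, ENNReal.toReal_add (by split_ifs <;> simp)
    (ENNReal.mul_ne_top (by simp) hne), ENNReal.toReal_mul, ENNReal.toReal_pow,
    ENNReal.toReal_natCast, Nat.cast_sub h1] at hqr
  simp only [ENNReal.toReal_inv, ENNReal.toReal_ofNat, inv_pow, Nat.cast_pow,
    Nat.cast_ofNat] at hqr
  have h2I : (0 : ℝ) < 2 ^ I := by positivity
  rw [eq_inv_mul_iff_mul_eq₀ h2I.ne'] at hqr
  change G 1 0 = _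
  rw [← ENNReal.ofReal_toReal hne]
  split_ifs at hqr ⊢
  · congr 1
    rw [eq_div_iff hm'.ne']
    rw [ENNReal.toReal_one] at hqr
    linarith
  · rw [ENNReal.toReal_zero] at hqr
    have : (G 1 0).toReal * m.val = 0 := by linarith
    rcases mul_eq_zero.1 this with h | h
    · rw [h, ENNReal.ofReal_zero]
    · exact absurd h hm'.ne'

/-- The averaged potential after `i` bits is c (2I + 2 - i). A bit lowers it by c. A final test
rejects with probability at most 1/2, as 2ᴵ ≤ 2m, and c + c (2I + 2) / 2 = c (I + 2) closes the
bound. -/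
theorem expectedTime_uniformBelow_le {m : BigNat w} (hm : 1 ≤ m.val) :
    (uniformBelow m).expectedTime ≤
      ((2 + 4 * words w (4 * m.val) ^ 2) * (2 * Nat.clog 2 m.val + 2) : ℕ) := by
  obtain ⟨F, h, hF, hF'⟩ := uniformBelow_eq_fix m
  rw [h]
  obtain ⟨h1, h2, h3⟩ := two_pow_clog_bounds hm
  set I := Nat.clog 2 m.val
  set X := 4 * m.val with hX
  set c := 2 + 4 * words w X ^ 2 with hc
  clear_value c
  have hbit : ∀ i ≤ I, 2 ^ i ≤ 2 * m.val := fun i hi =>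
    (Nat.pow_le_pow_right (by norm_num) hi).trans h2
  -- The invariant has to sum over all states with the same number of bits: a single state just
  -- before a rejection has no saving.
  refine expectedTime_fix_induction hF (fun T => ∀ i ≤ I, ∑ r ∈ Finset.range (2 ^ i),
    T (⟨2 ^ i⟩, ⟨r⟩) ≤ ((2 ^ i * (c * (2 * I + 2 - i)) : ℕ) : ℝ≥0∞)) (by simp) ?_ ?_
  · intro self hself hT i hi
    rcases hi.eq_or_lt with rfl | hlt
    · have hT0 : (self (⟨1⟩, ⟨0⟩)).expectedTime ≤ ((c * (2 * I + 2) : ℕ) : ℝ≥0∞) := by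
        have := hT 0 (Nat.zero_le _)
        simpa using this
      have hstep : ∀ r ∈ Finset.range (2 ^ I), (delay 1 (F self (⟨2 ^ I⟩, ⟨r⟩))).expectedTime ≤
          (c : ℝ≥0∞) + if m.val ≤ r then ((c * (2 * I + 2) : ℕ) : ℝ≥0∞) else 0 := by
        intro r hr
        have hr' : r < 2 ^ I := Finset.mem_range.1 hr
        rw [hF']
        refine ((((Delays.delay 1 _).trans (uniformBelow_body_big (X := X) self (by omega)
          (by omega) h1))).expectedTime_le ?_).trans ?_
        · split_ifs
          · exact hself _
          · exact isAlgorithm_pure _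
        · refine add_le_add (by exact_mod_cast (by rw [hc]; omega)) ?_
          split_ifs
          · exact hT0
          · rw [expectedTime_pure]
      refine (Finset.sum_le_sum hstep).trans ?_
      rw [Finset.sum_add_distrib, ← Finset.sum_filter, Finset.sum_const, Finset.sum_const,
        Finset.card_range, nsmul_eq_mul, nsmul_eq_mul]
      have hcard : 2 * (Finset.filter (fun r => m.val ≤ r) (Finset.range (2 ^ I))).card ≤
          2 ^ I := by
        have : Finset.filter (fun r => m.val ≤ r) (Finset.range (2 ^ I)) =
            Finset.Ico m.val (2 ^ I) := by
          ext r
          simp [and_comm]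
        rw [this, Nat.card_Ico]
        omega
      norm_cast
      rw [show 2 * I + 2 - I = I + 2 by omega]
      have := Nat.mul_le_mul_right (c * (I + 1)) hcard
      linarith
    · have hstep : ∀ r ∈ Finset.range (2 ^ i), (delay 1 (F self (⟨2 ^ i⟩, ⟨r⟩))).expectedTime ≤
          (c : ℝ≥0∞) + 2⁻¹ * ((self (⟨2 ^ (i + 1)⟩, ⟨2 * r⟩)).expectedTime +
            (self (⟨2 ^ (i + 1)⟩, ⟨2 * r + 1⟩)).expectedTime) := by
        intro r hr
        have hr' : r < 2 ^ i := Finset.mem_range.1 hr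
        have hi' := hbit i hi
        have e1 : 2 * 2 ^ i ≤ X := by omega
        have e2 : 2 * r + 1 ≤ X := by omega
        have hbr : ∀ b : Bool, (add ⟨2 ^ i⟩ ⟨2 ^ i⟩ >>= fun s' => add ⟨r⟩ ⟨r⟩ >>= fun r' =>
            add r' ⟨b.toNat⟩ >>= fun r'' => self (s', r'')).IsAlgorithm := fun b =>
          (isAlgorithm_op _ _ _).bind fun _ => (isAlgorithm_op _ _ _).bind fun _ =>
            (isAlgorithm_op _ _ _).bind fun _ => hself _
        rw [hF']
        refine ((((Delays.delay 1 _).trans (uniformBelow_body_small (X := X) self e1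
          (h3 i hlt) (by omega)))).expectedTime_le (isAlgorithm_flip.bind hbr)).trans ?_
        refine (add_le_add_right (expectedTime_flip_bind_le hbr) _).trans ?_
        have hb := fun b => (uniformBelow_branch self e1 e2 b).expectedTime_le (hself _)
        refine (add_le_add_right (add_le_add_right (mul_le_mul_right
          (add_le_add (hb true) (hb false)) _) _) _).trans (le_of_eq ?_)
        rw [add_add_add_comm, mul_add, half_add_half, pow_succ', Bool.toNat_true, Bool.toNat_false,
          add_zero, add_comm (self (_, ⟨2 * r⟩)).expectedTime, hc]
        push_cast
        ring_nf
      refine (Finset.sum_le_sum hstep).trans ?_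
      rw [Finset.sum_add_distrib, ← Finset.mul_sum,
        ← sum_range_two_mul fun r => (self (⟨2 ^ (i + 1)⟩, ⟨r⟩)).expectedTime, ← pow_succ',
        Finset.sum_const, Finset.card_range, nsmul_eq_mul]
      refine (add_le_add_right (mul_le_mul_right (hT (i + 1) hlt) _) _).trans (le_of_eq ?_)
      have e : 2 ^ (i + 1) * (c * (2 * I + 2 - (i + 1))) =
          2 ^ i * (c * (2 * I + 2 - (i + 1))) + 2 ^ i * (c * (2 * I + 2 - (i + 1))) := by ring
      have e' := congrArg (Nat.cast (R := ℝ≥0∞)) e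
      rw [Nat.cast_add] at e'
      rw [e', half_add_half]
      norm_cast
      rw [show 2 * I + 2 - i = 2 * I + 2 - (i + 1) + 1 by omega]
      ring
  · intro T hT
    simpa using hT 0 (Nat.zero_le _)

end

/-! ## The acceptance test -/

/-- The result of the comparison in a round with `N = 2ʳ`, where `u` is given by the first `2r` bits
of the random number. -/
def verdict (l k N u : ℕ) : Option Bool :=
  if (u + 1) * weightHi l (N * N * (N * N)) N 1 ≤ N * N * weightLo l (N * N * (N * N)) N k then
    some true
  else if u * weightLo l (N * N * (N * N)) N 1 ≤ N * N * weightHi l (N * N * (N * N)) N k then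
    none
  else some false

section

variable {w : ℕ}

/-- A round of the acceptance test, after the random bits have been read. -/
noncomputable def acceptRound (self : BigNat w × BigNat w → RComp Bool) (l k N u : BigNat w) :
    RComp Bool :=
  mul N N >>= fun B => mul B B >>= fun D => weightBounds l D N ⟨1⟩ >>= fun p =>
    weightBounds l D N k >>= fun q => add u ⟨1⟩ >>= fun u' => mul u' p.2 >>= fun a =>
    mul B q.1 >>= fun b => le a b >>= fun c => if c = true then pure true else
      mul u p.1 >>= fun c => mul B q.2 >>= fun d => le c d >>= fun e =>
        if e = true then self (N, u) else pure false

/-- A round of the acceptance test, after two random bits have been read. -/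
noncomputable def acceptBits (self : BigNat w × BigNat w → RComp Bool) (l k N u : BigNat w)
    (b₁ b₂ : Bool) : RComp Bool :=
  mul ⟨2⟩ u >>= fun u₁ => add u₁ ⟨b₁.toNat⟩ >>= fun u₂ => mul ⟨2⟩ u₂ >>= fun u₃ =>
    add u₃ ⟨b₂.toNat⟩ >>= fun u => acceptRound self l k N u

theorem acceptRound_admissible (l k N u : BigNat w) :
    Admissible fun self => acceptRound self l k N u := by
  refine (admissible_const (isAlgorithm_op _ _ _)).bind fun _ => ?_
  refine (admissible_const (isAlgorithm_op _ _ _)).bind fun _ => ?_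
  refine (admissible_const (isAlgorithm_weightBounds _ _ _ _)).bind fun _ => ?_
  refine (admissible_const (isAlgorithm_weightBounds _ _ _ _)).bind fun _ => ?_
  refine (admissible_const (isAlgorithm_op _ _ _)).bind fun _ => ?_
  refine (admissible_const (isAlgorithm_op _ _ _)).bind fun _ => ?_
  refine (admissible_const (isAlgorithm_op _ _ _)).bind fun _ => ?_
  refine (admissible_const (isAlgorithm_le _ _)).bind fun _ =>
    Admissible.ite _ (admissible_const (isAlgorithm_pure _)) ?_
  refine (admissible_const (isAlgorithm_op _ _ _)).bind fun _ => ?_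
  refine (admissible_const (isAlgorithm_op _ _ _)).bind fun _ => ?_
  exact (admissible_const (isAlgorithm_le _ _)).bind fun _ =>
    Admissible.ite _ (admissible_self _) (admissible_const (isAlgorithm_pure _))

theorem acceptBits_admissible (l k N u : BigNat w) (b₁ b₂ : Bool) :
    Admissible fun self => acceptBits self l k N u b₁ b₂ := by
  refine (admissible_const (isAlgorithm_op _ _ _)).bind fun _ => ?_
  refine (admissible_const (isAlgorithm_op _ _ _)).bind fun _ => ?_
  refine (admissible_const (isAlgorithm_op _ _ _)).bind fun _ => ?_
  exact (admissible_const (isAlgorithm_op _ _ _)).bind fun _ => acceptRound_admissible _ _ _ _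

theorem accept_eq_fix (l k : BigNat w) : ∃ F, accept l k = fix F (⟨1⟩, ⟨0⟩) ∧
    (∀ a, Admissible fun self => F self a) ∧
    ∀ self N u, F self (N, u) = (add N N >>= fun N => flip >>= fun b₁ => flip >>= fun b₂ =>
      acceptBits self l k N u b₁ b₂) := by
  have hF : ∀ (self : BigNat w × BigNat w → RComp Bool) (N u : BigNat w),
      (add N N >>= fun N => bit >>= fun b₁ => bit >>= fun b₂ => mul ⟨2⟩ u >>= fun u₁ =>
        add u₁ b₁ >>= fun u₂ => mul ⟨2⟩ u₂ >>= fun u₃ =>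
        add u₃ b₂ >>= fun u => acceptRound self l k N u) =
      (add N N >>= fun N => flip >>= fun b₁ => flip >>= fun b₂ =>
        acceptBits self l k N u b₁ b₂) := by
    intro self N u
    simp only [bit, bind_assoc', pure_bind', acceptBits]
  refine ⟨_, rfl, fun x => ?_, fun self N u => hF self N u⟩
  refine (congrArg Admissible (funext fun self => hF self x.1 x.2)).mpr ?_
  refine (admissible_const (isAlgorithm_op _ _ _)).bind fun _ => ?_
  refine (admissible_const isAlgorithm_flip).bind fun _ => ?_
  exact (admissible_const isAlgorithm_flip).bind fun _ => acceptBits_admissible _ _ _ _ _ _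

theorem isAlgorithm_accept (l k : BigNat w) : (accept l k).IsAlgorithm := by
  obtain ⟨F, h, hF, -⟩ := accept_eq_fix l k
  rw [h]
  exact isAlgorithm_fix hF _

/-- What follows a round of the acceptance test. -/
noncomputable def acceptNext (self : BigNat w × BigNat w → RComp Bool) (l k N u : ℕ) :
    RComp Bool := (verdict l k N u).elim (self (⟨N⟩, ⟨u⟩)) pure

theorem isAlgorithm_acceptNext {self : BigNat w × BigNat w → RComp Bool}
    (hself : ∀ a, (self a).IsAlgorithm) (l k N u : ℕ) : (acceptNext self l k N u).IsAlgorithm := by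
  rw [acceptNext]
  cases verdict l k N u
  · exact hself _
  · exact isAlgorithm_pure _

/-- The bound in `hX` is a numerator below N² times an upper bound for the weights, the largest
product formed in a round. -/
theorem acceptRound_delays (self : BigNat w × BigNat w → RComp Bool) {l k N u X : ℕ} (hN : 2 ≤ N)
    (hk : 1 ≤ k) (hkl : k < l) (hl : 2 * l ≤ X) (hu : u + 1 ≤ N * N)
    (hX : N * N * ((N * N * (N * N)) ^ 4 * (2 * N + 2) ^ 2) ≤ X) :
    Delays (acceptRound self ⟨l⟩ ⟨k⟩ ⟨N⟩ ⟨u⟩) (acceptNext self l k N u)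
      (20 * (N + 8) * (Nat.size (N * N * (N * N)) + 2) * words w X ^ 2) := by
  set D := N * N * (N * N) with hD
  have hB0 : 1 ≤ N * N := Nat.mul_pos (by omega) (by omega)
  have hD1 : 1 ≤ D := Nat.mul_pos hB0 hB0
  have hYX : D ^ 4 * (2 * N + 2) ^ 2 ≤ N * N * (D ^ 4 * (2 * N + 2) ^ 2) :=
    Nat.le_mul_of_pos_left _ hB0
  have hY1 : 1 ≤ (2 * N + 2) ^ 2 := Nat.one_le_pow _ _ (by omega)
  have hD4 : D ≤ D ^ 4 := Nat.le_self_pow (by norm_num) D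
  have hD4' : D ^ 4 ≤ D ^ 4 * (2 * N + 2) ^ 2 := Nat.le_mul_of_pos_right _ hY1
  have hDX : D ≤ X := by omega
  have hBX : N * N ≤ X := (Nat.le_mul_of_pos_right _ hB0).trans (hD ▸ hDX)
  have hNX : N ≤ X := (Nat.le_mul_of_pos_right _ (by omega)).trans hBX
  have hWX : D ^ 2 * (2 * N + 2) ^ 2 ≤ X := by
    refine le_trans ?_ (hYX.trans hX)
    gcongr
    norm_num
  obtain ⟨p1, p2⟩ := weight_le (N := N) l 1 hD1
  obtain ⟨q1, q2⟩ := weight_le (N := N) l k hD1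
  have huX : u ≤ X := by omega
  have hmul : ∀ x y : ℕ, x ≤ N * N → y ≤ D ^ 4 * (2 * N + 2) ^ 2 → x * y ≤ X := fun x y hx hy =>
    (Nat.mul_le_mul hx hy).trans hX
  have hwX : ∀ y, y ≤ D ^ 4 * (2 * N + 2) ^ 2 → y ≤ X := fun y hy => hy.trans (hYX.trans hX)
  have hu1 : u + 1 ≤ X := by omega
  set Q := words w X ^ 2
  set s := Nat.size D
  refine Delays.mono (c := Q + (Q + (10 * (N + 7) * (s + 2) * Q + (10 * (N + 7) * (s + 2) * Q +
    (Q + (Q + (Q + (Q + 3 * Q)))))))) ?_ (by nlinarith [Nat.zero_le (s * Q)])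
  refine ((returns_mul (a := ⟨N⟩) (b := ⟨N⟩) hNX hNX).delays _).trans ?_
  refine ((returns_mul (a := ⟨N * N⟩) (b := ⟨N * N⟩) hBX hBX).delays _).trans ?_
  refine ((returns_weightBounds (l := ⟨l⟩) (k := ⟨1⟩) (N := ⟨N⟩) (D := ⟨D⟩) hl
    (by show 1 ≤ l; omega) hN hD1 hWX).delays _).trans ?_
  refine ((returns_weightBounds (l := ⟨l⟩) (k := ⟨k⟩) (N := ⟨N⟩) (D := ⟨D⟩) hl hkl.le
    hN hD1 hWX).delays _).trans ?_
  refine ((returns_add (a := ⟨u⟩) (b := ⟨1⟩) huX (by show 1 ≤ X; omega)).delays _).trans ?_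
  refine ((returns_mul (a := ⟨u + 1⟩) (b := ⟨weightHi l D N 1⟩) hu1 (hwX _ p2)).delays _).trans ?_
  refine ((returns_mul (a := ⟨N * N⟩) (b := ⟨weightLo l D N k⟩) hBX (hwX _ q1)).delays _).trans ?_
  refine ((returns_le (a := ⟨(u + 1) * weightHi l D N 1⟩) (b := ⟨N * N * weightLo l D N k⟩)
    (hmul _ _ hu p2) (hmul _ _ le_rfl q1)).delays _).trans ?_
  rw [acceptNext]
  by_cases h1 : (u + 1) * weightHi l D N 1 ≤ N * N * weightLo l D N k
  · have hv : verdict l k N u = some true := if_pos h1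
    simp only [h1, decide_true, if_true, hv, Option.elim_some]
    exact (Delays.refl _).mono (Nat.zero_le _)
  simp only [h1, decide_false, Bool.false_eq_true, if_false]
  refine Delays.mono (c := Q + (Q + (Q + 0))) ?_ (by omega)
  refine ((returns_mul (a := ⟨u⟩) (b := ⟨weightLo l D N 1⟩) huX (hwX _ p1)).delays _).trans ?_
  refine ((returns_mul (a := ⟨N * N⟩) (b := ⟨weightHi l D N k⟩) hBX (hwX _ q2)).delays _).trans ?_
  refine ((returns_le (a := ⟨u * weightLo l D N 1⟩) (b := ⟨N * N * weightHi l D N k⟩)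
    (hmul _ _ (by omega) p1) (hmul _ _ le_rfl q2)).delays _).trans ?_
  by_cases h2 : u * weightLo l D N 1 ≤ N * N * weightHi l D N k
  · have hv : verdict l k N u = none := (if_neg h1).trans (if_pos h2)
    simp only [h2, decide_true, if_true, hv, Option.elim_none]
    exact Delays.refl _
  · have hv : verdict l k N u = some false := (if_neg h1).trans (if_neg h2)
    simp only [h2, decide_false, if_false, Bool.false_eq_true, hv, Option.elim_some]
    exact Delays.refl _

theorem acceptBits_delays (self : BigNat w × BigNat w → RComp Bool) {l k N u X : ℕ} (hN : 1 ≤ N)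
    (hk : 1 ≤ k) (hkl : k < l) (hl : 2 * l ≤ X) (hu : u < N * N)
    (hX : 2 * N * (2 * N) * ((2 * N * (2 * N) * (2 * N * (2 * N))) ^ 4 * (2 * (2 * N) + 2) ^ 2) ≤ X)
    (b₁ b₂ : Bool) :
    Delays (acceptBits self ⟨l⟩ ⟨k⟩ ⟨2 * N⟩ ⟨u⟩ b₁ b₂)
      (acceptNext self l k (2 * N) (2 * (2 * u + b₁.toNat) + b₂.toNat))
      (20 * (2 * N + 9) * (Nat.size (2 * N * (2 * N) * (2 * N * (2 * N))) + 2) *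
        words w X ^ 2) := by
  have h1 := Bool.toNat_le b₁
  have h2 := Bool.toNat_le b₂
  have hv : 2 * (2 * u + b₁.toNat) + b₂.toNat + 1 ≤ 2 * N * (2 * N) := by nlinarith
  have hX4 : 2 * N * (2 * N) ≤ X := by
    refine le_trans (Nat.le_mul_of_pos_right _ ?_) hX
    positivity
  refine Delays.mono (c := words w X ^ 2 + (words w X ^ 2 + (words w X ^ 2 + (words w X ^ 2 +
    20 * (2 * N + 8) * (Nat.size (2 * N * (2 * N) * (2 * N * (2 * N))) + 2) * words w X ^ 2)))) ?_
    (by nlinarith [Nat.zero_le (Nat.size (2 * N * (2 * N) * (2 * N * (2 * N))) * words w X ^ 2)])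
  refine ((returns_mul (a := ⟨2⟩) (b := ⟨u⟩) ?_ ?_).delays _).trans ?_
  · show 2 ≤ X
    omega
  · show u ≤ X
    omega
  refine ((returns_add (a := ⟨2 * u⟩) (b := ⟨b₁.toNat⟩) ?_ ?_).delays _).trans ?_
  · show 2 * u ≤ X
    omega
  · show b₁.toNat ≤ X
    omega
  refine ((returns_mul (a := ⟨2⟩) (b := ⟨2 * u + b₁.toNat⟩) ?_ ?_).delays _).trans ?_
  · show 2 ≤ X
    omega
  · show 2 * u + b₁.toNat ≤ X
    omega
  refine ((returns_add (a := ⟨2 * (2 * u + b₁.toNat)⟩) (b := ⟨b₂.toNat⟩) ?_ ?_).delays _).trans ?_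
  · show 2 * (2 * u + b₁.toNat) ≤ X
    omega
  · show b₂.toNat ≤ X
    omega
  exact acceptRound_delays self (by omega) hk hkl hl hv hX

/-- The random numbers for which the comparison is not decided after `r` rounds. -/
def undecided (l k r : ℕ) : Finset ℕ :=
  if r = 0 then {0} else (Finset.range (4 ^ r)).filter fun u => verdict l k (2 ^ r) u = none

theorem mem_undecided {l k r u : ℕ} (hr : r ≠ 0) :
    u ∈ undecided l k r ↔ u < 4 ^ r ∧ verdict l k (2 ^ r) u = none := by
  rw [undecided, if_neg hr, Finset.mem_filter, Finset.mem_range]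

theorem undecided_subset (l k r : ℕ) : undecided l k r ⊆ Finset.range (4 ^ r) := by
  intro u hu
  by_cases hr : r = 0
  · subst hr
    simpa [undecided] using hu
  · exact Finset.mem_range.2 ((mem_undecided hr).1 hu).1

/-- An undecided u must satisfy u q_lo ≤ N² p_hi-type inequalities for enclosures of relative width
O(1/N²), so after scaling by N² the admissible u fill an interval of bounded length. The set
contains all such u, whether or not an earlier round would already have decided. -/
theorem card_undecided_le {l k : ℕ} (hk : 1 ≤ k) (hkl : k < l) (r : ℕ) :
    (undecided l k r).card ≤ 7202 := by
  by_cases hr : r = 0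
  · subst hr
    simp [undecided]
  have key : ∀ u ∈ undecided l k r, ∀ v ∈ undecided l k r, v ≤ u + 7201 := by
    intro u hu v hv
    have hu := ((mem_undecided hr).1 hu).2
    have hv := ((mem_undecided hr).1 hv).2
    have hN : 2 ≤ 2 ^ r := by
      calc 2 = 2 ^ 1 := rfl
        _ ≤ 2 ^ r := Nat.pow_le_pow_right (by norm_num) (by omega)
    set N := 2 ^ r
    have hD : N * N * (N * N) = N ^ 4 := by ring
    obtain ⟨p1, p2, p3, p4, p5⟩ := weight_enclosure (k := 1) le_rfl (by omega) hN hD (l := l)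
    obtain ⟨q1, q2, q3, q4, q5⟩ := weight_enclosure hk hkl hN hD
    have hp := p2.trans p3
    have hq := q2.trans q3
    clear p2 p3 q2 q3
    have h1 : N * N * weightLo l (N * N * (N * N)) N k <
        (u + 1) * weightHi l (N * N * (N * N)) N 1 := by
      by_contra h
      rw [verdict, if_pos (not_lt.1 h)] at hu
      cases hu
    have h2 : v * weightLo l (N * N * (N * N)) N 1 ≤
        N * N * weightHi l (N * N * (N * N)) N k := by
      by_contra h
      rw [verdict, if_neg h] at hv
      split_ifs at hv
    have h1' : ((N : ℝ) * N) * weightLo l (N * N * (N * N)) N k <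
        (u + 1) * weightHi l (N * N * (N * N)) N 1 := by exact_mod_cast h1
    have h2' : (v : ℝ) * weightLo l (N * N * (N * N)) N 1 ≤
        (N * N) * weightHi l (N * N * (N * N)) N k := by exact_mod_cast h2
    have hN2 : (2 : ℝ) ≤ N := by exact_mod_cast hN
    have hDp : (0 : ℝ) < ((N * N * (N * N) : ℕ) : ℝ) := by rw [hD]; positivity
    generalize N * N * (N * N) = D at *
    generalize (weightLo l D N 1 : ℝ) = pl at *
    generalize (weightHi l D N 1 : ℝ) = ph at *
    generalize hql : (weightLo l D N k : ℝ) = ql at *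
    generalize (weightHi l D N k : ℝ) = qh at *
    have hE : (0 : ℝ) < (D : ℝ) ^ 4 := by positivity
    generalize (D : ℝ) ^ 4 = E at *
    have hB : (0 : ℝ) < (N : ℝ) * N := by positivity
    rw [le_div_iff₀ (by positivity), sq] at p4 q4
    generalize (N : ℝ) * N = B at *
    by_contra hcon
    have hcon' : (u : ℝ) + 7202 ≤ v := by exact_mod_cast (by omega : u + 7202 ≤ v)
    have hpl : 0 < pl := by linarith
    have hql0 : 0 ≤ ql := by linarith
    have hph0 : 0 < ph := hpl.trans_le hp
    -- Cross-multiplying the two failed tests. The right side is at most 2 · 25 · 9 E² = 450 E², and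
    -- pl ph ≥ E² / 16, so v - u - 1 ≤ 7200.
    have e1 : (v - u - 1) * (pl * ph) ≤ B * (qh - ql) * ph + ql * (B * (ph - pl)) := by
      have := mul_le_mul_of_nonneg_right h2' hph0.le
      have := mul_le_mul_of_nonneg_right h1'.le hpl.le
      nlinarith
    have e2 : (7201 : ℝ) * (pl * ph) ≤ (v - u - 1) * (pl * ph) := by
      have : 0 < pl * ph := by positivity
      gcongr
      linarith
    have e3 : E / 4 * (E / 4) ≤ pl * ph := by
      apply mul_le_mul p1 (by linarith) (by positivity) hpl.le
    have e4 : B * (qh - ql) * ph ≤ 25 * E * (9 * E) := by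
      rw [mul_comm B]
      exact mul_le_mul q4 p5 hph0.le (by positivity)
    have e5 : ql * (B * (ph - pl)) ≤ 9 * E * (25 * E) := by
      have h0 : 0 ≤ B * (ph - pl) := mul_nonneg hB.le (by linarith)
      have h1 : B * (ph - pl) ≤ 25 * E := by linarith
      exact mul_le_mul (by linarith) h1 h0 (by positivity)
    nlinarith
  rcases (undecided l k r).eq_empty_or_nonempty with h | h
  · rw [h]
    simp
  · have hsub : undecided l k r ⊆
        Finset.Icc ((undecided l k r).min' h) ((undecided l k r).min' h + 7201) := fun v hv =>
      Finset.mem_Icc.2 ⟨Finset.min'_le _ _ hv, key _ (Finset.min'_mem _ h) _ hv⟩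
    refine (Finset.card_le_card hsub).trans ?_
    rw [Nat.card_Icc]
    omega

/-- The conditional probability of the event `U ≤ θ`, given that the integral part of `N² U`
is `u`. -/
noncomputable def clampProb (θ : ℝ) (N u : ℕ) : ℝ := min 1 (max 0 ((N : ℝ) * N * θ - u))

/-- Reading two more bits cuts a cell into four equal cells, and the conditional probability is the
mean of the four new ones. -/
theorem clamp_average (x : ℝ) : min 1 (max 0 x) =
    (min 1 (max 0 (4 * x)) + min 1 (max 0 (4 * x - 1)) + min 1 (max 0 (4 * x - 2)) +
      min 1 (max 0 (4 * x - 3))) / 4 := by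
  have clamp0 : ∀ y : ℝ, y ≤ 0 → min 1 (max 0 y) = 0 := fun y h => by
    rw [max_eq_left h, min_eq_right zero_le_one]
  have clamp1 : ∀ y : ℝ, 1 ≤ y → min 1 (max 0 y) = 1 := fun y h => by
    rw [max_eq_right (zero_le_one.trans h), min_eq_left h]
  have clamp : ∀ y : ℝ, 0 ≤ y → y ≤ 1 → min 1 (max 0 y) = y := fun y h h' => by
    rw [max_eq_right h, min_eq_right h']
  rcases le_total x 0 with h | h
  · rw [clamp0 x h, clamp0 _ (by linarith), clamp0 _ (by linarith), clamp0 _ (by linarith),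
      clamp0 _ (by linarith)]
    norm_num
  rcases le_total x (1 / 4) with h1 | h1
  · rw [clamp x h (by linarith), clamp _ (by linarith) (by linarith), clamp0 _ (by linarith),
      clamp0 _ (by linarith), clamp0 _ (by linarith)]
    ring
  rcases le_total x (2 / 4) with h2 | h2
  · rw [clamp x h (by linarith), clamp1 _ (by linarith), clamp _ (by linarith) (by linarith),
      clamp0 _ (by linarith), clamp0 _ (by linarith)]
    ring
  rcases le_total x (3 / 4) with h3 | h3
  · rw [clamp x h (by linarith), clamp1 _ (by linarith), clamp1 _ (by linarith),
      clamp _ (by linarith) (by linarith), clamp0 _ (by linarith)]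
    ring
  rcases le_total x 1 with h4 | h4
  · rw [clamp x h (by linarith), clamp1 _ (by linarith), clamp1 _ (by linarith),
      clamp1 _ (by linarith), clamp _ (by linarith) (by linarith)]
    ring
  · rw [clamp1 x h4, clamp1 _ (by linarith), clamp1 _ (by linarith),
      clamp1 _ (by linarith), clamp1 _ (by linarith)]
    norm_num

theorem clampProb_average (θ : ℝ) (N u : ℕ) : clampProb θ N u =
    (clampProb θ (2 * N) (4 * u) + clampProb θ (2 * N) (4 * u + 1) +
      clampProb θ (2 * N) (4 * u + 2) + clampProb θ (2 * N) (4 * u + 3)) / 4 := by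
  rw [clampProb, clamp_average]
  simp only [clampProb]
  push_cast
  congr 4 <;> ring_nf

/-- The ratio of the weights of `k` and `1`. -/
noncomputable def weightRatio (l k : ℕ) : ℝ :=
  (oddZeta k * oddZeta (l - k)) / (oddZeta 1 * oddZeta (l - 1))

/-- All values λ(j) lie in [1, 5/4], so the ratio is at least (4/5)². This bounds the rejection
probability by 9/25 and keeps the size distribution close to uniform. -/
theorem weightRatio_bounds {l k : ℕ} (hk : 1 ≤ k) (hkl : k < l) :
    16 / 25 ≤ weightRatio l k ∧ weightRatio l k ≤ 1 := by
  have h1 := one_le_oddZeta (le_refl 1)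
  have h2 := one_le_oddZeta (by omega : 1 ≤ l - 1)
  have h3 := one_le_oddZeta hk
  have h4 := one_le_oddZeta (by omega : 1 ≤ l - k)
  have h5 := oddZeta_le (le_refl 1)
  have h6 := oddZeta_le (by omega : 1 ≤ l - 1)
  have hpos : 0 < oddZeta 1 * oddZeta (l - 1) := by positivity
  rw [weightRatio, le_div_iff₀ hpos, div_le_one hpos]
  refine ⟨?_, oddZeta_mul_le hk hkl⟩
  have : oddZeta 1 * oddZeta (l - 1) ≤ 5 / 4 * (5 / 4) :=
    mul_le_mul h5 h6 (by linarith) (by norm_num)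
  nlinarith

/-- Soundness of the enclosures: a decision in round r means that the whole cell of U lies on one
side of the threshold. -/
theorem clampProb_of_verdict {l k N u : ℕ} (hk : 1 ≤ k) (hkl : k < l) (hN : 2 ≤ N) {b : Bool}
    (h : verdict l k N u = some b) : clampProb (weightRatio l k) N u = if b then 1 else 0 := by
  have hD : N * N * (N * N) = N ^ 4 := by ring
  obtain ⟨-, p2, p3, -, -⟩ := weight_enclosure (k := 1) le_rfl (by omega) hN hD (l := l)
  obtain ⟨-, q2, q3, -, -⟩ := weight_enclosure hk hkl hN hD
  have hDp : (0 : ℝ) < ((N * N * (N * N) : ℕ) : ℝ) := by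
    rw [hD]
    have : (0 : ℝ) < N := by exact_mod_cast (by omega : 0 < N)
    positivity
  have h1 := one_le_oddZeta (le_refl 1)
  have h2 := one_le_oddZeta (by omega : 1 ≤ l - 1)
  have hpos : 0 < oddZeta 1 * oddZeta (l - 1) := by positivity
  rw [clampProb, weightRatio]
  rw [verdict] at h
  split_ifs at h with c1 c2
  · obtain rfl : true = b := by simpa using h
    have c1' : ((u : ℝ) + 1) * weightHi l (N * N * (N * N)) N 1 ≤
        N * N * weightLo l (N * N * (N * N)) N k := by exact_mod_cast c1
    generalize N * N * (N * N) = D at *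
    have hE : (0 : ℝ) < (D : ℝ) ^ 4 := by positivity
    have : (u + 1) * (oddZeta 1 * oddZeta (l - 1)) ≤
        (N : ℝ) * N * (oddZeta k * oddZeta (l - k)) := by
      refine le_of_mul_le_mul_left ?_ hE
      have e1 := mul_le_mul_of_nonneg_left p3 (by positivity : (0 : ℝ) ≤ u + 1)
      have e2 := mul_le_mul_of_nonneg_left q2 (by positivity : (0 : ℝ) ≤ (N : ℝ) * N)
      linarith
    have h3 : (1 : ℝ) ≤ N * N * (oddZeta k * oddZeta (l - k) / (oddZeta 1 * oddZeta (l - 1))) - u := by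
      rw [← mul_div_assoc, le_sub_iff_add_le, le_div_iff₀ hpos, add_comm]
      exact this
    rw [max_eq_right (zero_le_one.trans h3), min_eq_left h3]
    rfl
  · obtain rfl : false = b := by simpa using h
    have c2' : (N : ℝ) * N * weightHi l (N * N * (N * N)) N k <
        u * weightLo l (N * N * (N * N)) N 1 := by exact_mod_cast not_le.1 c2
    generalize N * N * (N * N) = D at *
    have hE : (0 : ℝ) < (D : ℝ) ^ 4 := by positivity
    have : (N : ℝ) * N * (oddZeta k * oddZeta (l - k)) ≤
        u * (oddZeta 1 * oddZeta (l - 1)) := by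
      refine le_of_mul_le_mul_left ?_ hE
      have e1 := mul_le_mul_of_nonneg_left p2 (by positivity : (0 : ℝ) ≤ u)
      have e2 := mul_le_mul_of_nonneg_left q3 (by positivity : (0 : ℝ) ≤ (N : ℝ) * N)
      linarith
    have h3 : N * N * (oddZeta k * oddZeta (l - k) / (oddZeta 1 * oddZeta (l - 1))) - u ≤ (0 : ℝ) := by
      rw [← mul_div_assoc, sub_nonpos, div_le_iff₀ hpos]
      exact this
    rw [max_eq_left h3, min_eq_right zero_le_one]
    rfl

theorem sum_range_four_mul {M : Type*} [AddCommMonoid M] (f : ℕ → M) (n : ℕ) :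
    ∑ r ∈ Finset.range (4 * n), f r =
      ∑ r ∈ Finset.range n, (f (4 * r) + f (4 * r + 1) + f (4 * r + 2) + f (4 * r + 3)) := by
  rw [show 4 * n = 2 * (2 * n) by ring, sum_range_two_mul, sum_range_two_mul]
  refine Finset.sum_congr rfl fun r _ => ?_
  rw [← add_assoc]
  ring_nf

theorem prob_accept_step {F : (BigNat w × BigNat w → RComp Bool) → BigNat w × BigNat w → RComp Bool}
    {l k : ℕ} (hF : ∀ a, Admissible fun self => F self a)
    (hF' : ∀ self N u, F self (N, u) = (add N N >>= fun N => flip >>= fun b₁ => flip >>= fun b₂ =>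
      acceptBits self ⟨l⟩ ⟨k⟩ N u b₁ b₂)) (hk : 1 ≤ k) (hkl : k < l) {N u : ℕ} (hN : 1 ≤ N)
    (hu : u < N * N) (c : Bool) :
    ((fix F (⟨N⟩, ⟨u⟩)).prob c).toReal =
      (((acceptNext (fix F) l k (2 * N) (4 * u)).prob c).toReal +
      ((acceptNext (fix F) l k (2 * N) (4 * u + 1)).prob c).toReal +
      ((acceptNext (fix F) l k (2 * N) (4 * u + 2)).prob c).toReal +
      ((acceptNext (fix F) l k (2 * N) (4 * u + 3)).prob c).toReal) / 4 := by
  obtain ⟨X, hX1, hX2, hX3⟩ : ∃ X, N ≤ X ∧ 2 * l ≤ X ∧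
    2 * N * (2 * N) * ((2 * N * (2 * N) * (2 * N * (2 * N))) ^ 4 * (2 * (2 * N) + 2) ^ 2) ≤ X :=
    ⟨max N (max (2 * l) _), le_max_left _ _, (le_max_left _ _).trans (le_max_right _ _),
      (le_max_right _ _).trans (le_max_right _ _)⟩
  have hne : ∀ v, (acceptNext (fix F) l k (2 * N) v).prob c ≠ ⊤ := fun v =>
    (isAlgorithm_acceptNext (isAlgorithm_fix hF) l k (2 * N) v).prob_ne_top c
  have hb := fun b₁ b₂ => (acceptBits_delays (fix F) (w := w) hN hk hkl hX2 hu hX3 b₁ b₂).prob_eq c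
  rw [fix_eq hF, prob_delay, hF', ((returns_add (a := ⟨N⟩) (b := ⟨N⟩) hX1 hX1).delays _).prob_eq]
  have h2 : N + N = 2 * N := (two_mul N).symm
  simp only [h2]
  rw [prob_flip_bind, prob_flip_bind, prob_flip_bind, hb, hb, hb, hb]
  simp only [Bool.toNat_true, Bool.toNat_false, add_zero]
  rw [show 2 * (2 * u + 1) + 1 = 4 * u + 3 by ring, show 2 * (2 * u + 1) = 4 * u + 2 by ring,
    show 2 * (2 * u) + 1 = 4 * u + 1 by ring, show 2 * (2 * u) = 4 * u by ring]
  have hadd : ∀ v v', (2⁻¹ * ((acceptNext (fix F) l k (2 * N) v).prob c +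
      (acceptNext (fix F) l k (2 * N) v').prob c)) ≠ ⊤ := fun v v' =>
    ENNReal.mul_ne_top (by simp) (ENNReal.add_ne_top.2 ⟨hne v, hne v'⟩)
  rw [ENNReal.toReal_mul, ENNReal.toReal_add (hadd _ _) (hadd _ _), ENNReal.toReal_mul,
    ENNReal.toReal_mul, ENNReal.toReal_add (hne _) (hne _), ENNReal.toReal_add (hne _) (hne _)]
  simp only [ENNReal.toReal_inv, ENNReal.toReal_ofNat]
  ring

theorem coinProb_bounds {x : ℝ} (h0 : 0 ≤ x) (h1 : x ≤ 1) (c : Bool) :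
    0 ≤ coinProb x c ∧ coinProb x c ≤ 1 := by
  cases c <;> simp [coinProb, h0, h1]

/-- The error against the exact conditional probability vanishes at decided cells, so it is carried
by the undecided ones. Going back one round divides the sum of errors by 4; a bounded number of
cells with errors at most 1 gives 7202 · 4⁻ʳ at the start, for every r. -/
theorem prob_accept {l k : ℕ} (hk : 1 ≤ k) (hkl : k < l) (c : Bool) :
    (accept (⟨l⟩ : BigNat w) ⟨k⟩).prob c = ENNReal.ofReal (coinProb (weightRatio l k) c) := by
  obtain ⟨F, h, hF, hF'⟩ := accept_eq_fix (⟨l⟩ : BigNat w) ⟨k⟩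
  have halg := isAlgorithm_fix hF
  obtain ⟨hθ0, hθ1⟩ := weightRatio_bounds hk hkl
  set θ := weightRatio l k
  set e : ℕ → ℕ → ℝ := fun r u =>
    |((fix F (⟨2 ^ r⟩, ⟨u⟩)).prob c).toReal - coinProb (clampProb θ (2 ^ r) u) c| with he
  have he0 : ∀ r u, 0 ≤ e r u := fun r u => abs_nonneg _
  have he1 : ∀ r u, e r u ≤ 1 := fun r u => by
    have h1 : ((fix F (⟨2 ^ r⟩, ⟨u⟩)).prob c).toReal ≤ 1 :=
      ENNReal.toReal_mono ENNReal.one_ne_top ((halg _).prob_le_one c)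
    have h2 := ENNReal.toReal_nonneg (a := (fix F (⟨2 ^ r⟩, ⟨u⟩)).prob c)
    have h3 := coinProb_bounds (x := clampProb θ (2 ^ r) u)
      (le_min zero_le_one (le_max_left _ _)) (min_le_left _ _) c
    rw [he, abs_le]
    constructor <;> linarith [h3.1, h3.2]
  have hnext : ∀ r v, v < 4 ^ (r + 1) →
      |((acceptNext (fix F) l k (2 ^ (r + 1)) v).prob c).toReal -
        coinProb (clampProb θ (2 ^ (r + 1)) v) c| ≤
      if v ∈ undecided l k (r + 1) then e (r + 1) v else 0 := by
    intro r v hv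
    have hN : 2 ≤ 2 ^ (r + 1) := by
      rw [pow_succ]
      have := Nat.one_le_two_pow (n := r)
      omega
    have hmem := mem_undecided (l := l) (k := k) (u := v) (Nat.succ_ne_zero r)
    rw [acceptNext]
    cases hver : verdict l k (2 ^ (r + 1)) v with
    | none => rw [if_pos (hmem.2 ⟨hv, hver⟩)]; exact le_rfl
    | some b =>
      refine le_trans (le_of_eq ?_) (show (0 : ℝ) ≤ _ from by split_ifs <;> simp [he0])
      rw [clampProb_of_verdict hk hkl hN hver]
      cases b <;> cases c <;> simp [prob_pure, coinProb]
  have hstep : ∀ r u, u < 4 ^ r → e r u ≤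
      ((if 4 * u ∈ undecided l k (r + 1) then e (r + 1) (4 * u) else 0) +
      (if 4 * u + 1 ∈ undecided l k (r + 1) then e (r + 1) (4 * u + 1) else 0) +
      (if 4 * u + 2 ∈ undecided l k (r + 1) then e (r + 1) (4 * u + 2) else 0) +
      (if 4 * u + 3 ∈ undecided l k (r + 1) then e (r + 1) (4 * u + 3) else 0)) * (1 / 4) := by
    intro r u hu
    have h4 : 4 ^ (r + 1) = 4 * 4 ^ r := pow_succ' 4 r
    have h44 : (2 : ℕ) ^ r * 2 ^ r = 4 ^ r := by rw [← mul_pow]; rfl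
    have a0 := hnext r (4 * u) (by omega)
    have a1 := hnext r (4 * u + 1) (by omega)
    have a2 := hnext r (4 * u + 2) (by omega)
    have a3 := hnext r (4 * u + 3) (by omega)
    have hp := prob_accept_step hF hF' hk hkl (Nat.one_le_two_pow (n := r))
      (by rw [h44]; exact hu) c
    have hc : coinProb (clampProb θ (2 ^ r) u) c = (coinProb (clampProb θ (2 ^ (r + 1)) (4 * u)) c +
        coinProb (clampProb θ (2 ^ (r + 1)) (4 * u + 1)) c +
        coinProb (clampProb θ (2 ^ (r + 1)) (4 * u + 2)) c +
        coinProb (clampProb θ (2 ^ (r + 1)) (4 * u + 3)) c) / 4 := by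
      rw [clampProb_average, ← pow_succ']
      cases c <;> simp only [coinProb, if_true, Bool.false_eq_true, if_false]
      ring
    rw [← pow_succ'] at hp
    rw [he, abs_le]
    rw [abs_le] at a0 a1 a2 a3
    simp only
    rw [hp, hc]
    constructor <;> linarith [a0.1, a0.2, a1.1, a1.2, a2.1, a2.2, a3.1, a3.2]
  -- Enlarging the sum to all 4ʳ cells costs nothing, because their children regroup into the 4ʳ⁺¹
  -- cells, of which only undecided ones count.
  have hS : ∀ r, ∑ u ∈ undecided l k r, e r u ≤
      (∑ u ∈ undecided l k (r + 1), e (r + 1) u) * (1 / 4) := by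
    intro r
    calc ∑ u ∈ undecided l k r, e r u ≤ ∑ u ∈ Finset.range (4 ^ r), e r u :=
          Finset.sum_le_sum_of_subset_of_nonneg (undecided_subset l k r) fun u _ _ => he0 r u
      _ ≤ _ := Finset.sum_le_sum fun u hu => hstep r u (Finset.mem_range.1 hu)
      _ = (∑ v ∈ Finset.range (4 ^ (r + 1)),
          if v ∈ undecided l k (r + 1) then e (r + 1) v else 0) * (1 / 4) := by
        rw [pow_succ', sum_range_four_mul, Finset.sum_mul]
      _ = _ := by
        rw [← Finset.sum_filter]
        congr 2
        ext v
        rw [Finset.mem_filter]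
        exact and_iff_right_of_imp fun h => undecided_subset l k (r + 1) h
  have hS0 : ∀ r, e 0 0 ≤ (∑ u ∈ undecided l k r, e r u) * (1 / 4) ^ r := by
    intro r
    induction r with
    | zero => simp [undecided]
    | succ r ih =>
      refine ih.trans ?_
      rw [pow_succ', ← mul_assoc]
      exact mul_le_mul_of_nonneg_right (hS r) (by positivity)
  have hbound : ∀ r : ℕ, e 0 0 ≤ 7202 * (1 / 4) ^ r := by
    intro r
    refine (hS0 r).trans ?_
    gcongr
    refine (Finset.sum_le_card_nsmul _ _ 1 fun u _ => he1 r u).trans ?_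
    rw [nsmul_eq_mul, mul_one]
    exact_mod_cast card_undecided_le hk hkl r
  have hlim : Filter.Tendsto (fun r : ℕ => (7202 : ℝ) * (1 / 4) ^ r) Filter.atTop (nhds 0) := by
    have := (tendsto_pow_atTop_nhds_zero_of_lt_one (r := (1 / 4 : ℝ)) (by norm_num)
      (by norm_num)).const_mul (7202 : ℝ)
    rwa [mul_zero] at this
  have hzero : e 0 0 ≤ 0 := ge_of_tendsto' hlim hbound
  have hclamp : clampProb θ (2 ^ 0) 0 = θ := by
    have h3 : (0 : ℝ) ≤ θ := by linarith
    simp [clampProb, h3, hθ1]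
  have := sub_eq_zero.1 (abs_nonpos_iff.1 hzero)
  rw [hclamp] at this
  rw [h, ← this, ENNReal.ofReal_toReal ((halg _).prob_ne_top c)]
  rfl

end

/-! ### Running time of the acceptance test. -/

section

variable {w : ℕ}

/-- The summand `w` in the exponent adds only one word, so the number of words is O(r) uniformly in
the word length. -/
theorem words_two_pow_le (hw : 1 ≤ w) (r : ℕ) : words w (2 ^ (20 * r + w + 24)) ≤ 27 * (r + 1) := by
  have h : (20 * r + w + 24 + 1) / w ≤ 20 * r + 26 := by
    refine Nat.div_le_of_le_mul ?_
    nlinarith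
  rw [words, Nat.size_pow]
  omega

/-- The cost r³ 2ʳ of a round is dominated by a geometric sequence of ratio 7/2, below the 4 of the
survival probability. From r = 4 on the quotient of consecutive left sides is at most 7. -/
theorem succ_pow_three_mul_le (r : ℕ) : (r + 1) ^ 3 * 4 ^ r ≤ 125 * 7 ^ r := by
  rcases Nat.lt_or_ge r 4 with h | h
  · interval_cases r <;> norm_num
  · induction r, h using Nat.le_induction with
    | base => norm_num
    | succ r h ih =>
      have h2 : (r + 1 + 1) ^ 3 * 4 ≤ 7 * (r + 1) ^ 3 := by
        obtain ⟨s, rfl⟩ := Nat.exists_eq_add_of_le h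
        ring_nf
        nlinarith [Nat.zero_le s, Nat.zero_le (s ^ 2), Nat.zero_le (s ^ 3)]
      calc (r + 1 + 1) ^ 3 * 4 ^ (r + 1) = (r + 1 + 1) ^ 3 * 4 * 4 ^ r := by ring
        _ ≤ 7 * (r + 1) ^ 3 * 4 ^ r := Nat.mul_le_mul_right _ h2
        _ = 7 * ((r + 1) ^ 3 * 4 ^ r) := by ring
        _ ≤ 7 * (125 * 7 ^ r) := Nat.mul_le_mul_left _ ih
        _ = _ := by ring

theorem expectedTime_acceptNext_le (s : BigNat w × BigNat w → RComp Bool) (l k : ℕ) {r v : ℕ}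
    (hv : v < 4 ^ (r + 1)) : (acceptNext s l k (2 ^ (r + 1)) v).expectedTime ≤
      if v ∈ undecided l k (r + 1) then (s (⟨2 ^ (r + 1)⟩, ⟨v⟩)).expectedTime else 0 := by
  have hmem := mem_undecided (l := l) (k := k) (u := v) (Nat.succ_ne_zero r)
  rw [acceptNext]
  cases hver : verdict l k (2 ^ (r + 1)) v with
  | none => rw [if_pos (hmem.2 ⟨hv, hver⟩)]; exact le_rfl
  | some b => simp [expectedTime_pure]

theorem average_four (p c a₀ a₁ a₂ a₃ : ℝ≥0∞) :
    p + 2⁻¹ * (p + 2⁻¹ * (c + a₃ + (c + a₂)) + (p + 2⁻¹ * (c + a₁ + (c + a₀)))) =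
      p + p + c + (a₀ + a₁ + a₂ + a₃) * (2⁻¹ * 2⁻¹) := by
  calc _ = p + 2⁻¹ * (p + p) + 2⁻¹ * (2⁻¹ * (c + c) + 2⁻¹ * (c + c)) +
      (a₀ + a₁ + a₂ + a₃) * (2⁻¹ * 2⁻¹) := by ring
    _ = _ := by rw [half_add_half, half_add_half, half_add_half]

/-- The factor 2ʳ comes from the terms of the zeta sums, one factor r + 1 from the bit length of D
in each divided power, and (r + 1)² from schoolbook arithmetic. -/
theorem expectedTime_accept_step
    {F : (BigNat w × BigNat w → RComp Bool) → BigNat w × BigNat w → RComp Bool}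
    {l k : ℕ} (hF' : ∀ self N u, F self (N, u) = (add N N >>= fun N => flip >>= fun b₁ =>
      flip >>= fun b₂ => acceptBits self ⟨l⟩ ⟨k⟩ N u b₁ b₂)) (hw : 1 ≤ w) (hl : l ≤ 2 ^ w)
    (hk : 1 ≤ k) (hkl : k < l) {s : BigNat w × BigNat w → RComp Bool}
    (hs : ∀ a, (s a).IsAlgorithm) {r u : ℕ} (hu : u < 4 ^ r) :
    (delay 1 (F s (⟨2 ^ r⟩, ⟨u⟩))).expectedTime ≤ (1200000 * ((r + 1) ^ 3 * 2 ^ r) : ℕ) +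
      ((if 4 * u ∈ undecided l k (r + 1) then (s (⟨2 ^ (r + 1)⟩, ⟨4 * u⟩)).expectedTime else 0) +
      (if 4 * u + 1 ∈ undecided l k (r + 1) then
        (s (⟨2 ^ (r + 1)⟩, ⟨4 * u + 1⟩)).expectedTime else 0) +
      (if 4 * u + 2 ∈ undecided l k (r + 1) then
        (s (⟨2 ^ (r + 1)⟩, ⟨4 * u + 2⟩)).expectedTime else 0) +
      (if 4 * u + 3 ∈ undecided l k (r + 1) then
        (s (⟨2 ^ (r + 1)⟩, ⟨4 * u + 3⟩)).expectedTime else 0)) * (2⁻¹ * 2⁻¹) := by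
  -- The largest product is N² D⁴ (2N + 2)² with D = N⁴, of order N²⁰; `w` makes room for `l`.
  set X := 2 ^ (20 * r + w + 24) with hX
  have hNX : 2 ^ r ≤ X := Nat.pow_le_pow_right (by norm_num) (by omega)
  have hlX : 2 * l ≤ X := by
    calc 2 * l ≤ 2 * 2 ^ w := by omega
      _ = 2 ^ (w + 1) := by ring
      _ ≤ X := Nat.pow_le_pow_right (by norm_num) (by omega)
  have hD : 2 * 2 ^ r * (2 * 2 ^ r) * (2 * 2 ^ r * (2 * 2 ^ r)) = 2 ^ (4 * r + 4) := by ring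
  have hXX : 2 * 2 ^ r * (2 * 2 ^ r) * ((2 * 2 ^ r * (2 * 2 ^ r) * (2 * 2 ^ r * (2 * 2 ^ r))) ^ 4 *
      (2 * (2 * 2 ^ r) + 2) ^ 2) ≤ X := by
    have h1 := Nat.one_le_two_pow (n := r)
    calc _ ≤ 2 * 2 ^ r * (2 * 2 ^ r) * ((2 * 2 ^ r * (2 * 2 ^ r) * (2 * 2 ^ r * (2 * 2 ^ r))) ^ 4 *
          (8 * 2 ^ r) ^ 2) := by gcongr; omega
      _ = 2 ^ (20 * r + 24) := by ring
      _ ≤ X := Nat.pow_le_pow_right (by norm_num) (by omega)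
  have h44 : (2 : ℕ) ^ r * 2 ^ r = 4 ^ r := by rw [← mul_pow]; rfl
  have hd := fun b₁ b₂ => acceptBits_delays s (w := w) (Nat.one_le_two_pow (n := r)) hk hkl hlX
    (by rw [h44]; exact hu) hXX b₁ b₂
  set c := 20 * (2 * 2 ^ r + 9) *
    (Nat.size (2 * 2 ^ r * (2 * 2 ^ r) * (2 * 2 ^ r * (2 * 2 ^ r))) + 2) * words w X ^ 2 with hc
  have hadm := fun b₁ b₂ => (acceptBits_admissible (⟨l⟩ : BigNat w) ⟨k⟩ ⟨2 * 2 ^ r⟩ ⟨u⟩ b₁ b₂).alg s hs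
  have halg := isAlgorithm_acceptNext hs l k (2 * 2 ^ r)
  have hb : ∀ (b₁ b₂ : Bool) (v : ℕ), v = 2 * (2 * u + b₁.toNat) + b₂.toNat →
      (acceptBits s ⟨l⟩ ⟨k⟩ ⟨2 * 2 ^ r⟩ ⟨u⟩ b₁ b₂).expectedTime ≤ c +
        if v ∈ undecided l k (r + 1) then (s (⟨2 ^ (r + 1)⟩, ⟨v⟩)).expectedTime else 0 := by
    rintro b₁ b₂ v rfl
    have h1 := Bool.toNat_le b₁
    have h2 := Bool.toNat_le b₂
    refine ((hd b₁ b₂).expectedTime_le (halg _)).trans ?_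
    gcongr
    rw [← pow_succ']
    refine expectedTime_acceptNext_le s l k ?_
    rw [pow_succ']
    omega
  have h4 : 4 ^ (r + 1) = 4 * 4 ^ r := pow_succ' 4 r
  have h11 := hb true true (4 * u + 3) (by simp; ring)
  have h10 := hb true false (4 * u + 2) (by simp; ring)
  have h01 := hb false true (4 * u + 1) (by simp; ring)
  have h00 := hb false false (4 * u) (by simp; ring)
  have halg2 : ∀ b₁, (flip >>= fun b₂ => acceptBits s (⟨l⟩ : BigNat w) ⟨k⟩ ⟨2 * 2 ^ r⟩ ⟨u⟩ b₁
      b₂).IsAlgorithm := fun b₁ => isAlgorithm_flip.bind fun b₂ => hadm b₁ b₂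
  have hflip : (flip >>= fun b₁ => flip >>= fun b₂ =>
      acceptBits s (⟨l⟩ : BigNat w) ⟨k⟩ ⟨2 * 2 ^ r⟩ ⟨u⟩ b₁ b₂).expectedTime ≤ _ :=
    (expectedTime_flip_bind_le halg2).trans (add_le_add le_rfl (mul_le_mul_right
      (add_le_add ((expectedTime_flip_bind_le (hadm true)).trans (add_le_add le_rfl
        (mul_le_mul_right (add_le_add h11 h10) _)))
        ((expectedTime_flip_bind_le (hadm false)).trans (add_le_add le_rfl
        (mul_le_mul_right (add_le_add h01 h00) _)))) _))
  rw [average_four] at hflip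
  have hadd := ((returns_add (a := (⟨2 ^ r⟩ : BigNat w)) (b := ⟨2 ^ r⟩) hNX hNX).delays
    (fun N => flip >>= fun b₁ => flip >>= fun b₂ => acceptBits s (⟨l⟩ : BigNat w) ⟨k⟩ N ⟨u⟩ b₁ b₂))
  have h2 : 2 ^ r + 2 ^ r = 2 * 2 ^ r := (two_mul _).symm
  simp only [h2] at hadd
  have hfin := ((expectedTime_delay_le (f := F s (⟨2 ^ r⟩, ⟨u⟩)) (by
    rw [hF']
    exact (isAlgorithm_op _ _ _).bind fun N => isAlgorithm_flip.bind fun b₁ =>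
      isAlgorithm_flip.bind fun b₂ => (acceptBits_admissible _ _ _ _ _ _).alg s hs) 1).trans
    (add_le_add le_rfl ((congrArg expectedTime (hF' s _ _)).le.trans
      ((hadd.expectedTime_le (isAlgorithm_flip.bind halg2)).trans (add_le_add le_rfl hflip)))))
  refine hfin.trans ?_
  have hcost : 1 + (words w X ^ 2 + (1 + 1 + c)) ≤ 1200000 * ((r + 1) ^ 3 * 2 ^ r) := by
    have hW := words_two_pow_le hw r
    rw [← hX] at hW
    have hW2 : words w X ^ 2 ≤ 729 * (r + 1) ^ 2 := by
      calc words w X ^ 2 ≤ (27 * (r + 1)) ^ 2 := Nat.pow_le_pow_left hW 2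
        _ = _ := by ring
    have h1 := Nat.one_le_two_pow (n := r)
    have hc' : c ≤ 20 * (11 * 2 ^ r) * (7 * (r + 1)) * (729 * (r + 1) ^ 2) := by
      rw [hc, hD, Nat.size_pow]
      gcongr <;> omega
    have h3 : (r + 1) ^ 2 ≤ (r + 1) ^ 3 * 2 ^ r := by
      calc (r + 1) ^ 2 ≤ (r + 1) ^ 3 := Nat.pow_le_pow_right (by omega) (by norm_num)
        _ ≤ _ := Nat.le_mul_of_pos_right _ h1
    have h4 : 1 ≤ (r + 1) ^ 2 := Nat.one_le_pow _ _ (by omega)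
    have h5 : 20 * (11 * 2 ^ r) * (7 * (r + 1)) * (729 * (r + 1) ^ 2) =
      1122660 * ((r + 1) ^ 3 * 2 ^ r) := by ring
    omega
  have hcost' : (1 + (words w X ^ 2 + (1 + 1 + c)) : ℝ≥0∞) ≤
      (1200000 * ((r + 1) ^ 3 * 2 ^ r) : ℕ) := by exact_mod_cast hcost
  refine le_trans (le_of_eq ?_) (add_le_add hcost' le_rfl)
  push_cast
  ring

/-- The acceptance test takes bounded time if the numbers fit into words. -/
theorem exists_expectedTime_accept_le : ∃ C : ℕ, ∀ w l k : ℕ, 1 ≤ w → l ≤ 2 ^ w → 1 ≤ k → k < l →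
    (accept (⟨l⟩ : BigNat w) ⟨k⟩).expectedTime ≤ C := by
  refine ⟨8 * 7202 * (125 * 1200000), fun w l k hw hl hk hkl => ?_⟩
  obtain ⟨F, h, hF, hF'⟩ := accept_eq_fix (⟨l⟩ : BigNat w) ⟨k⟩
  rw [h]
  -- The potential A xʳ with x = 7/2 is an upper bound for the total time over the undecided cells
  -- of round r. One round costs 7202 K xʳ = A xʳ / 8, and the next contributes A xʳ⁺¹ / 4 = 7 A xʳ
  -- / 8, which add up exactly.
  set K : NNReal := 125 * 1200000 with hK
  set A : NNReal := 8 * 7202 * K with hA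
  set x : NNReal := 7 / 2 with hx
  refine expectedTime_fix_induction hF (fun T => ∀ r, ∑ u ∈ undecided l k r,
    T (⟨2 ^ r⟩, ⟨u⟩) ≤ (A * x ^ r : NNReal)) (by simp) (fun s hs hT r => ?_) fun T hT => ?_
  · have hcr : ((1200000 * ((r + 1) ^ 3 * 2 ^ r) : ℕ) : NNReal) ≤ K * x ^ r := by
      have h1 : (((r + 1) ^ 3 * 4 ^ r : ℕ) : NNReal) ≤ ((125 * 7 ^ r : ℕ) : NNReal) := by
        exact_mod_cast succ_pow_three_mul_le r
      push_cast at h1 ⊢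
      rw [hx, hK, div_pow, mul_comm 125 1200000, mul_assoc 1200000]
      refine mul_le_mul_of_nonneg_left ?_ (by positivity)
      rw [← mul_div_assoc, le_div_iff₀ (by positivity), mul_assoc, ← mul_pow]
      norm_num
      exact h1
    have hcr' : ((1200000 * ((r + 1) ^ 3 * 2 ^ r) : ℕ) : ℝ≥0∞) ≤ (K * x ^ r : NNReal) := by
      exact_mod_cast hcr
    have hT' := hT (r + 1)
    set t : ℕ → ℝ≥0∞ := fun v => if v ∈ undecided l k (r + 1) then
      (s (⟨2 ^ (r + 1)⟩, ⟨v⟩)).expectedTime else 0 with ht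
    calc ∑ u ∈ undecided l k r, (delay 1 (F s (⟨2 ^ r⟩, ⟨u⟩))).expectedTime
        ≤ ∑ u ∈ undecided l k r, ((K * x ^ r : NNReal) +
          (t (4 * u) + t (4 * u + 1) + t (4 * u + 2) + t (4 * u + 3)) * (2⁻¹ * 2⁻¹)) :=
          Finset.sum_le_sum fun u hu => (expectedTime_accept_step hF' hw hl hk hkl hs
            (Finset.mem_range.1 (undecided_subset l k r hu))).trans (add_le_add hcr' le_rfl)
      _ ≤ 7202 * (K * x ^ r : NNReal) + (∑ u ∈ Finset.range (4 ^ r),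
          (t (4 * u) + t (4 * u + 1) + t (4 * u + 2) + t (4 * u + 3))) * (2⁻¹ * 2⁻¹) := by
          rw [Finset.sum_add_distrib, Finset.sum_const, nsmul_eq_mul, ← Finset.sum_mul]
          have h1 : ((undecided l k r).card : ℝ≥0∞) ≤ 7202 := by
            exact_mod_cast card_undecided_le hk hkl r
          have h2 := Finset.sum_le_sum_of_subset (f := fun u =>
            t (4 * u) + t (4 * u + 1) + t (4 * u + 2) + t (4 * u + 3)) (undecided_subset l k r)
          gcongr
      _ = 7202 * (K * x ^ r : NNReal) + (∑ u ∈ undecided l k (r + 1),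
          (s (⟨2 ^ (r + 1)⟩, ⟨u⟩)).expectedTime) * (2⁻¹ * 2⁻¹) := by
          rw [← sum_range_four_mul, ← pow_succ', ht, ← Finset.sum_filter]
          congr 3
          ext v
          rw [Finset.mem_filter]
          exact and_iff_right_of_imp fun h => undecided_subset l k (r + 1) h
      _ ≤ 7202 * (K * x ^ r : NNReal) + (A * x ^ (r + 1) : NNReal) * (2⁻¹ * 2⁻¹) := by
          gcongr
      _ = ((7202 * (K * x ^ r) + A * x ^ (r + 1) * (2⁻¹ * 2⁻¹) : NNReal) : ℝ≥0∞) := by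
          push_cast
          simp
      _ = _ := by
          congr 1
          rw [pow_succ, hA, hx]
          ext
          push_cast
          ring
  · have := hT 0
    simp only [undecided, if_true, Finset.sum_singleton, pow_zero, mul_one] at this
    refine this.trans (le_of_eq ?_)
    rw [hA, hK]
    norm_num

end

/-! ## The size of the left subtree -/

section

variable {w : ℕ}

/-- What a round of the Monte-Carlo procedure does with the uniform random number. -/
noncomputable def sizeRound (self : Unit → RComp (BigNat w)) (l x : BigNat w) : RComp (BigNat w) :=
  add x ⟨1⟩ >>= fun X => accept l X >>= fun c => if c = true then
    add X X >>= fun Y => sub Y ⟨1⟩ else self ()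

theorem sizeRound_admissible (l x : BigNat w) : Admissible fun self => sizeRound self l x :=
  (admissible_const (isAlgorithm_op _ _ _)).bind fun _ =>
    (admissible_const (isAlgorithm_accept _ _)).bind fun _ =>
      Admissible.ite _ (admissible_const ((isAlgorithm_op _ _ _).bind fun _ => isAlgorithm_op _ _ _))
        (admissible_self _)

/-- The loop of the Monte-Carlo procedure. -/
noncomputable def sizeLoop (l m : BigNat w) : RComp (BigNat w) :=
  fix (fun self (_ : Unit) => uniformBelow m >>= fun x => sizeRound self l x) ()

theorem sizeLoop_admissible (l m : BigNat w) (a : Unit) : Admissible fun self =>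
    (fun (self : Unit → RComp (BigNat w)) (_ : Unit) =>
      uniformBelow m >>= fun x => sizeRound self l x) self a :=
  (admissible_const (isAlgorithm_uniformBelow m)).bind fun x => sizeRound_admissible l x

theorem leftSize_eq (n : BigNat w) : leftSize n = add n ⟨1⟩ >>= fun n' => div n' ⟨2⟩ >>= fun l =>
    sub l ⟨1⟩ >>= fun m => sizeLoop l m := rfl

theorem isAlgorithm_sizeLoop (l m : BigNat w) : (sizeLoop l m).IsAlgorithm :=
  isAlgorithm_fix (sizeLoop_admissible l m) ()

theorem isAlgorithm_leftSize (n : BigNat w) : (leftSize n).IsAlgorithm := by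
  rw [leftSize_eq]
  exact (isAlgorithm_op _ _ _).bind fun _ => (isAlgorithm_op _ _ _).bind fun _ =>
    (isAlgorithm_op _ _ _).bind fun _ => isAlgorithm_sizeLoop _ _

theorem leftSize_delays {l : ℕ} (hl : 1 ≤ l) :
    Delays (leftSize (⟨2 * l - 1⟩ : BigNat w)) (sizeLoop ⟨l⟩ ⟨l - 1⟩) (3 * words w (2 * l) ^ 2) := by
  rw [leftSize_eq]
  refine Delays.mono (c := words w (2 * l) ^ 2 + (words w (2 * l) ^ 2 + words w (2 * l) ^ 2)) ?_
    (by omega)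
  refine ((returns_add (a := ⟨2 * l - 1⟩) (b := ⟨1⟩) (X := 2 * l) ?_ ?_).delays _).trans ?_
  · show 2 * l - 1 ≤ 2 * l
    omega
  · show 1 ≤ 2 * l
    omega
  have h1 : 2 * l - 1 + 1 = 2 * l := by omega
  simp only [h1]
  refine ((returns_div (a := ⟨2 * l⟩) (b := ⟨2⟩) (X := 2 * l) le_rfl ?_).delays _).trans ?_
  · show 2 ≤ 2 * l
    omega
  have h2 : 2 * l / 2 = l := by omega
  simp only [h2]
  refine (returns_sub (a := ⟨l⟩) (b := ⟨1⟩) (X := 2 * l) ?_ ?_).delays _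
  · show l ≤ 2 * l
    omega
  · show 1 ≤ 2 * l
    omega

/-- The equivalence of stored numbers with numbers. -/
def bigNatEquiv (w : ℕ) : ℕ ≃ BigNat w := ⟨BigNat.mk, BigNat.val, fun _ => rfl, fun _ => rfl⟩

theorem tsum_bigNat (f : BigNat w → ℝ≥0∞) : ∑' x, f x = ∑' j : ℕ, f ⟨j⟩ :=
  ((bigNatEquiv w).tsum_eq f).symm

theorem tsum_prob_uniformBelow {m : ℕ} (hm : 1 ≤ m) (g : BigNat w → ℝ≥0∞) :
    ∑' x, (uniformBelow (⟨m⟩ : BigNat w)).prob x * g x =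
      ∑ j ∈ Finset.range m, ENNReal.ofReal (1 / m) * g ⟨j⟩ := by
  rw [tsum_bigNat, tsum_eq_sum (s := Finset.range m)]
  · refine Finset.sum_congr rfl fun j hj => ?_
    rw [prob_uniformBelow (m := ⟨m⟩) hm, if_pos (Finset.mem_range.1 hj)]
  · intro j hj
    rw [prob_uniformBelow (m := ⟨m⟩) hm, if_neg (fun h => hj (Finset.mem_range.2 h)), zero_mul]

theorem sizeRound_delays (self : Unit → RComp (BigNat w)) {l j : ℕ} (hj : j + 1 < l) :
    Delays (sizeRound self ⟨l⟩ ⟨j⟩) (accept (⟨l⟩ : BigNat w) ⟨j + 1⟩ >>= fun c => if c = true then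
      add ⟨j + 1⟩ ⟨j + 1⟩ >>= fun Y => sub Y ⟨1⟩ else self ()) (words w (2 * l) ^ 2) :=
  (returns_add (a := ⟨j⟩) (b := ⟨1⟩) (X := 2 * l) (by show j ≤ 2 * l; omega)
    (by show 1 ≤ 2 * l; omega)).delays _

theorem returns_double_sub_one {l j : ℕ} (hj : j + 1 < l) :
    Returns (add (⟨j + 1⟩ : BigNat w) ⟨j + 1⟩ >>= fun Y => sub Y ⟨1⟩) ⟨2 * (j + 1) - 1⟩
      (words w (2 * l) ^ 2 + words w (2 * l) ^ 2) := by
  have h : j + 1 + (j + 1) = 2 * (j + 1) := by ring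
  rw [← h]
  exact (returns_add (a := ⟨j + 1⟩) (b := ⟨j + 1⟩) (X := 2 * l) (by show j + 1 ≤ 2 * l; omega)
    (by show j + 1 ≤ 2 * l; omega)).bind (returns_sub (a := ⟨j + 1 + (j + 1)⟩) (b := ⟨1⟩)
    (X := 2 * l) (by show j + 1 + (j + 1) ≤ 2 * l; omega) (by show 1 ≤ 2 * l; omega))

theorem prob_of_returns [DecidableEq α] {f : RComp α} {v : α} {c : ℕ} (h : Returns f v c) (a : α) :
    f.prob a = if v = a then 1 else 0 := by
  obtain ⟨d, -, rfl⟩ := h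
  rw [prob_delay, prob_pure]

theorem expectedTime_of_returns_le {f : RComp α} {v : α} {c : ℕ} (h : Returns f v c) :
    f.expectedTime ≤ c := by
  obtain ⟨d, hd, rfl⟩ := h
  refine (expectedTime_delay_le (isAlgorithm_pure v) d).trans ?_
  rw [expectedTime_pure, add_zero]
  exact_mod_cast hd

theorem prob_sizeRound (self : Unit → RComp (BigNat w)) {l j : ℕ} (hj : j + 1 < l) (b : ℕ) :
    (sizeRound self ⟨l⟩ ⟨j⟩).prob ⟨b⟩ =
      ENNReal.ofReal (weightRatio l (j + 1)) * (if 2 * (j + 1) - 1 = b then 1 else 0) +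
      ENNReal.ofReal (1 - weightRatio l (j + 1)) * (self ()).prob ⟨b⟩ := by
  classical
  rw [(sizeRound_delays self hj).prob_eq, prob_bind (isAlgorithm_accept _ _), tsum_bool,
    prob_accept (by omega) hj, prob_accept (by omega) hj]
  simp only [coinProb, Bool.false_eq_true, if_false, if_true]
  rw [prob_of_returns (returns_double_sub_one hj), add_comm]
  simp only [BigNat.mk.injEq]

theorem weight_eq_mul_weightRatio {l k : ℕ} (hk : 1 ≤ k) (hkl : k < l) :
    weight l k = 4 ^ l * (oddZeta 1 * oddZeta (l - 1)) * weightRatio l k := by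
  have h1 := one_le_oddZeta (le_refl 1)
  have h2 := one_le_oddZeta (by omega : 1 ≤ l - 1)
  rw [weight_eq hk hkl, weightRatio]
  field_simp

/-- The probability that the left subtree of a random tree of size `2l - 1` has size `2k - 1`. -/
noncomputable def sizeProb (l k : ℕ) : ℝ := weight l k / ∑ j ∈ Finset.Icc 1 (l - 1), weight l j

theorem sizeProb_eq {l k : ℕ} (hk : 1 ≤ k) (hkl : k < l) :
    sizeProb l k = weightRatio l k / ∑ j ∈ Finset.Icc 1 (l - 1), weightRatio l j := by
  have h1 := one_le_oddZeta (le_refl 1)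
  have h2 := one_le_oddZeta (by omega : 1 ≤ l - 1)
  rw [sizeProb, weight_eq_mul_weightRatio hk hkl]
  have : ∑ j ∈ Finset.Icc 1 (l - 1), weight l j = 4 ^ l * (oddZeta 1 * oddZeta (l - 1)) *
      ∑ j ∈ Finset.Icc 1 (l - 1), weightRatio l j := by
    rw [Finset.mul_sum]
    refine Finset.sum_congr rfl fun j hj => ?_
    rw [Finset.mem_Icc] at hj
    exact weight_eq_mul_weightRatio hj.1 (by omega)
  rw [this, mul_div_mul_left _ _ (by positivity)]

theorem sum_weightRatio_bounds {l : ℕ} (hl : 2 ≤ l) :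
    16 / 25 * ((l : ℝ) - 1) ≤ ∑ j ∈ Finset.Icc 1 (l - 1), weightRatio l j ∧
      ∑ j ∈ Finset.Icc 1 (l - 1), weightRatio l j ≤ (l : ℝ) - 1 := by
  have hc : ((Finset.Icc 1 (l - 1)).card : ℝ) = l - 1 := by
    rw [Nat.card_Icc, Nat.add_sub_cancel, Nat.cast_sub (by omega), Nat.cast_one]
  constructor
  · have := Finset.card_nsmul_le_sum (Finset.Icc 1 (l - 1)) (weightRatio l) (16 / 25) fun j hj => by
      rw [Finset.mem_Icc] at hj
      exact (weightRatio_bounds hj.1 (by omega)).1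
    rwa [nsmul_eq_mul, hc, mul_comm] at this
  · have := Finset.sum_le_card_nsmul (Finset.Icc 1 (l - 1)) (weightRatio l) 1 fun j hj => by
      rw [Finset.mem_Icc] at hj
      exact (weightRatio_bounds hj.1 (by omega)).2
    rwa [nsmul_eq_mul, hc, mul_one] at this

theorem sum_weightRatio_pos {l : ℕ} (hl : 2 ≤ l) :
    0 < ∑ j ∈ Finset.Icc 1 (l - 1), weightRatio l j := by
  have h1 := (sum_weightRatio_bounds hl).1
  have h2 : (2 : ℝ) ≤ l := by exact_mod_cast hl
  linarith

/-- The denominator is at most l - 1 and the numerator at least 16/25. This anti-concentration is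
what the analysis of the recursion uses. -/
theorem le_sizeProb {l k : ℕ} (hk : 1 ≤ k) (hkl : k < l) :
    16 / 25 / ((l : ℝ) - 1) ≤ sizeProb l k := by
  rw [sizeProb_eq hk hkl]
  have := sum_weightRatio_pos (l := l) (by omega)
  have := (weightRatio_bounds hk hkl).1
  have := (sum_weightRatio_bounds (l := l) (by omega)).2
  gcongr

theorem sizeProb_nonneg {l k : ℕ} (hk : 1 ≤ k) (hkl : k < l) : 0 ≤ sizeProb l k := by
  rw [sizeProb_eq hk hkl]
  exact div_nonneg (by linarith [(weightRatio_bounds hk hkl).1])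
    (sum_weightRatio_pos (by omega)).le

theorem sum_sizeProb {l : ℕ} (hl : 2 ≤ l) : ∑ k ∈ Finset.Icc 1 (l - 1), sizeProb l k = 1 := by
  have : ∀ k ∈ Finset.Icc 1 (l - 1), sizeProb l k =
      weightRatio l k / ∑ j ∈ Finset.Icc 1 (l - 1), weightRatio l j := fun k hk => by
    rw [Finset.mem_Icc] at hk
    exact sizeProb_eq hk.1 (by omega)
  rw [Finset.sum_congr rfl this, ← Finset.sum_div, div_self (sum_weightRatio_pos hl).ne']

/-- The loop gives a linear equation for the probability: the accepted part plus the rejected part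
times the unknown. Since some acceptance probability is positive, it has the normalized weights as
its only solution. -/
theorem prob_sizeLoop {l : ℕ} (hl : 2 ≤ l) (b : ℕ) :
    (sizeLoop (⟨l⟩ : BigNat w) ⟨l - 1⟩).prob ⟨b⟩ =
      ∑ k ∈ Finset.Icc 1 (l - 1), ENNReal.ofReal (sizeProb l k) * if 2 * k - 1 = b then 1 else 0 := by
  have hadm := sizeLoop_admissible (⟨l⟩ : BigNat w) ⟨l - 1⟩
  have hm : (0 : ℝ) < ((l - 1 : ℕ) : ℝ) := by exact_mod_cast (by omega : 0 < l - 1)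
  set q := (sizeLoop (⟨l⟩ : BigNat w) ⟨l - 1⟩).prob ⟨b⟩ with hq
  have hqt : q ≠ ⊤ := (isAlgorithm_sizeLoop _ _).prob_ne_top _
  have hθ : ∀ k ∈ Finset.Icc 1 (l - 1), 0 ≤ weightRatio l k ∧ 0 ≤ 1 - weightRatio l k := by
    intro k hk
    rw [Finset.mem_Icc] at hk
    have := weightRatio_bounds hk.1 (show k < l by omega)
    constructor <;> linarith [this.1, this.2]
  have hrange : ∀ f : ℕ → ℝ≥0∞, ∑ j ∈ Finset.range (l - 1), f (j + 1) =
      ∑ k ∈ Finset.Icc 1 (l - 1), f k := fun f => by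
    rw [Finset.range_eq_Ico, Finset.sum_Ico_add' f 0 (l - 1) 1]
    rfl
  have key : q = ∑ k ∈ Finset.Icc 1 (l - 1), ENNReal.ofReal (1 / (l - 1 : ℕ)) *
      (ENNReal.ofReal (weightRatio l k) * (if 2 * k - 1 = b then 1 else 0) +
        ENNReal.ofReal (1 - weightRatio l k) * q) := by
    conv_lhs => rw [hq, sizeLoop, fix_eq hadm, prob_delay, prob_bind (isAlgorithm_uniformBelow _),
      tsum_prob_uniformBelow (by omega)]
    rw [← hrange]
    refine Finset.sum_congr rfl fun j hj => ?_
    rw [Finset.mem_range] at hj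
    rw [prob_sizeRound _ (by omega)]
    rfl
  have keyR : q.toReal = ∑ k ∈ Finset.Icc 1 (l - 1), 1 / (l - 1 : ℕ) *
      (weightRatio l k * (if 2 * k - 1 = b then 1 else 0) + (1 - weightRatio l k) * q.toReal) := by
    conv_lhs => rw [key]
    have hfin : ∀ k, ENNReal.ofReal (weightRatio l k) * (if 2 * k - 1 = b then 1 else 0) ≠ ⊤ :=
      fun k => ENNReal.mul_ne_top ENNReal.ofReal_ne_top (by split_ifs <;> simp)
    have hfin' : ∀ k, ENNReal.ofReal (1 - weightRatio l k) * q ≠ ⊤ :=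
      fun k => ENNReal.mul_ne_top ENNReal.ofReal_ne_top hqt
    rw [ENNReal.toReal_sum fun k _ => ENNReal.mul_ne_top ENNReal.ofReal_ne_top
      (ENNReal.add_ne_top.2 ⟨hfin k, hfin' k⟩)]
    refine Finset.sum_congr rfl fun k hk => ?_
    rw [ENNReal.toReal_mul, ENNReal.toReal_add (hfin k) (hfin' k), ENNReal.toReal_mul,
      ENNReal.toReal_mul, ENNReal.toReal_ofReal (by positivity), ENNReal.toReal_ofReal (hθ k hk).1,
      ENNReal.toReal_ofReal (hθ k hk).2]
    congr 3
    split_ifs <;> simp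
  have hsum : q.toReal * ∑ k ∈ Finset.Icc 1 (l - 1), weightRatio l k =
      ∑ k ∈ Finset.Icc 1 (l - 1), weightRatio l k * if 2 * k - 1 = b then 1 else 0 := by
    rw [← Finset.mul_sum, Finset.sum_add_distrib, ← Finset.sum_mul, Finset.sum_sub_distrib,
      Finset.sum_const, Nat.card_Icc, Nat.add_sub_cancel, nsmul_eq_mul, mul_one, one_div,
      eq_inv_mul_iff_mul_eq₀ hm.ne'] at keyR
    linarith
  rw [← ENNReal.ofReal_toReal hqt, eq_div_of_mul_eq (sum_weightRatio_pos hl).ne' hsum,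
    Finset.sum_div, ENNReal.ofReal_sum_of_nonneg]
  · refine Finset.sum_congr rfl fun k hk => ?_
    have hk' := Finset.mem_Icc.1 hk
    rw [sizeProb_eq hk'.1 (by omega)]
    split_ifs <;> simp
  · intro k hk
    refine div_nonneg (mul_nonneg (hθ k hk).1 ?_) (sum_weightRatio_pos hl).le
    split_ifs <;> norm_num

theorem prob_leftSize {l : ℕ} (hl : 2 ≤ l) (b : ℕ) :
    (leftSize (⟨2 * l - 1⟩ : BigNat w)).prob ⟨b⟩ =
      ∑ k ∈ Finset.Icc 1 (l - 1), ENNReal.ofReal (sizeProb l k) * if 2 * k - 1 = b then 1 else 0 := by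
  rw [(leftSize_delays (by omega)).prob_eq, prob_sizeLoop hl]

theorem prob_leftSize_of_mem {l k : ℕ} (hk : k ∈ Finset.Icc 1 (l - 1)) :
    (leftSize (⟨2 * l - 1⟩ : BigNat w)).prob ⟨2 * k - 1⟩ = ENNReal.ofReal (sizeProb l k) := by
  have hk' := Finset.mem_Icc.1 hk
  rw [prob_leftSize (by omega), Finset.sum_eq_single_of_mem k hk]
  · simp
  · intro j hj hjk
    rw [Finset.mem_Icc] at hj
    rw [if_neg (by omega), mul_zero]

theorem tsum_prob_leftSize {l : ℕ} (hl : 2 ≤ l) (g : BigNat w → ℝ≥0∞) :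
    ∑' x, (leftSize (⟨2 * l - 1⟩ : BigNat w)).prob x * g x =
      ∑ k ∈ Finset.Icc 1 (l - 1), ENNReal.ofReal (sizeProb l k) * g ⟨2 * k - 1⟩ := by
  rw [tsum_bigNat]
  simp only [prob_leftSize hl, Finset.sum_mul]
  rw [Summable.tsum_finsetSum fun _ _ => ENNReal.summable]
  refine Finset.sum_congr rfl fun k _ => ?_
  rw [tsum_eq_single (2 * k - 1)]
  · simp
  · intro b hb
    rw [if_neg hb.symm, mul_zero, zero_mul]

/-- Numbers up to 4 · 2ʷ take at most 5 words, hence the constant 25 for the cost of an operation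
below. -/
theorem words_four_mul_le (hw : 1 ≤ w) {l : ℕ} (hl : l ≤ 2 ^ w) : words w (4 * l) ≤ 5 := by
  have h1 : 4 * l ≤ 2 ^ (w + 2) := by
    calc 4 * l ≤ 4 * 2 ^ w := by omega
      _ = _ := by ring
  have h2 : Nat.size (4 * l) ≤ w + 3 := (Nat.size_le_size h1).trans (Nat.size_pow).le
  have h3 : Nat.size (4 * l) / w ≤ 4 := Nat.div_le_of_le_mul (by omega)
  rw [words]
  omega

theorem words_mono {x y : ℕ} (h : x ≤ y) : words w x ≤ words w y :=
  Nat.add_le_add_left (Nat.div_le_div_right (Nat.size_le_size h)) _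

/-- The expected time of the Monte-Carlo procedure is proportional to the word length. -/
theorem exists_expectedTime_leftSize_le : ∃ C : ℕ, ∀ w l : ℕ, 1 ≤ w → l ≤ 2 ^ w → 2 ≤ l →
    (leftSize (⟨2 * l - 1⟩ : BigNat w)).expectedTime ≤ (C * (w + 1) : ℕ) := by
  obtain ⟨A, hA⟩ := exists_expectedTime_accept_le
  refine ⟨75 + 2 * (1 + 204 + 75 + A), fun w l hw hlw hl => ?_⟩
  -- The cost of one round apart from a restart. As a restart has probability at most 9/25, the
  -- bound 2B for the loop reproduces itself: B + 18/25 B ≤ 2B.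
  set B := 1 + 102 * (2 * w + 2) + 75 + A with hB
  have hW2 : words w (2 * l) ^ 2 ≤ 25 :=
    Nat.pow_le_pow_left ((words_mono (by omega)).trans (words_four_mul_le hw hlw)) 2
  have hW4 : words w (4 * (l - 1)) ^ 2 ≤ 25 :=
    Nat.pow_le_pow_left ((words_mono (by omega)).trans (words_four_mul_le hw hlw)) 2
  have hloop : (sizeLoop (⟨l⟩ : BigNat w) ⟨l - 1⟩).expectedTime ≤ (2 * B : ℕ) := by
    refine expectedTime_fix_le (sizeLoop_admissible _ _) (fun _ => ((2 * B : ℕ) : ℝ≥0∞))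
      (fun _ => True) (fun s hs hT a _ => ?_) trivial
    have hround : ∀ j < l - 1, (sizeRound s (⟨l⟩ : BigNat w) ⟨j⟩).expectedTime ≤
        ((75 + A : ℕ) : ℝ≥0∞) + ENNReal.ofReal (9 / 25) * (2 * B : ℕ) := by
      intro j hj
      have halg : ∀ c : Bool, (if c = true then
          add (⟨j + 1⟩ : BigNat w) ⟨j + 1⟩ >>= fun Y => sub Y ⟨1⟩ else s ()).IsAlgorithm := by
        intro c
        split_ifs
        · exact (returns_double_sub_one (l := l) (by omega)).isAlgorithm
        · exact hs _
      have h1 := (sizeRound_delays s (w := w) (by omega : j + 1 < l)).expectedTime_le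
        ((isAlgorithm_accept _ _).bind halg)
      have h2 := expectedTime_bind_le (isAlgorithm_accept (⟨l⟩ : BigNat w) ⟨j + 1⟩) halg
      have h3 := hA w l (j + 1) hw hlw (by omega) (by omega)
      have h4 := expectedTime_of_returns_le (returns_double_sub_one (w := w) (by omega : j + 1 < l))
      have h5 : (accept (⟨l⟩ : BigNat w) ⟨j + 1⟩).prob true *
          (add (⟨j + 1⟩ : BigNat w) ⟨j + 1⟩ >>= fun Y => sub Y ⟨1⟩).expectedTime ≤
          1 * (words w (2 * l) ^ 2 + words w (2 * l) ^ 2 : ℕ) :=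
        mul_le_mul' ((isAlgorithm_accept _ _).prob_le_one _) h4
      have h6 : (accept (⟨l⟩ : BigNat w) ⟨j + 1⟩).prob false * (s ()).expectedTime ≤
          ENNReal.ofReal (9 / 25) * (2 * B : ℕ) := by
        refine mul_le_mul' ?_ (hT () trivial)
        rw [prob_accept (by omega) (by omega)]
        refine ENNReal.ofReal_le_ofReal ?_
        have := (weightRatio_bounds (l := l) (k := j + 1) (by omega) (by omega)).1
        simp only [coinProb, Bool.false_eq_true, if_false]
        linarith
      rw [tsum_bool] at h2
      simp only [Bool.false_eq_true, if_false, if_true] at h2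
      have h7 : ((words w (2 * l) ^ 2 : ℕ) : ℝ≥0∞) + (A + 1 *
          (words w (2 * l) ^ 2 + words w (2 * l) ^ 2 : ℕ)) ≤ ((75 + A : ℕ) : ℝ≥0∞) := by
        rw [one_mul]
        exact_mod_cast (by omega : words w (2 * l) ^ 2 + (A + (words w (2 * l) ^ 2 +
          words w (2 * l) ^ 2)) ≤ 75 + A)
      refine (h1.trans (add_le_add le_rfl (h2.trans (add_le_add h3 (add_le_add h6 h5))))).trans ?_
      refine le_trans (le_of_eq ?_) (add_le_add h7 le_rfl)
      ring
    have hbody := expectedTime_bind_le_add (isAlgorithm_uniformBelow (⟨l - 1⟩ : BigNat w))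
      (fun x => (sizeRound_admissible (⟨l⟩ : BigNat w) x).alg s hs)
      (C := ((75 + A : ℕ) : ℝ≥0∞) + ENNReal.ofReal (9 / 25) * (2 * B : ℕ)) fun x hx => by
        obtain ⟨j⟩ := x
        rw [prob_uniformBelow (m := ⟨l - 1⟩) (by show 1 ≤ l - 1; omega)] at hx
        exact hround j (by by_contra h; exact hx (if_neg h))
    have huni := expectedTime_uniformBelow_le (m := (⟨l - 1⟩ : BigNat w)) (by show 1 ≤ l - 1; omega)
    have hclog : Nat.clog 2 (l - 1) ≤ w := Nat.clog_le_of_le_pow (by omega)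
    have huni' : (uniformBelow (⟨l - 1⟩ : BigNat w)).expectedTime ≤ (102 * (2 * w + 2) : ℕ) := by
      refine huni.trans ?_
      have : (2 + 4 * words w (4 * (l - 1)) ^ 2) * (2 * Nat.clog 2 (l - 1) + 2) ≤
        102 * (2 * w + 2) := by gcongr; omega
      exact_mod_cast this
    have hreal : ENNReal.ofReal (9 / 25) * (2 * B : ℕ) ≤ (B : ℝ≥0∞) := by
      rw [← ENNReal.ofReal_natCast (2 * B), ← ENNReal.ofReal_mul (by norm_num),
        ← ENNReal.ofReal_natCast B]
      refine ENNReal.ofReal_le_ofReal ?_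
      push_cast
      nlinarith [Nat.cast_nonneg (α := ℝ) B]
    refine (add_le_add (hbody.trans (add_le_add huni' (add_le_add le_rfl hreal))) le_rfl).trans ?_
    exact_mod_cast (by omega : 102 * (2 * w + 2) + (75 + A + B) + 1 ≤ 2 * B)
  refine ((leftSize_delays (w := w) (by omega)).expectedTime_le (isAlgorithm_sizeLoop _ _)).trans ?_
  refine (add_le_add le_rfl hloop).trans ?_
  have : 3 * words w (2 * l) ^ 2 + 2 * B ≤ (75 + 2 * (1 + 204 + 75 + A)) * (w + 1) := by
    rw [hB]
    nlinarith [Nat.zero_le (A * w)]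
  exact_mod_cast this

end

/-! ## Shuffles -/

/-- The members of the list `L` are distributed among `A` and `B`, in their order. -/
def IsSplit {α : Type} : List α → List α → List α → Prop
  | [], A, B => A = [] ∧ B = []
  | a :: L, A, B => (∃ A', A = a :: A' ∧ IsSplit L A' B) ∨ ∃ B', B = a :: B' ∧ IsSplit L A B'

namespace IsSplit

theorem perm {α : Type} {L A B : List α} (h : IsSplit L A B) : (A ++ B).Perm L := by
  induction L generalizing A B with
  | nil =>
    obtain ⟨rfl, rfl⟩ := h
    exact List.Perm.refl _
  | cons a L ih =>
    rcases h with ⟨A', rfl, h⟩ | ⟨B', rfl, h⟩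
    · exact (ih h).cons a
    · exact List.perm_middle.trans ((ih h).cons a)

theorem sublist_left {α : Type} {L A B : List α} (h : IsSplit L A B) : A.Sublist L := by
  induction L generalizing A B with
  | nil =>
    obtain ⟨rfl, rfl⟩ := h
    exact List.Sublist.refl _
  | cons a L ih =>
    rcases h with ⟨A', rfl, h⟩ | ⟨B', rfl, h⟩
    · exact (ih h).cons_cons a
    · exact (ih h).cons a

theorem sublist_right {α : Type} {L A B : List α} (h : IsSplit L A B) : B.Sublist L := by
  induction L generalizing A B with
  | nil =>
    obtain ⟨rfl, rfl⟩ := h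
    exact List.Sublist.refl _
  | cons a L ih =>
    rcases h with ⟨A', rfl, h⟩ | ⟨B', rfl, h⟩
    · exact (ih h).cons a
    · exact (ih h).cons_cons a

theorem length_add_length {α : Type} {L A B : List α} (h : IsSplit L A B) :
    A.length + B.length = L.length := by
  rw [← List.length_append, h.perm.length_eq]

end IsSplit

theorem isSplit_filter {α : Type} (p : α → Bool) (L : List α) :
    IsSplit L (L.filter p) (L.filter fun a => !p a) := by
  induction L with
  | nil => exact ⟨rfl, rfl⟩
  | cons a L ih =>
    cases h : p a
    · exact Or.inr ⟨L.filter fun a => !p a, by simp [h], by simpa [h] using ih⟩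
    · exact Or.inl ⟨L.filter p, by simp [h], by simpa [h] using ih⟩

namespace RComp

theorem prob_map_of_injective {f : RComp α} (hf : f.IsAlgorithm) {h : α → β}
    (hh : Function.Injective h) (a : α) : (f >>= fun x => pure (h x)).prob (h a) = f.prob a := by
  classical
  rw [prob_bind hf, tsum_eq_single a]
  · rw [prob_pure, if_pos rfl, mul_one]
  · intro b hb
    rw [prob_pure, if_neg fun e => hb (hh e), mul_zero]

theorem prob_map_of_notMem_range {f : RComp α} (hf : f.IsAlgorithm) {h : α → β} {b : β}
    (hb : ∀ a, h a ≠ b) : (f >>= fun x => pure (h x)).prob b = 0 := by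
  classical
  rw [prob_bind hf]
  simp [prob_pure, hb]

theorem mass_map {f : RComp α} (hf : f.IsAlgorithm) (h : α → β) :
    (f >>= fun x => pure (h x)).mass = f.mass := by
  rw [mass_bind hf, mass_eq_tsum]
  simp only [mass_pure, mul_one]

theorem expectedTime_map_le {f : RComp α} (hf : f.IsAlgorithm) (h : α → β) :
    (f >>= fun x => pure (h x)).expectedTime ≤ f.expectedTime := by
  have := expectedTime_bind_le_add hf (g := fun x => pure (h x)) (fun _ => isAlgorithm_pure _)
    (C := 0) fun a _ => (expectedTime_pure _).le
  rwa [add_zero] at this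

end RComp

section

variable {w : ℕ}

theorem shuffle_eq_fix : ∃ F, (∀ (r s : BigNat w) (L : List (BigNat w)),
      shuffle r s L = fix F (r, s, L)) ∧
    (∀ a, Admissible fun self => F self a) ∧
    (∀ self r s, F self (r, s, []) = pure ([], [])) ∧
    ∀ self r s a L, F self (r, s, a :: L) = (sub s ⟨1⟩ >>= fun s' => biasedCoin r s >>= fun c =>
      if c = true then sub r ⟨1⟩ >>= fun r' => self (r', s', L) >>= fun p => pure (a :: p.1, p.2)
      else self (r, s', L) >>= fun p => pure (p.1, a :: p.2)) := by
  refine ⟨_, fun _ _ _ => rfl, ?_, fun _ _ _ => rfl, fun _ _ _ _ _ => rfl⟩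
  rintro ⟨r, s, L⟩
  cases L with
  | nil => exact admissible_const (isAlgorithm_pure _)
  | cons a L =>
    refine (admissible_const (isAlgorithm_op _ _ _)).bind fun _ => ?_
    refine (admissible_const (isAlgorithm_biasedCoin _ _)).bind fun _ => Admissible.ite _ ?_ ?_
    · exact (admissible_const (isAlgorithm_op _ _ _)).bind fun _ =>
        (admissible_self _).bind fun _ => admissible_const (isAlgorithm_pure _)
    · exact (admissible_self _).bind fun _ => admissible_const (isAlgorithm_pure _)

theorem isAlgorithm_shuffle (r s : BigNat w) (L : List (BigNat w)) :
    (shuffle r s L).IsAlgorithm := by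
  obtain ⟨F, h, hF, -⟩ := shuffle_eq_fix (w := w)
  rw [h]
  exact isAlgorithm_fix hF _

/-- The first member of the list goes to the left or to the right. -/
noncomputable def shuffleStep (a : BigNat w) (r s : ℕ) (L : List (BigNat w)) (c : Bool) :
    RComp (List (BigNat w) × List (BigNat w)) :=
  if c = true then shuffle ⟨r - 1⟩ ⟨s⟩ L >>= fun p => pure (a :: p.1, p.2)
  else shuffle ⟨r⟩ ⟨s⟩ L >>= fun p => pure (p.1, a :: p.2)

theorem isAlgorithm_shuffleStep (a : BigNat w) (r s : ℕ) (L : List (BigNat w)) (c : Bool) :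
    (shuffleStep a r s L c).IsAlgorithm := by
  rw [shuffleStep]
  split_ifs
  · exact (isAlgorithm_shuffle _ _ _).bind fun _ => isAlgorithm_pure _
  · exact (isAlgorithm_shuffle _ _ _).bind fun _ => isAlgorithm_pure _

theorem shuffle_nil (r s : BigNat w) : Delays (shuffle r s []) (pure ([], [])) 1 := by
  obtain ⟨F, h, hF, h0, -⟩ := shuffle_eq_fix (w := w)
  rw [h, fix_eq hF, h0]
  exact Delays.delay _ _

theorem shuffle_cons {r s : ℕ} (hrs : r ≤ s + 1) (a : BigNat w) (L : List (BigNat w)) :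
    ∃ g : Bool → RComp (List (BigNat w) × List (BigNat w)), (∀ c, (g c).IsAlgorithm) ∧
      (∀ c, Delays (g c) (shuffleStep a r s L c) (words w (s + 1) ^ 2)) ∧
      Delays (shuffle ⟨r⟩ ⟨s + 1⟩ (a :: L)) (biasedCoin (⟨r⟩ : BigNat w) ⟨s + 1⟩ >>= g)
        (1 + words w (s + 1) ^ 2) := by
  obtain ⟨F, h, hF, -, h1⟩ := shuffle_eq_fix (w := w)
  refine ⟨fun c => if c = true then sub ⟨r⟩ ⟨1⟩ >>= fun r' => shuffle r' ⟨s⟩ L >>= fun p =>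
    pure (a :: p.1, p.2) else shuffle ⟨r⟩ ⟨s⟩ L >>= fun p => pure (p.1, a :: p.2), ?_, ?_, ?_⟩
  · intro c
    cases c
    · exact (isAlgorithm_shuffle _ _ _).bind fun _ => isAlgorithm_pure _
    · exact (isAlgorithm_op _ _ _).bind fun _ => (isAlgorithm_shuffle _ _ _).bind fun _ =>
        isAlgorithm_pure _
  · intro c
    cases c
    · exact (Delays.refl _).mono (Nat.zero_le _)
    · exact (returns_sub (a := ⟨r⟩) (b := ⟨1⟩) (X := s + 1) hrs (by show 1 ≤ s + 1; omega)).delays _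
  · rw [h, fix_eq hF, h1]
    refine (Delays.delay _ _).trans ?_
    simp only [h]
    exact (returns_sub (a := ⟨s + 1⟩) (b := ⟨1⟩) (X := s + 1) le_rfl
      (by show 1 ≤ s + 1; omega)).delays _

theorem prob_shuffle_cons {r s : ℕ} (hrs : r ≤ s + 1) (a : BigNat w) (L : List (BigNat w))
    (p : List (BigNat w) × List (BigNat w)) :
    (shuffle ⟨r⟩ ⟨s + 1⟩ (a :: L)).prob p =
      ENNReal.ofReal (r / (s + 1 : ℕ)) *
        (shuffle ⟨r - 1⟩ ⟨s⟩ L >>= fun p => pure (a :: p.1, p.2)).prob p +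
      ENNReal.ofReal (1 - r / (s + 1 : ℕ)) *
        (shuffle ⟨r⟩ ⟨s⟩ L >>= fun p => pure (p.1, a :: p.2)).prob p := by
  obtain ⟨g, hg, hgs, h⟩ := shuffle_cons hrs a L
  have hc := prob_biasedCoin (a := (⟨r⟩ : BigNat w)) (s := ⟨s + 1⟩) hrs (by show 1 ≤ s + 1; omega)
  rw [h.prob_eq, prob_bind (isAlgorithm_biasedCoin _ _), tsum_bool, hc, hc, (hgs _).prob_eq,
    (hgs _).prob_eq, add_comm]
  rfl

/-- If all remaining labels must go to the left, the coin has parameter 1, so the branch for which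
the induction hypothesis fails has probability 0. -/
theorem mass_shuffle {L : List (BigNat w)} {r : ℕ} (hr : r ≤ L.length) :
    (shuffle ⟨r⟩ ⟨L.length⟩ L).mass = 1 := by
  induction L generalizing r with
  | nil => rw [(shuffle_nil _ _).mass_eq, mass_pure]
  | cons a L ih =>
    rw [List.length_cons] at hr ⊢
    obtain ⟨g, hg, hgs, h⟩ := shuffle_cons hr a L
    have hc := prob_biasedCoin (a := (⟨r⟩ : BigNat w)) (s := ⟨L.length + 1⟩) hr
      (by show 1 ≤ L.length + 1; omega)
    have hr' : (r : ℝ) / (L.length + 1 : ℕ) ≤ 1 := by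
      rw [div_le_one (by positivity)]
      exact_mod_cast hr
    rw [h.mass_eq, mass_bind (isAlgorithm_biasedCoin _ _), tsum_bool, hc, hc, (hgs _).mass_eq,
      (hgs _).mass_eq]
    simp only [shuffleStep, if_true, Bool.false_eq_true, if_false, coinProb,
      mass_map (isAlgorithm_shuffle _ _ _)]
    have h1 : (shuffle (⟨r - 1⟩ : BigNat w) ⟨L.length⟩ L).mass = 1 := ih (by omega)
    have : ENNReal.ofReal (1 - r / (L.length + 1 : ℕ)) * (shuffle ⟨r⟩ ⟨L.length⟩ L).mass =
        ENNReal.ofReal (1 - r / (L.length + 1 : ℕ)) := by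
      by_cases hrl : r ≤ L.length
      · rw [ih hrl, mul_one]
      · obtain rfl : r = L.length + 1 := by omega
        rw [div_self (by positivity)]
        simp
    rw [this, h1, mul_one, ← ENNReal.ofReal_add (by linarith) (by positivity)]
    simp

theorem isSplit_of_prob_shuffle_ne_zero {L A B : List (BigNat w)} {r : ℕ} (hr : r ≤ L.length)
    (h : (shuffle ⟨r⟩ ⟨L.length⟩ L).prob (A, B) ≠ 0) : IsSplit L A B ∧ A.length = r := by
  classical
  induction L generalizing r A B with
  | nil =>
    rw [(shuffle_nil _ _).prob_eq, prob_pure] at h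
    have h := (ite_ne_right_iff.1 h).1
    simp only [Prod.mk.injEq] at h
    obtain ⟨rfl, rfl⟩ := h
    simp only [List.length_nil, Nat.le_zero] at hr
    exact ⟨⟨rfl, rfl⟩, hr.symm⟩
  | cons a L ih =>
    rw [List.length_cons] at hr h
    rw [prob_shuffle_cons hr] at h
    by_cases h1 : ENNReal.ofReal (r / (L.length + 1 : ℕ)) *
        (shuffle ⟨r - 1⟩ ⟨L.length⟩ L >>= fun p => pure (a :: p.1, p.2)).prob (A, B) = 0
    · rw [h1, zero_add] at h
      have hrl : r ≤ L.length := by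
        by_contra hrl
        obtain rfl : r = L.length + 1 := by omega
        rw [div_self (by positivity)] at h
        simp at h
      rw [prob_bind (isAlgorithm_shuffle _ _ _)] at h
      obtain ⟨p, hp⟩ : ∃ p, (shuffle ⟨r⟩ ⟨L.length⟩ L).prob p *
          (pure (p.1, a :: p.2) : RComp _).prob (A, B) ≠ 0 := by
        by_contra hall
        push Not at hall
        simp [hall] at h
      rw [prob_pure] at hp
      obtain ⟨hp1, hp2⟩ := mul_ne_zero_iff.1 hp
      have hp2 := (ite_ne_right_iff.1 hp2).1
      simp only [Prod.mk.injEq] at hp2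
      obtain ⟨rfl, rfl⟩ := hp2
      obtain ⟨i1, i2⟩ := ih hrl hp1
      exact ⟨Or.inr ⟨p.2, rfl, i1⟩, i2⟩
    · have hr0 : 1 ≤ r := by
        by_contra hr0
        obtain rfl : r = 0 := by omega
        simp at h1
      rw [prob_bind (isAlgorithm_shuffle _ _ _)] at h1
      obtain ⟨p, hp⟩ : ∃ p, (shuffle ⟨r - 1⟩ ⟨L.length⟩ L).prob p *
          (pure (a :: p.1, p.2) : RComp _).prob (A, B) ≠ 0 := by
        by_contra hall
        push Not at hall
        simp [hall] at h1
      rw [prob_pure] at hp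
      obtain ⟨hp1, hp2⟩ := mul_ne_zero_iff.1 hp
      have hp2 := (ite_ne_right_iff.1 hp2).1
      simp only [Prod.mk.injEq] at hp2
      obtain ⟨rfl, rfl⟩ := hp2
      obtain ⟨i1, i2⟩ := ih (by omega) hp1
      refine ⟨Or.inl ⟨p.1, rfl, i1⟩, ?_⟩
      rw [List.length_cons, i2]
      omega

theorem ofReal_div_mul_inv {a b c d : ℕ} (hb : 0 < b) (hc : 0 < c) (hd : 0 < d)
    (h : a * d = b * c) : ENNReal.ofReal (a / b) * (c : ℝ≥0∞)⁻¹ = (d : ℝ≥0∞)⁻¹ := by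
  have hb' : (0 : ℝ) < b := by exact_mod_cast hb
  have hc' : (0 : ℝ) < c := by exact_mod_cast hc
  have hd' : (0 : ℝ) < d := by exact_mod_cast hd
  have h' : (a : ℝ) * d = b * c := by exact_mod_cast h
  rw [← ENNReal.ofReal_natCast c, ← ENNReal.ofReal_natCast d, ← ENNReal.ofReal_inv_of_pos hc',
    ← ENNReal.ofReal_inv_of_pos hd', ← ENNReal.ofReal_mul (by positivity)]
  congr 1
  field_simp
  linarith

/-- Without repetitions the side of the first label is determined by the split, so only one branch
of the coin contributes. The remaining factors are the two absorption identities for binomial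
coefficients. -/
theorem prob_shuffle {L A B : List (BigNat w)} (hL : L.Nodup) (h : IsSplit L A B) :
    (shuffle ⟨A.length⟩ ⟨L.length⟩ L).prob (A, B) = (L.length.choose A.length : ℝ≥0∞)⁻¹ := by
  classical
  induction L generalizing A B with
  | nil =>
    obtain ⟨rfl, rfl⟩ := h
    rw [(shuffle_nil _ _).prob_eq, prob_pure]
    simp
  | cons a L ih =>
    obtain ⟨ha, hL⟩ := List.nodup_cons.1 hL
    have hlen := h.length_add_length
    rw [List.length_cons] at hlen ⊢
    rw [prob_shuffle_cons (by omega)]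
    rcases h with ⟨A', rfl, h⟩ | ⟨B', rfl, h⟩
    · have h2 : ∀ p : List (BigNat w) × List (BigNat w), (shuffle ⟨(a :: A').length⟩ ⟨L.length⟩ L).prob p *
          (pure (p.1, a :: p.2) : RComp _).prob (a :: A', B) = 0 := by
        intro p
        by_contra hp
        rw [prob_pure] at hp
        obtain ⟨hp1, hp2⟩ := mul_ne_zero_iff.1 hp
        have hp2 := (ite_ne_right_iff.1 hp2).1
        simp only [Prod.mk.injEq] at hp2
        have hB : B.length ≠ 0 := by rw [← hp2.2]; simp
        have := (isSplit_of_prob_shuffle_ne_zero (by omega) hp1).1.sublist_left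
        rw [hp2.1] at this
        exact ha (this.subset (by simp))
      rw [prob_bind (isAlgorithm_shuffle _ _ _) (fun p => pure (p.1, a :: p.2))]
      simp only [h2, tsum_zero, mul_zero, add_zero]
      simp only [List.length_cons, Nat.add_sub_cancel]
      have h3 := prob_map_of_injective (isAlgorithm_shuffle (⟨A'.length⟩ : BigNat w) ⟨L.length⟩ L)
        (h := fun p => (a :: p.1, p.2)) (by
          rintro ⟨x, y⟩ ⟨x', y'⟩ e
          simpa using e) (A', B)
      simp only at h3
      rw [h3, ih hL h]
      have hle := h.length_add_length
      refine ofReal_div_mul_inv (by omega) (Nat.choose_pos (by omega)) (Nat.choose_pos (by omega)) ?_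
      rw [Nat.add_one_mul_choose_eq, mul_comm]
    · have h2 : ∀ p : List (BigNat w) × List (BigNat w), ENNReal.ofReal (A.length / (L.length + 1 : ℕ)) *
          ((shuffle ⟨A.length - 1⟩ ⟨L.length⟩ L).prob p *
          (pure (a :: p.1, p.2) : RComp _).prob (A, a :: B')) = 0 := by
        intro p
        by_contra hp
        rw [prob_pure] at hp
        obtain ⟨-, hp⟩ := mul_ne_zero_iff.1 hp
        obtain ⟨hp1, hp2⟩ := mul_ne_zero_iff.1 hp
        have hp2 := (ite_ne_right_iff.1 hp2).1
        simp only [Prod.mk.injEq] at hp2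
        have := (isSplit_of_prob_shuffle_ne_zero (by omega) hp1).1.sublist_right
        rw [hp2.2] at this
        exact ha (this.subset (by simp))
      rw [prob_bind (isAlgorithm_shuffle _ _ _) (fun p => pure (a :: p.1, p.2)),
        ← ENNReal.tsum_mul_left]
      simp only [h2, tsum_zero, zero_add]
      have h3 := prob_map_of_injective (isAlgorithm_shuffle (⟨A.length⟩ : BigNat w) ⟨L.length⟩ L)
        (h := fun p => (p.1, a :: p.2)) (by
          rintro ⟨x, y⟩ ⟨x', y'⟩ e
          simpa using e) (A, B')
      simp only at h3
      have hle := h.length_add_length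
      rw [h3, ih hL h]
      have : (1 : ℝ) - A.length / (L.length + 1 : ℕ) =
          ((L.length + 1 - A.length : ℕ) : ℝ) / (L.length + 1 : ℕ) := by
        rw [Nat.cast_sub (by omega), sub_div, div_self (by positivity)]
      rw [this]
      refine ofReal_div_mul_inv (by omega) (Nat.choose_pos (by omega)) (Nat.choose_pos (by omega)) ?_
      rw [mul_comm, ← Nat.choose_mul_succ_eq, mul_comm]

/-- Per label: one call, two subtractions at 25 and a coin at 4 + 6 · 25, in total 205. -/
theorem expectedTime_shuffle_le (hw : 1 ≤ w) {L : List (BigNat w)} (hL : L.length ≤ 2 ^ w) {r : ℕ}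
    (hr : r ≤ L.length) : (shuffle ⟨r⟩ ⟨L.length⟩ L).expectedTime ≤ (205 * (L.length + 1) : ℕ) := by
  induction L generalizing r with
  | nil =>
    refine ((shuffle_nil _ _).expectedTime_le (isAlgorithm_pure _)).trans ?_
    rw [expectedTime_pure]
    norm_num
  | cons a L ih =>
    rw [List.length_cons] at hr hL ⊢
    obtain ⟨g, hg, hgs, h⟩ := shuffle_cons hr a L
    have hW1 : words w (L.length + 1) ^ 2 ≤ 25 :=
      Nat.pow_le_pow_left ((words_mono (by omega)).trans (words_four_mul_le hw hL)) 2
    have hW2 : words w (2 * (L.length + 1)) ^ 2 ≤ 25 :=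
      Nat.pow_le_pow_left ((words_mono (by omega)).trans (words_four_mul_le hw hL)) 2
    have hcoin := expectedTime_biasedCoin_le (a := (⟨r⟩ : BigNat w)) (s := ⟨L.length + 1⟩) hr
    have hc := prob_biasedCoin (a := (⟨r⟩ : BigNat w)) (s := ⟨L.length + 1⟩) hr
      (by show 1 ≤ L.length + 1; omega)
    have hbody := expectedTime_bind_le_add (isAlgorithm_biasedCoin (⟨r⟩ : BigNat w) ⟨L.length + 1⟩) hg
      (C := ((words w (L.length + 1) ^ 2 : ℕ) : ℝ≥0∞) + (205 * (L.length + 1) : ℕ)) fun c hcp => by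
        refine ((hgs c).expectedTime_le (isAlgorithm_shuffleStep _ _ _ _ _)).trans ?_
        gcongr
        cases c
        · refine (expectedTime_map_le (isAlgorithm_shuffle _ _ _) _).trans (ih (by omega) ?_)
          by_contra hrl
          obtain rfl : r = L.length + 1 := by omega
          rw [hc] at hcp
          simp only [coinProb, Bool.false_eq_true, if_false] at hcp
          rw [div_self (by positivity)] at hcp
          simp at hcp
        · exact (expectedTime_map_le (isAlgorithm_shuffle _ _ _) _).trans
            (ih (by omega) (by omega))
    refine (h.expectedTime_le ((isAlgorithm_biasedCoin _ _).bind hg)).trans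
      ((add_le_add le_rfl (hbody.trans (add_le_add hcoin le_rfl))).trans ?_)
    exact_mod_cast (by omega : 1 + words w (L.length + 1) ^ 2 +
      (4 + 6 * words w (2 * (L.length + 1)) ^ 2 + (words w (L.length + 1) ^ 2 +
        205 * (L.length + 1))) ≤ 205 * (L.length + 1 + 1))

end

/-! ### Support and mass of composed computations. -/

namespace RComp

theorem exists_of_prob_bind_ne_zero {f : RComp α} (hf : f.IsAlgorithm) {g : α → RComp β} {b : β}
    (h : (f >>= g).prob b ≠ 0) : ∃ a, f.prob a ≠ 0 ∧ (g a).prob b ≠ 0 := by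
  rw [prob_bind hf] at h
  by_contra! hall
  refine h (ENNReal.tsum_eq_zero.2 fun a => ?_)
  by_cases ha : f.prob a = 0
  · rw [ha, zero_mul]
  · rw [hall a ha, mul_zero]

/-- If the final value determines the intermediate one, the sum over intermediate values has a
single term. This is how a tree determines its history in the sampler. -/
theorem prob_bind_eq_of_unique {f : RComp α} (hf : f.IsAlgorithm) {g : α → RComp β} {b : β} (a : α)
    (h : ∀ a', f.prob a' ≠ 0 → (g a').prob b ≠ 0 → a' = a) :
    (f >>= g).prob b = f.prob a * (g a).prob b := by
  rw [prob_bind hf, tsum_eq_single a]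
  intro a' ha'
  by_contra hne
  obtain ⟨h1, h2⟩ := mul_ne_zero_iff.1 hne
  exact ha' (h a' h1 h2)

theorem mass_bind_eq_one {f : RComp α} (hf : f.IsAlgorithm) (hf1 : f.mass = 1) {g : α → RComp β}
    (h : ∀ a, f.prob a ≠ 0 → (g a).mass = 1) : (f >>= g).mass = 1 := by
  rw [mass_bind hf, ← hf1, mass_eq_tsum]
  refine tsum_congr fun a => ?_
  by_cases ha : f.prob a = 0
  · rw [ha, zero_mul]
  · rw [h a ha, mul_one]

end RComp

/-! ## Labelled trees -/

namespace BTree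

theorem labels_map {α β : Type} (f : α → β) (T : BTree α) : (T.map f).labels = T.labels.map f := by
  induction T with
  | leaf a => rfl
  | node a l r hl hr => simp [map, labels, hl, hr]

/-- Sizes are odd; the form 2k - 1 names the index used for left sizes and tangent coefficients. -/
theorem exists_length_labels {α : Type} (T : BTree α) : ∃ k, 1 ≤ k ∧ T.labels.length = 2 * k - 1 := by
  induction T with
  | leaf a => exact ⟨1, le_rfl, rfl⟩
  | node a l r hl hr =>
    obtain ⟨k, hk, hl⟩ := hl
    obtain ⟨j, hj, hr⟩ := hr
    refine ⟨k + j, by omega, ?_⟩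
    rw [labels, List.length_cons, List.length_append]
    omega

theorem map_injective {α β : Type} {f : α → β} (hf : Function.Injective f) :
    Function.Injective (BTree.map f) := by
  intro T
  induction T with
  | leaf a =>
    intro T' h
    cases T' with
    | leaf b =>
      rw [map, map, leaf.injEq] at h
      rw [hf h]
    | node b l r => cases h
  | node a l r hl hr =>
    intro T' h
    cases T' with
    | leaf b => cases h
    | node b l' r' =>
      rw [map, map, node.injEq] at h
      rw [hf h.1, hl h.2.1, hr h.2.2]

end BTree

theorem exists_isSplit {α : Type} {L X Y : List α} (hL : L.Nodup) (h : (X ++ Y).Perm L) :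
    ∃ A B, IsSplit L A B ∧ A.Perm X ∧ B.Perm Y := by
  classical
  have hs := isSplit_filter (fun a => decide (a ∈ X)) L
  refine ⟨_, _, hs, ?_⟩
  have hdis := (List.nodup_append.1 ((h.nodup_iff).2 hL)).2.2
  have hA : (L.filter fun a => decide (a ∈ X)).Perm X := by
    have h1 := h.symm.filter fun a => decide (a ∈ X)
    rw [List.filter_append] at h1
    have hX : X.filter (fun a => decide (a ∈ X)) = X :=
      List.filter_eq_self.2 fun a ha => by simpa using ha
    have hY : Y.filter (fun a => decide (a ∈ X)) = [] :=
      List.filter_eq_nil_iff.2 fun a ha => by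
        simp only [decide_eq_true_eq]
        exact fun ha' => hdis a ha' a ha rfl
    rwa [hX, hY, List.append_nil] at h1
  refine ⟨hA, ?_⟩
  have h2 := (hs.perm.trans h.symm).trans (hA.symm.append_right Y)
  exact (List.perm_append_left_iff _).1 h2

section

variable {w : ℕ}

/-- The label list is increasing. -/
def Increasing (L : List (BigNat w)) : Prop := L.Pairwise fun a b => a.val < b.val

theorem Increasing.nodup {L : List (BigNat w)} (h : Increasing L) : L.Nodup :=
  List.Pairwise.imp (fun hab e => by rw [e] at hab; exact lt_irrefl _ hab) h

theorem Increasing.eq_of_perm {A B : List (BigNat w)} (hA : Increasing A) (hB : Increasing B)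
    (h : A.Perm B) : A = B :=
  List.Perm.eq_of_pairwise (fun _ _ _ _ h1 h2 => absurd h1 (lt_asymm h2)) hA hB h

/-- The trees that the recursive method can return for the list `L` of labels. -/
def IsTreeOn (L : List (BigNat w)) (T : BTree (BigNat w)) : Prop :=
  (T.map BigNat.val).IsIncreasing ∧ T.labels.Perm L

/-- The increasing condition forces the smallest label to the root. The labels of the left subtree
then cut the rest of the list into two sublists, found by filtering. -/
theorem isTreeOn_node_iff {a : BigNat w} {L : List (BigNat w)} (hL : Increasing (a :: L))
    {T : BTree (BigNat w)} (hl : L ≠ []) : IsTreeOn (a :: L) T ↔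
      ∃ T₁ T₂ A B, T = BTree.node a T₁ T₂ ∧ IsSplit L A B ∧ IsTreeOn A T₁ ∧ IsTreeOn B T₂ := by
  have ha := (List.pairwise_cons.1 hL).1
  constructor
  · rintro ⟨h1, h2⟩
    cases T with
    | leaf b =>
      have := h2.length_eq
      simp only [BTree.labels, List.length_cons, List.length_nil] at this
      exact absurd (List.length_eq_zero_iff.1 (by omega)) hl
    | node b T₁ T₂ =>
      obtain ⟨h3, h4, h5⟩ := h1
      rw [BTree.labels] at h2
      have hb : ∀ c ∈ T₁.labels ++ T₂.labels, b.val < c.val := by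
        intro c hc
        refine h3 _ ?_
        rw [BTree.labels_map, BTree.labels_map, ← List.map_append]
        exact List.mem_map_of_mem hc
      have hab : b = a := by
        by_contra hne
        have hba : b ∈ L := by
          have := h2.subset List.mem_cons_self
          exact (List.mem_cons.1 this).resolve_left hne
        have hab : a ∈ T₁.labels ++ T₂.labels := by
          have := h2.symm.subset List.mem_cons_self
          exact (List.mem_cons.1 this).resolve_left fun e => hne e.symm
        exact absurd (ha b hba) (lt_asymm (hb a hab))
      subst hab
      obtain ⟨A, B, hs, hA, hB⟩ := exists_isSplit (List.nodup_cons.1 hL.nodup).2 h2.cons_inv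
      exact ⟨T₁, T₂, A, B, rfl, hs, ⟨h4, hA.symm⟩, ⟨h5, hB.symm⟩⟩
  · rintro ⟨T₁, T₂, A, B, rfl, hs, ⟨h1, h2⟩, ⟨h3, h4⟩⟩
    have hp : (T₁.labels ++ T₂.labels).Perm L := (h2.append h4).trans hs.perm
    refine ⟨⟨fun c hc => ?_, h1, h3⟩, hp.cons a⟩
    rw [BTree.labels_map, BTree.labels_map, ← List.map_append] at hc
    obtain ⟨d, hd, rfl⟩ := List.mem_map.1 hc
    exact ha d (hp.subset hd)

/-! ## The recursive method -/

/-- The generation of the subtrees, once the labels have been distributed. -/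
noncomputable def subtrees (self : BigNat w × List (BigNat w) → RComp (BTree (BigNat w)))
    (a m s : BigNat w) (p : List (BigNat w) × List (BigNat w)) : RComp (BTree (BigNat w)) :=
  self (m, p.1) >>= fun T' => sub s m >>= fun m' => self (m', p.2) >>= fun T'' =>
    pure (BTree.node a T' T'')

theorem subtrees_admissible (a m s : BigNat w) (p : List (BigNat w) × List (BigNat w)) :
    Admissible fun self => subtrees self a m s p :=
  (admissible_self _).bind fun _ => (admissible_const (isAlgorithm_op _ _ _)).bind fun _ =>
    (admissible_self _).bind fun _ => admissible_const (isAlgorithm_pure _)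

theorem recursiveMethod_eq_fix : ∃ F, (∀ (n : BigNat w) (L : List (BigNat w)),
      recursiveMethod n L = fix F (n, L)) ∧ (∀ a, Admissible fun self => F self a) ∧
    ∀ self n a L, F self (n, a :: L) = (le n ⟨1⟩ >>= fun c => if c = true then pure (BTree.leaf a)
      else leftSize n >>= fun m => sub n ⟨1⟩ >>= fun s => shuffle m s L >>= fun p =>
        subtrees self a m s p) := by
  refine ⟨_, fun _ _ => rfl, ?_, fun _ _ _ _ => rfl⟩
  rintro ⟨n, L⟩
  cases L with
  | nil => exact admissible_const (isAlgorithm_pure _)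
  | cons a L =>
    refine (admissible_const (isAlgorithm_le _ _)).bind fun _ => Admissible.ite _
      (admissible_const (isAlgorithm_pure _)) ?_
    exact (admissible_const (isAlgorithm_leftSize _)).bind fun _ =>
      (admissible_const (isAlgorithm_op _ _ _)).bind fun _ =>
      (admissible_const (isAlgorithm_shuffle _ _ _)).bind fun _ => subtrees_admissible _ _ _ _

theorem isAlgorithm_recursiveMethod (n : BigNat w) (L : List (BigNat w)) :
    (recursiveMethod n L).IsAlgorithm := by
  obtain ⟨F, h, hF, -⟩ := recursiveMethod_eq_fix (w := w)
  rw [h]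
  exact isAlgorithm_fix hF _

theorem isAlgorithm_subtrees (a m s : BigNat w) (p : List (BigNat w) × List (BigNat w)) :
    (subtrees (fun x => recursiveMethod x.1 x.2) a m s p).IsAlgorithm :=
  (subtrees_admissible a m s p).alg _ fun _ => isAlgorithm_recursiveMethod _ _

theorem recursiveMethod_singleton (a : BigNat w) :
    Delays (recursiveMethod ⟨1⟩ [a]) (pure (BTree.leaf a)) (1 + words w 1 ^ 2) := by
  obtain ⟨F, h, hF, h1⟩ := recursiveMethod_eq_fix (w := w)
  rw [h, fix_eq hF, h1]
  refine (Delays.delay _ _).trans ?_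
  exact (returns_le (a := (⟨1⟩ : BigNat w)) (b := ⟨1⟩) (X := 1) le_rfl le_rfl).delays _

/-- The recursive method after the size of the left subtree has been drawn. -/
noncomputable def distribute (a : BigNat w) (L : List (BigNat w)) (m s : BigNat w) :
    RComp (BTree (BigNat w)) :=
  shuffle m s L >>= fun p => subtrees (fun x => recursiveMethod x.1 x.2) a m s p

theorem isAlgorithm_distribute (a : BigNat w) (L : List (BigNat w)) (m s : BigNat w) :
    (distribute a L m s).IsAlgorithm :=
  (isAlgorithm_shuffle _ _ _).bind fun _ => isAlgorithm_subtrees _ _ _ _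

theorem recursiveMethod_cons {n : ℕ} (hn : 2 ≤ n) (a : BigNat w) (L : List (BigNat w)) :
    ∃ g : BigNat w → RComp (BTree (BigNat w)), (∀ m, (g m).IsAlgorithm) ∧
      (∀ m, Delays (g m) (distribute a L m ⟨n - 1⟩) (words w n ^ 2)) ∧
      Delays (recursiveMethod ⟨n⟩ (a :: L)) (leftSize ⟨n⟩ >>= g) (1 + words w n ^ 2) := by
  obtain ⟨F, h, hF, h1⟩ := recursiveMethod_eq_fix (w := w)
  refine ⟨fun m => sub ⟨n⟩ ⟨1⟩ >>= fun s => distribute a L m s, ?_, ?_, ?_⟩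
  · exact fun _ => (isAlgorithm_op _ _ _).bind fun _ => isAlgorithm_distribute _ _ _ _
  · exact fun _ => (returns_sub (a := ⟨n⟩) (b := ⟨1⟩) (X := n) le_rfl
      (by show 1 ≤ n; omega)).delays _
  · rw [h, fix_eq hF, h1]
    refine (Delays.delay _ _).trans ?_
    have hle := returns_le (a := (⟨n⟩ : BigNat w)) (b := ⟨1⟩) (X := n) le_rfl (by show 1 ≤ n; omega)
    have hn1 : ¬ n ≤ 1 := by omega
    simp only [hn1, decide_false] at hle
    refine hle.delays' ?_
    simp only [Bool.false_eq_true, if_false, distribute, h]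

theorem prob_subtrees_node (a : BigNat w) (m s : ℕ) (p : List (BigNat w) × List (BigNat w))
    (T₁ T₂ : BTree (BigNat w)) :
    (subtrees (fun x => recursiveMethod x.1 x.2) a ⟨m⟩ ⟨s⟩ p).prob (BTree.node a T₁ T₂) =
      (recursiveMethod ⟨m⟩ p.1).prob T₁ * (recursiveMethod ⟨s - m⟩ p.2).prob T₂ := by
  have hd := fun T' => ((returns_sub (a := (⟨s⟩ : BigNat w)) (b := ⟨m⟩) (le_max_left s m)
    (le_max_right s m)).delays fun m' => recursiveMethod m' p.2 >>= fun T'' =>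
      pure (BTree.node a T' T''))
  rw [subtrees, prob_bind_eq_of_unique (isAlgorithm_recursiveMethod _ _) T₁]
  · congr 1
    rw [(hd T₁).prob_eq]
    exact prob_map_of_injective (isAlgorithm_recursiveMethod _ _) (h := BTree.node a T₁)
      (fun x y e => by simpa using e) T₂
  · intro T' _ h
    rw [(hd T').prob_eq] at h
    by_contra hne
    refine h (prob_map_of_notMem_range (isAlgorithm_recursiveMethod _ _) (h := BTree.node a T')
      fun x e => hne ?_)
    rw [BTree.node.injEq] at e
    exact e.2.1

theorem exists_of_prob_subtrees_ne_zero {a : BigNat w} {m s : ℕ}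
    {p : List (BigNat w) × List (BigNat w)} {T : BTree (BigNat w)}
    (h : (subtrees (fun x => recursiveMethod x.1 x.2) a ⟨m⟩ ⟨s⟩ p).prob T ≠ 0) :
    ∃ T₁ T₂, T = BTree.node a T₁ T₂ ∧ (recursiveMethod ⟨m⟩ p.1).prob T₁ ≠ 0 ∧
      (recursiveMethod ⟨s - m⟩ p.2).prob T₂ ≠ 0 := by
  classical
  rw [subtrees] at h
  obtain ⟨T₁, -, h2⟩ := exists_of_prob_bind_ne_zero (isAlgorithm_recursiveMethod _ _) h
  obtain ⟨m', -, h2⟩ := exists_of_prob_bind_ne_zero (isAlgorithm_op _ _ _) h2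
  obtain ⟨T₂, -, h2⟩ := exists_of_prob_bind_ne_zero (isAlgorithm_recursiveMethod _ _) h2
  rw [prob_pure] at h2
  obtain rfl := (ite_ne_right_iff.1 h2).1
  have h := prob_subtrees_node a m s p T₁ T₂ ▸ h
  exact ⟨T₁, T₂, rfl, mul_ne_zero_iff.1 h⟩

theorem mass_subtrees {a : BigNat w} {m s : ℕ} {p : List (BigNat w) × List (BigNat w)}
    (h1 : (recursiveMethod ⟨m⟩ p.1).mass = 1) (h2 : (recursiveMethod ⟨s - m⟩ p.2).mass = 1) :
    (subtrees (fun x => recursiveMethod x.1 x.2) a ⟨m⟩ ⟨s⟩ p).mass = 1 := by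
  refine mass_bind_eq_one (isAlgorithm_recursiveMethod _ _) h1 fun T' _ => ?_
  rw [((returns_sub (a := (⟨s⟩ : BigNat w)) (b := ⟨m⟩) (le_max_left s m)
    (le_max_right s m)).delays _).mass_eq]
  exact (mass_map (isAlgorithm_recursiveMethod _ _) _).trans h2

theorem exists_of_prob_leftSize_ne_zero {l : ℕ} (hl : 2 ≤ l) {m : BigNat w}
    (h : (leftSize (⟨2 * l - 1⟩ : BigNat w)).prob m ≠ 0) :
    ∃ k ∈ Finset.Icc 1 (l - 1), m = ⟨2 * k - 1⟩ := by
  obtain ⟨b⟩ := m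
  rw [prob_leftSize hl] at h
  obtain ⟨k, hk, h⟩ := Finset.exists_ne_zero_of_sum_ne_zero h
  refine ⟨k, hk, ?_⟩
  rw [(ite_ne_right_iff.1 (mul_ne_zero_iff.1 h).2).1]

theorem mass_leftSize {l : ℕ} (hl : 2 ≤ l) : (leftSize (⟨2 * l - 1⟩ : BigNat w)).mass = 1 := by
  have h := tsum_prob_leftSize (w := w) hl fun _ => 1
  simp only [mul_one] at h
  rw [mass_eq_tsum, h, ← ENNReal.ofReal_sum_of_nonneg, sum_sizeProb hl, ENNReal.ofReal_one]
  intro k hk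
  rw [Finset.mem_Icc] at hk
  exact sizeProb_nonneg hk.1 (by omega)

/-- Almost sure termination, by induction on the size; every stage of a call stops almost surely. It
is later used to count the trees. -/
theorem mass_recursiveMethod {l : ℕ} (hl : 1 ≤ l) {L : List (BigNat w)}
    (hL : L.length = 2 * l - 1) : (recursiveMethod ⟨2 * l - 1⟩ L).mass = 1 := by
  induction l using Nat.strong_induction_on generalizing L with
  | _ l ih =>
    cases L with
    | nil =>
      rw [List.length_nil] at hL
      omega
    | cons a L =>
      rw [List.length_cons] at hL
      obtain rfl | hl2 := hl.eq_or_lt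
      · obtain rfl := List.length_eq_zero_iff.1 (by omega : L.length = 0)
        rw [show 2 * 1 - 1 = 1 from rfl, (recursiveMethod_singleton a).mass_eq, mass_pure]
      · obtain ⟨g, hg, hgd, h⟩ := recursiveMethod_cons (by omega : 2 ≤ 2 * l - 1) a L
        rw [h.mass_eq]
        refine mass_bind_eq_one (isAlgorithm_leftSize _) (mass_leftSize hl2) fun m hm => ?_
        obtain ⟨k, hk, rfl⟩ := exists_of_prob_leftSize_ne_zero hl2 hm
        rw [Finset.mem_Icc] at hk
        have hs : 2 * l - 1 - 1 = L.length := by omega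
        rw [(hgd _).mass_eq, distribute, hs]
        refine mass_bind_eq_one (isAlgorithm_shuffle _ _ _) (mass_shuffle (by omega)) fun p hp => ?_
        obtain ⟨h1, h2⟩ := isSplit_of_prob_shuffle_ne_zero (A := p.1) (B := p.2) (by omega) hp
        have h3 := h1.length_add_length
        have h4 : L.length - (2 * k - 1) = 2 * (l - k) - 1 := by omega
        refine mass_subtrees (ih k (by omega) hk.1 h2) ?_
        rw [h4]
        exact ih (l - k) (by omega) (by omega) (by omega)

theorem isTreeOn_of_prob_ne_zero {l : ℕ} (hl : 1 ≤ l) {L : List (BigNat w)} (hi : Increasing L)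
    (hL : L.length = 2 * l - 1) {T : BTree (BigNat w)}
    (hT : (recursiveMethod ⟨2 * l - 1⟩ L).prob T ≠ 0) : IsTreeOn L T := by
  classical
  induction l using Nat.strong_induction_on generalizing L T with
  | _ l ih =>
    cases L with
    | nil =>
      rw [List.length_nil] at hL
      omega
    | cons a L =>
      rw [List.length_cons] at hL
      obtain rfl | hl2 := hl.eq_or_lt
      · obtain rfl := List.length_eq_zero_iff.1 (by omega : L.length = 0)
        rw [show 2 * 1 - 1 = 1 from rfl, (recursiveMethod_singleton a).prob_eq, prob_pure] at hT
        obtain rfl := (ite_ne_right_iff.1 hT).1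
        exact ⟨trivial, List.Perm.refl _⟩
      · obtain ⟨g, hg, hgd, h⟩ := recursiveMethod_cons (by omega : 2 ≤ 2 * l - 1) a L
        rw [h.prob_eq] at hT
        obtain ⟨m, hm, hT⟩ := exists_of_prob_bind_ne_zero (isAlgorithm_leftSize _) hT
        obtain ⟨k, hk, rfl⟩ := exists_of_prob_leftSize_ne_zero hl2 hm
        rw [Finset.mem_Icc] at hk
        have hs : 2 * l - 1 - 1 = L.length := by omega
        rw [(hgd _).prob_eq, distribute, hs] at hT
        obtain ⟨p, hp, hT⟩ := exists_of_prob_bind_ne_zero (isAlgorithm_shuffle _ _ _) hT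
        obtain ⟨h1, h2⟩ := isSplit_of_prob_shuffle_ne_zero (A := p.1) (B := p.2) (by omega) hp
        obtain ⟨T₁, T₂, rfl, hT1, hT2⟩ := exists_of_prob_subtrees_ne_zero hT
        have h3 := h1.length_add_length
        have h4 : L.length - (2 * k - 1) = 2 * (l - k) - 1 := by omega
        rw [h4] at hT2
        have hi' : Increasing L := (List.pairwise_cons.1 hi).2
        refine (isTreeOn_node_iff hi (fun e => by rw [e] at hL; simp at hL; omega)).2
          ⟨T₁, T₂, p.1, p.2, rfl, h1, ?_, ?_⟩
        · exact ih k (by omega) hk.1 (hi'.sublist h1.sublist_left) h2 hT1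
        · exact ih (l - k) (by omega) (by omega) (hi'.sublist h1.sublist_right) (by omega) hT2

/-- The number of strictly increasing binary trees of size `2l - 1`. -/
noncomputable def treeNumber (l : ℕ) : ℝ := (2 * l - 1).factorial * tangentCoeff l

theorem treeNumber_pos {l : ℕ} (hl : 1 ≤ l) : 0 < treeNumber l := by
  have := tangentCoeff_pos hl
  unfold treeNumber
  positivity

theorem treeNumber_one : treeNumber 1 = 1 := by
  rw [treeNumber, tangentCoeff_one]
  norm_num

theorem sizeProb_eq_tangentCoeff {l k : ℕ} (hk : 1 ≤ k) (hkl : k < l) : sizeProb l k =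
    tangentCoeff k * tangentCoeff (l - k) / ((2 * l - 1) * tangentCoeff l) := by
  have hc : (0 : ℝ) < 4 / Real.pi ^ (2 * l) := by positivity
  rw [sizeProb, ← sum_tangentCoeff (by omega), tangentCoeff_mul hk hkl]
  have : ∑ j ∈ Finset.Icc 1 (l - 1), tangentCoeff j * tangentCoeff (l - j) =
      4 / Real.pi ^ (2 * l) * ∑ j ∈ Finset.Icc 1 (l - 1), weight l j := by
    rw [Finset.mul_sum]
    refine Finset.sum_congr rfl fun j hj => ?_
    rw [Finset.mem_Icc] at hj
    exact tangentCoeff_mul hj.1 (by omega)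
  rw [this, mul_div_mul_left _ _ hc.ne']

/-- The factorials of the binomial coefficient cancel those in the tree numbers, and 2l - 1 from the
recurrence turns (2l - 2)! into (2l - 1)!. -/
theorem sizeProb_mul {l k : ℕ} (hk : 1 ≤ k) (hkl : k < l) :
    sizeProb l k * (((2 * l - 2).choose (2 * k - 1) : ℝ)⁻¹ *
      ((treeNumber k)⁻¹ * (treeNumber (l - k))⁻¹)) = (treeNumber l)⁻¹ := by
  have h1 := tangentCoeff_pos hk
  have h2 := tangentCoeff_pos (by omega : 1 ≤ l - k)
  have h3 := tangentCoeff_pos (by omega : 1 ≤ l)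
  have hf := Nat.choose_mul_factorial_mul_factorial (show 2 * k - 1 ≤ 2 * l - 2 by omega)
  rw [show 2 * l - 2 - (2 * k - 1) = 2 * (l - k) - 1 by omega] at hf
  have hf' : ((2 * l - 2).choose (2 * k - 1) : ℝ) * (2 * k - 1).factorial *
      (2 * (l - k) - 1).factorial = (2 * l - 2).factorial := by exact_mod_cast hf
  have hc : (0 : ℝ) < (2 * l - 2).choose (2 * k - 1) := by
    exact_mod_cast Nat.choose_pos (by omega)
  have hl : ((2 * l - 1).factorial : ℝ) = (2 * l - 1) * (2 * l - 2).factorial := by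
    have : (2 * l - 1).factorial = (2 * l - 1) * (2 * l - 2).factorial := by
      rw [show 2 * l - 1 = 2 * l - 2 + 1 by omega, Nat.factorial_succ]
    rw [this, Nat.cast_mul, Nat.cast_sub (by omega)]
    push_cast
    ring
  have hl' : (0 : ℝ) < 2 * l - 1 := by
    have : (2 : ℝ) ≤ l := by exact_mod_cast (by omega : 2 ≤ l)
    linarith
  rw [sizeProb_eq_tangentCoeff hk hkl, treeNumber, treeNumber, treeNumber, hl, ← hf']
  have hp1 : (0 : ℝ) < (2 * k - 1).factorial := by positivity
  have hp2 : (0 : ℝ) < (2 * (l - k) - 1).factorial := by positivity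
  field_simp

/-- A tree fixes the left size by the number of labels in its left subtree, and the split by its
label sets, as sublists of an increasing list are determined by their members. So exactly one
history leads to it, and its probability is the product in `sizeProb_mul`. -/
theorem prob_recursiveMethod {l : ℕ} (hl : 1 ≤ l) {L : List (BigNat w)} (hi : Increasing L)
    (hL : L.length = 2 * l - 1) {T : BTree (BigNat w)} (hT : IsTreeOn L T) :
    (recursiveMethod ⟨2 * l - 1⟩ L).prob T = ENNReal.ofReal (treeNumber l)⁻¹ := by
  classical
  induction l using Nat.strong_induction_on generalizing L T with
  | _ l ih =>
    cases L with
    | nil =>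
      rw [List.length_nil] at hL
      omega
    | cons a L =>
      rw [List.length_cons] at hL
      obtain rfl | hl2 := hl.eq_or_lt
      · obtain rfl := List.length_eq_zero_iff.1 (by omega : L.length = 0)
        rw [show 2 * 1 - 1 = 1 from rfl, (recursiveMethod_singleton a).prob_eq, prob_pure,
          treeNumber_one, inv_one, ENNReal.ofReal_one, if_pos]
        cases T with
        | leaf b =>
          have := hT.2
          rw [BTree.labels, List.singleton_perm_singleton] at this
          rw [this]
        | node b T₁ T₂ =>
          obtain ⟨k, hk, h1⟩ := T₁.exists_length_labels
          have h2 := hT.2.length_eq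
          rw [BTree.labels, List.length_cons, List.length_append] at h2
          simp only [List.length_cons, List.length_nil] at h2
          omega
      · have hi' : Increasing L := (List.pairwise_cons.1 hi).2
        obtain ⟨T₁, T₂, A, B, rfl, hs, hA, hB⟩ :=
          (isTreeOn_node_iff hi (fun e => by rw [e] at hL; simp at hL; omega)).1 hT
        obtain ⟨k, hk, h1⟩ := T₁.exists_length_labels
        obtain ⟨j, hj, h2⟩ := T₂.exists_length_labels
        have h3 := hs.length_add_length
        have hAl := hA.2.length_eq
        have hBl := hB.2.length_eq
        obtain rfl : j = l - k := by omega
        have hkl : k < l := by omega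
        obtain ⟨g, hg, hgd, h⟩ := recursiveMethod_cons (by omega : 2 ≤ 2 * l - 1) a L
        have hlen : 2 * l - 1 - 1 = L.length := by omega
        rw [h.prob_eq, prob_bind_eq_of_unique (isAlgorithm_leftSize _) ⟨2 * k - 1⟩]
        · rw [prob_leftSize_of_mem (Finset.mem_Icc.2 ⟨hk, by omega⟩), (hgd _).prob_eq, distribute,
            hlen, prob_bind_eq_of_unique (isAlgorithm_shuffle _ _ _) (A, B)]
          · have hAk : 2 * k - 1 = A.length := by omega
            have h4 : L.length - (2 * k - 1) = 2 * (l - k) - 1 := by omega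
            have hsh := prob_shuffle hi'.nodup hs
            rw [← hAk] at hsh
            rw [prob_subtrees_node, hsh, h4,
              ih k hkl hk (hi'.sublist hs.sublist_left) (by omega) hA,
              ih (l - k) (by omega) (by omega) (hi'.sublist hs.sublist_right) (by omega) hB,
              ← sizeProb_mul hk hkl, ← ENNReal.ofReal_natCast, ← ENNReal.ofReal_inv_of_pos,
              ← ENNReal.ofReal_mul, ← ENNReal.ofReal_mul, ← ENNReal.ofReal_mul]
            · rw [← hlen]
              rfl
            · exact sizeProb_nonneg hk hkl
            · positivity
            · exact inv_nonneg.2 (treeNumber_pos hk).le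
            · exact_mod_cast Nat.choose_pos (by omega)
          · rintro ⟨A', B'⟩ hp hT'
            obtain ⟨i1, i2⟩ := isSplit_of_prob_shuffle_ne_zero (by omega) hp
            have i3 := i1.length_add_length
            rw [prob_subtrees_node] at hT'
            obtain ⟨j1, j2⟩ := mul_ne_zero_iff.1 hT'
            have h4 : L.length - (2 * k - 1) = 2 * (l - k) - 1 := by omega
            rw [h4] at j2
            have e1 := isTreeOn_of_prob_ne_zero hk (hi'.sublist i1.sublist_left) i2 j1
            have e2 := isTreeOn_of_prob_ne_zero (by omega) (hi'.sublist i1.sublist_right)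
              (by omega) j2
            rw [Prod.mk.injEq]
            exact ⟨Increasing.eq_of_perm (hi'.sublist i1.sublist_left) (hi'.sublist hs.sublist_left)
              (e1.2.symm.trans hA.2), Increasing.eq_of_perm (hi'.sublist i1.sublist_right)
              (hi'.sublist hs.sublist_right) (e2.2.symm.trans hB.2)⟩
        · intro m hm hT'
          obtain ⟨k', hk', rfl⟩ := exists_of_prob_leftSize_ne_zero hl2 hm
          rw [Finset.mem_Icc] at hk'
          rw [(hgd _).prob_eq, distribute, hlen] at hT'
          obtain ⟨⟨A', B'⟩, hp, hT'⟩ := exists_of_prob_bind_ne_zero (isAlgorithm_shuffle _ _ _) hT'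
          obtain ⟨i1, i2⟩ := isSplit_of_prob_shuffle_ne_zero (by omega) hp
          rw [prob_subtrees_node] at hT'
          obtain ⟨j1, j2⟩ := mul_ne_zero_iff.1 hT'
          have e1 := isTreeOn_of_prob_ne_zero hk'.1 (hi'.sublist i1.sublist_left) i2 j1
          have e3 := e1.2.length_eq
          have : k' = k := by omega
          rw [this]

end

/-! ## The time of the recursive method -/

/-- From log z ≥ 1 - 1/z with z = (x + y)/x, and with x and y exchanged. The gain is a constant
fraction of x + y whenever the split is balanced. -/
theorem mul_log_add_le {x y : ℝ} (hx : 0 < x) (hy : 0 < y) :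
    x * Real.log x + y * Real.log y + 2 * (x * y) / (x + y) ≤ (x + y) * Real.log (x + y) := by
  have key : ∀ {x y : ℝ}, 0 < x → 0 < y →
      x * Real.log x + x * y / (x + y) ≤ x * Real.log (x + y) := by
    intro x y hx hy
    have h := Real.one_sub_inv_le_log_of_pos (show 0 < (x + y) / x by positivity)
    rw [Real.log_div (by positivity) hx.ne'] at h
    have h2 : x * (1 - ((x + y) / x)⁻¹) = x * y / (x + y) := by
      field_simp
      ring
    have h3 := mul_le_mul_of_nonneg_left h hx.le
    rw [h2] at h3
    linarith
  have h1 := key hx hy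
  have h2 := key hy hx
  have h3 : 2 * (x * y) / (x + y) = x * y / (x + y) + y * x / (y + x) := by
    rw [add_comm y x, mul_comm y x]
    ring
  rw [add_comm y x] at h2 h3
  linarith

theorem mul_log_sub_one_le {x : ℝ} (hx : 2 ≤ x) : (x - 1) * Real.log (x - 1) ≤ x * Real.log x := by
  have h1 : 0 ≤ Real.log (x - 1) := Real.log_nonneg (by linarith)
  have h2 : Real.log (x - 1) ≤ Real.log x := Real.log_le_log (by linarith) (by linarith)
  exact mul_le_mul (by linarith) h2 h1 (by linarith)

theorem sum_odd_mul_odd (m : ℕ) : ∑ k ∈ Finset.Icc 1 m, ((2 * k - 1) * (2 * (m - k) + 1) : ℝ) =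
    m * (2 * m ^ 2 + 1) / 3 := by
  -- The upper end of the sum and the parameter of the summand must be separated for the induction
  -- to work.
  have h : ∀ M : ℝ, ∑ k ∈ Finset.Icc 1 m, ((2 * k - 1) * (2 * (M - k) + 1) : ℝ) =
      m * (6 * M * m - 4 * m ^ 2 + 1) / 3 := by
    intro M
    induction m with
    | zero => simp
    | succ m ih =>
      rw [Finset.sum_Icc_succ_top (by omega), ih]
      push_cast
      ring
  rw [h]
  ring

/-- The gain 2xy/(x + y) is weighted by at least (16/25)/(l - 1) for each size. Summing the products
of odd sizes by `sum_odd_mul_odd` gives an expected gain of at least 32/75 (l - 1). -/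
theorem sum_sizeProb_mul_le {l : ℕ} (hl : 2 ≤ l) :
    ∑ k ∈ Finset.Icc 1 (l - 1), sizeProb l k * ((2 * k - 1) * Real.log (2 * k - 1) +
      (2 * (l - k) - 1) * Real.log (2 * (l - k) - 1)) ≤
      (2 * l - 1) * Real.log (2 * l - 1) - 32 / 75 * (l - 1) := by
  have hM : (2 : ℝ) ≤ l := by exact_mod_cast hl
  have hterm : ∀ k ∈ Finset.Icc 1 (l - 1), sizeProb l k * ((2 * k - 1) * Real.log (2 * k - 1) +
      (2 * (l - k) - 1) * Real.log (2 * (l - k) - 1)) ≤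
      sizeProb l k * ((2 * l - 1) * Real.log (2 * l - 1)) -
        16 / 25 / (l - 1) ^ 2 * ((2 * k - 1) * (2 * (((l - 1 : ℕ) : ℝ) - k) + 1)) := by
    intro k hk
    rw [Finset.mem_Icc] at hk
    have hk1 : (1 : ℝ) ≤ k := by exact_mod_cast hk.1
    have hkl : (k : ℝ) + 1 ≤ l := by exact_mod_cast (by omega : k + 1 ≤ l)
    rw [Nat.cast_sub (by omega), Nat.cast_one]
    have hx : (0 : ℝ) < 2 * k - 1 := by linarith
    have hy : (0 : ℝ) < 2 * (l - k) - 1 := by linarith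
    have h1 := mul_log_add_le hx hy
    have h2 := mul_log_sub_one_le (x := 2 * l - 1) (by linarith)
    have h3 : (2 * k - 1 + (2 * (l - k) - 1) : ℝ) = 2 * l - 1 - 1 := by ring
    rw [h3] at h1
    have hp := le_sizeProb hk.1 (by omega : k < l)
    have hp0 := sizeProb_nonneg hk.1 (by omega : k < l)
    have hxy : (0 : ℝ) ≤ 2 * ((2 * k - 1) * (2 * (l - k) - 1)) / (2 * l - 1 - 1) :=
      div_nonneg (by positivity) (by linarith)
    have h4 := mul_le_mul_of_nonneg_left (h1.trans h2) hp0
    have h5 := mul_le_mul_of_nonneg_right hp hxy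
    have h6 : (16 / 25 / (l - 1) * (2 * ((2 * k - 1) * (2 * (l - k) - 1)) / (2 * l - 1 - 1)) : ℝ) =
        16 / 25 / (l - 1) ^ 2 * ((2 * k - 1) * (2 * ((l : ℝ) - 1 - k) + 1)) := by
      have : (l : ℝ) - 1 ≠ 0 := by linarith
      rw [show (2 * l - 1 - 1 : ℝ) = 2 * (l - 1) by ring]
      field_simp
      ring
    rw [h6] at h5
    linarith
  refine (Finset.sum_le_sum hterm).trans ?_
  rw [Finset.sum_sub_distrib, ← Finset.sum_mul, sum_sizeProb hl, ← Finset.mul_sum, sum_odd_mul_odd,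
    Nat.cast_sub (by omega), Nat.cast_one, one_mul]
  have h0 : (0 : ℝ) < l - 1 := by linarith
  have : (16 / 25 / (l - 1) ^ 2 * ((l - 1) * (2 * (l - 1) ^ 2 + 1) / 3) : ℝ) =
      32 / 75 * (l - 1) + 16 / 75 / (l - 1) := by
    field_simp
    ring
  rw [this]
  have : (0 : ℝ) ≤ 16 / 75 / (l - 1) := by positivity
  linarith

/-- A bound for the time of the recursive method. -/
noncomputable def potential (b x : ℝ) : ℝ := 1500 * (x * Real.log x) + b * x

theorem potential_nonneg {b x : ℝ} (hb : 0 ≤ b) (hx : 1 ≤ x) : 0 ≤ potential b x := by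
  have := Real.log_nonneg hx
  unfold potential
  positivity

/-- The gain 1500 · 32/75 (l - 1) = 640 (l - 1) exceeds the shuffling cost 205 (2l - 1) for l ≥ 2.
The subtree sizes add up to one less than the size of the tree, which sets `b` free for the other
costs of the node. -/
theorem sum_sizeProb_mul_potential_le {b : ℝ} {l : ℕ} (hl : 2 ≤ l) :
    ∑ k ∈ Finset.Icc 1 (l - 1), sizeProb l k * (50 + 205 * (2 * l - 1) +
      potential b (2 * k - 1) + potential b (2 * (l - k) - 1)) + b ≤
      potential b (2 * l - 1) + 50 := by
  have hM : (2 : ℝ) ≤ l := by exact_mod_cast hl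
  have h1 : ∀ k ∈ Finset.Icc 1 (l - 1), sizeProb l k * (50 + 205 * (2 * l - 1) +
      potential b (2 * k - 1) + potential b (2 * (l - k) - 1)) =
      sizeProb l k * (50 + 205 * (2 * l - 1) + b * (2 * l - 2)) +
      1500 * (sizeProb l k * ((2 * k - 1) * Real.log (2 * k - 1) +
        (2 * (l - k) - 1) * Real.log (2 * (l - k) - 1))) := fun k _ => by
    unfold potential
    ring
  have h2 := sum_sizeProb_mul_le hl
  rw [Finset.sum_congr rfl h1, Finset.sum_add_distrib, ← Finset.sum_mul, sum_sizeProb hl,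
    ← Finset.mul_sum, potential]
  linarith

section

variable {w : ℕ}

theorem expectedTime_subtrees_le (hw : 1 ≤ w) {a : BigNat w} {m s : ℕ} (hs : s ≤ 2 ^ w) (hm : m ≤ s)
    {p : List (BigNat w) × List (BigNat w)} {C D : ℝ≥0∞}
    (h1 : (recursiveMethod ⟨m⟩ p.1).expectedTime ≤ C)
    (h2 : (recursiveMethod ⟨s - m⟩ p.2).expectedTime ≤ D) :
    (subtrees (fun x => recursiveMethod x.1 x.2) a ⟨m⟩ ⟨s⟩ p).expectedTime ≤ C + (25 + D) := by
  have hW : words w s ^ 2 ≤ 25 :=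
    Nat.pow_le_pow_left ((words_mono (by omega)).trans (words_four_mul_le hw hs)) 2
  refine (expectedTime_bind_le_add (isAlgorithm_recursiveMethod _ _) (fun T' =>
    (isAlgorithm_op _ _ _).bind fun _ => (isAlgorithm_recursiveMethod _ _).bind fun _ =>
      isAlgorithm_pure _) (C := 25 + D) fun T' _ => ?_).trans (add_le_add h1 le_rfl)
  have hd := (returns_sub (a := (⟨s⟩ : BigNat w)) (b := ⟨m⟩) (X := s) le_rfl hm).delays
    (fun m' => recursiveMethod m' p.2 >>= fun T'' => pure (BTree.node a T' T''))
  refine (hd.expectedTime_le ((isAlgorithm_recursiveMethod _ _).bind fun _ =>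
    isAlgorithm_pure _)).trans (add_le_add ?_ ?_)
  · exact_mod_cast hW
  · exact (expectedTime_map_le (isAlgorithm_recursiveMethod _ _) _).trans h2

/-- In `b`, the part C (w + 1) pays for the left size. The 76 consists of 26 for the call and its
comparison and 50 for the two subtractions. The word length is fixed throughout the recursion. -/
theorem expectedTime_recursiveMethod_le {C : ℕ} (hC : ∀ w l : ℕ, 1 ≤ w → l ≤ 2 ^ w → 2 ≤ l →
      (leftSize (⟨2 * l - 1⟩ : BigNat w)).expectedTime ≤ (C * (w + 1) : ℕ)) (hw : 1 ≤ w) {l : ℕ}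
    (hl : 1 ≤ l) (hlw : 2 * l - 1 ≤ 2 ^ w) {L : List (BigNat w)} (hL : L.length = 2 * l - 1) :
    (recursiveMethod ⟨2 * l - 1⟩ L).expectedTime ≤
      ENNReal.ofReal (potential ((C * (w + 1) + 76 : ℕ) : ℝ) (2 * l - 1)) := by
  set b : ℝ := ((C * (w + 1) + 76 : ℕ) : ℝ) with hb
  have hb0 : 0 ≤ b := Nat.cast_nonneg _
  induction l using Nat.strong_induction_on generalizing L with
  | _ l ih =>
    have hW : words w (2 * l - 1) ^ 2 ≤ 25 :=
      Nat.pow_le_pow_left ((words_mono (by omega)).trans (words_four_mul_le hw hlw)) 2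
    cases L with
    | nil =>
      rw [List.length_nil] at hL
      omega
    | cons a L =>
      rw [List.length_cons] at hL
      obtain rfl | hl2 := hl.eq_or_lt
      · obtain rfl := List.length_eq_zero_iff.1 (by omega : L.length = 0)
        refine ((recursiveMethod_singleton a).expectedTime_le (isAlgorithm_pure _)).trans ?_
        rw [expectedTime_pure, add_zero, ← ENNReal.ofReal_natCast]
        refine ENNReal.ofReal_le_ofReal ?_
        have h1 : (2 * (1 : ℕ) - 1 : ℝ) = 1 := by norm_num
        rw [h1, potential, Real.log_one, mul_zero, mul_zero, zero_add, mul_one, hb]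
        have hW1 : words w 1 ^ 2 ≤ 25 := hW
        exact_mod_cast (by omega : 1 + words w 1 ^ 2 ≤ C * (w + 1) + 76)
      · have hM : (2 : ℝ) ≤ l := by exact_mod_cast (by omega : 2 ≤ l)
        obtain ⟨g, hg, hgd, h⟩ := recursiveMethod_cons (by omega : 2 ≤ 2 * l - 1) a L
        have hs : 2 * l - 1 - 1 = L.length := by omega
        have hgk : ∀ k ∈ Finset.Icc 1 (l - 1), (g ⟨2 * k - 1⟩).expectedTime ≤
            ENNReal.ofReal (50 + 205 * (2 * l - 1) + potential b (2 * k - 1) +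
              potential b (2 * (l - k) - 1)) := by
          intro k hk
          rw [Finset.mem_Icc] at hk
          have hk1 : (1 : ℝ) ≤ k := by exact_mod_cast hk.1
          have hkl : (k : ℝ) + 1 ≤ l := by exact_mod_cast (by omega : k + 1 ≤ l)
          have hp1 := potential_nonneg hb0 (x := 2 * k - 1) (by linarith)
          have hp2 := potential_nonneg hb0 (x := 2 * (l - k) - 1) (by linarith)
          have hd := (hgd ⟨2 * k - 1⟩).expectedTime_le (isAlgorithm_distribute _ _ _ _)
          rw [hs] at hd
          refine hd.trans ?_
          have hsh := expectedTime_shuffle_le hw (L := L) (by omega) (r := 2 * k - 1) (by omega)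
          have hdist := expectedTime_bind_le_add
            (isAlgorithm_shuffle (⟨2 * k - 1⟩ : BigNat w) ⟨L.length⟩ L)
            (g := fun p => subtrees (fun x => recursiveMethod x.1 x.2) a ⟨2 * k - 1⟩ ⟨L.length⟩ p)
            (fun p => isAlgorithm_subtrees _ _ _ _)
            (C := ENNReal.ofReal (potential b (2 * k - 1)) +
              (25 + ENNReal.ofReal (potential b (2 * (l - k) - 1)))) fun p hp => by
              obtain ⟨h1, h2⟩ := isSplit_of_prob_shuffle_ne_zero (A := p.1) (B := p.2) (by omega) hp
              have h3 := h1.length_add_length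
              have h4 : L.length - (2 * k - 1) = 2 * (l - k) - 1 := by omega
              refine expectedTime_subtrees_le hw (by omega) (by omega)
                (ih k (by omega) hk.1 (by omega) h2) ?_
              rw [h4]
              have := ih (l - k) (by omega) (by omega) (by omega) (by omega : p.2.length = _)
              rwa [Nat.cast_sub (by omega)] at this
          refine (add_le_add (Nat.cast_le.2 hW) (hdist.trans (add_le_add hsh le_rfl))).trans ?_
          have hLl : L.length + 1 = 2 * l - 1 := hL
          have hcast : ((205 * (L.length + 1) : ℕ) : ℝ) = 205 * (2 * l - 1) := by
            rw [hLl, Nat.cast_mul, Nat.cast_sub (by omega)]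
            push_cast
            ring
          rw [← ENNReal.ofReal_natCast (205 * (L.length + 1)), hcast, ← ENNReal.ofReal_natCast 25,
            show (25 : ℝ≥0∞) = ENNReal.ofReal 25 by simp, ← ENNReal.ofReal_add (by norm_num) hp2,
            ← ENNReal.ofReal_add hp1 (by positivity), ← ENNReal.ofReal_add (by linarith)
            (by positivity), ← ENNReal.ofReal_add (by positivity) (by
              have : (0 : ℝ) ≤ 205 * (2 * l - 1) := by linarith
              positivity)]
          refine ENNReal.ofReal_le_ofReal ?_
          push_cast
          linarith
        have hbind := expectedTime_bind_le (isAlgorithm_leftSize (⟨2 * l - 1⟩ : BigNat w)) hg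
        rw [tsum_prob_leftSize (by omega)] at hbind
        have hsum : ∑ k ∈ Finset.Icc 1 (l - 1), ENNReal.ofReal (sizeProb l k) *
            (g ⟨2 * k - 1⟩).expectedTime ≤ ENNReal.ofReal (∑ k ∈ Finset.Icc 1 (l - 1),
              sizeProb l k * (50 + 205 * (2 * l - 1) + potential b (2 * k - 1) +
                potential b (2 * (l - k) - 1))) := by
          have hk0 : ∀ k ∈ Finset.Icc 1 (l - 1), 0 ≤ sizeProb l k := fun k hk => by
            rw [Finset.mem_Icc] at hk
            exact sizeProb_nonneg hk.1 (by omega)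
          rw [ENNReal.ofReal_sum_of_nonneg]
          · refine Finset.sum_le_sum fun k hk => ?_
            rw [ENNReal.ofReal_mul (hk0 k hk)]
            exact mul_le_mul' le_rfl (hgk k hk)
          · intro k hk
            refine mul_nonneg (hk0 k hk) ?_
            rw [Finset.mem_Icc] at hk
            have hk1 : (1 : ℝ) ≤ k := by exact_mod_cast hk.1
            have hkl : (k : ℝ) + 1 ≤ l := by exact_mod_cast (by omega : k + 1 ≤ l)
            have hp1 := potential_nonneg hb0 (x := 2 * k - 1) (by linarith)
            have hp2 := potential_nonneg hb0 (x := 2 * (l - k) - 1) (by linarith)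
            linarith
        have hfin := (h.expectedTime_le ((isAlgorithm_leftSize _).bind hg)).trans
          (add_le_add le_rfl (hbind.trans (add_le_add (hC w l hw (by omega) (by omega)) hsum)))
        refine hfin.trans ?_
        rw [← ENNReal.ofReal_natCast, ← ENNReal.ofReal_natCast (C * (w + 1)),
          ← ENNReal.ofReal_add (Nat.cast_nonneg _), ← ENNReal.ofReal_add (Nat.cast_nonneg _)]
        · refine ENNReal.ofReal_le_ofReal ?_
          have h1 := sum_sizeProb_mul_potential_le (b := b) (by omega : 2 ≤ l)
          have h2 : ((1 + words w (2 * l - 1) ^ 2 : ℕ) : ℝ) ≤ 26 := by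
            exact_mod_cast (by omega : 1 + words w (2 * l - 1) ^ 2 ≤ 26)
          have h3 : b = ((C * (w + 1) : ℕ) : ℝ) + 76 := by rw [hb]; push_cast; ring
          linarith
        all_goals
          first
          | refine add_nonneg (Nat.cast_nonneg _) (Finset.sum_nonneg fun k hk => ?_)
          | refine Finset.sum_nonneg fun k hk => ?_
          rw [Finset.mem_Icc] at hk
          have hk1 : (1 : ℝ) ≤ k := by exact_mod_cast hk.1
          have hkl : (k : ℝ) + 1 ≤ l := by exact_mod_cast (by omega : k + 1 ≤ l)
          have hp1 := potential_nonneg hb0 (x := 2 * k - 1) (by linarith)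
          have hp2 := potential_nonneg hb0 (x := 2 * (l - k) - 1) (by linarith)
          refine mul_nonneg (sizeProb_nonneg hk.1 (by omega)) ?_
          linarith

end

/-! ## The sampler -/

theorem sampler_delays (n : ℕ) : Delays (sampler n)
    (recursiveMethod (⟨n⟩ : BigNat (Nat.size n)) ((List.range' 1 n).map BigNat.mk) >>= fun T =>
      pure (T.map BigNat.val)) (3 * (n + 1) * words (Nat.size n) (n + 1) ^ 2) :=
  (returns_upTo n).delays _

theorem isAlgorithm_sampler (n : ℕ) : (sampler n).IsAlgorithm :=
  (returns_upTo n).isAlgorithm.bind fun _ =>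
    (isAlgorithm_recursiveMethod _ _).bind fun _ => isAlgorithm_pure _

theorem BTree.map_map {α β γ : Type} (f : α → β) (g : β → γ) (T : BTree α) :
    (T.map f).map g = T.map (g ∘ f) := by
  induction T with
  | leaf a => rfl
  | node a l r hl hr => simp [map, hl, hr]

theorem BTree.map_id {α : Type} (T : BTree α) : T.map id = T := by
  induction T with
  | leaf a => rfl
  | node a l r hl hr => simp [map, hl, hr]

theorem map_val_map_mk {w : ℕ} (T : BTree ℕ) : (T.map (BigNat.mk (w := w))).map BigNat.val = T :=
  (T.map_map _ _).trans T.map_id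

theorem isTreeOn_range'_iff {w n : ℕ} (T : BTree ℕ) :
    IsTreeOn ((List.range' 1 n).map (BigNat.mk (w := w))) (T.map BigNat.mk) ↔ T ∈ incTrees n := by
  rw [IsTreeOn, map_val_map_mk, BTree.labels_map]
  exact and_congr_right fun _ => List.map_perm_map_iff fun a b h => congrArg BigNat.val h

theorem increasing_range' {w n : ℕ} : Increasing ((List.range' 1 n).map (BigNat.mk (w := w))) :=
  List.pairwise_map.2 (List.pairwise_lt_range' (s := 1) (n := n))

theorem prob_sampler_eq (n : ℕ) (T : BTree ℕ) : (sampler n).prob T =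
    (recursiveMethod (⟨n⟩ : BigNat (Nat.size n)) ((List.range' 1 n).map BigNat.mk)).prob
      (T.map BigNat.mk) := by
  have h := prob_map_of_injective (isAlgorithm_recursiveMethod (⟨n⟩ : BigNat (Nat.size n))
    ((List.range' 1 n).map BigNat.mk)) (BTree.map_injective (f := BigNat.val)
      fun a b h => by cases a; cases b; exact congrArg BigNat.mk h) (T.map BigNat.mk)
  rw [map_val_map_mk] at h
  rw [(sampler_delays n).prob_eq, h]

theorem prob_sampler_of_mem {l : ℕ} (hl : 1 ≤ l) {T : BTree ℕ} (hT : T ∈ incTrees (2 * l - 1)) :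
    (sampler (2 * l - 1)).prob T = ENNReal.ofReal (treeNumber l)⁻¹ := by
  rw [prob_sampler_eq]
  exact prob_recursiveMethod hl increasing_range' (by simp) ((isTreeOn_range'_iff T).2 hT)

theorem prob_sampler_of_notMem {l : ℕ} (hl : 1 ≤ l) {T : BTree ℕ} (hT : T ∉ incTrees (2 * l - 1)) :
    (sampler (2 * l - 1)).prob T = 0 := by
  by_contra h
  rw [prob_sampler_eq] at h
  exact hT ((isTreeOn_range'_iff T).1
    (isTreeOn_of_prob_ne_zero hl increasing_range' (by simp) h))

theorem mass_sampler {l : ℕ} (hl : 1 ≤ l) : (sampler (2 * l - 1)).mass = 1 := by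
  rw [(sampler_delays _).mass_eq, mass_map (isAlgorithm_recursiveMethod _ _)]
  exact mass_recursiveMethod hl (by simp)

theorem tsum_prob_of_const {f : RComp (BTree ℕ)} {s : Set (BTree ℕ)} {c : ℝ≥0∞}
    (h1 : ∀ T ∈ s, f.prob T = c) (h2 : ∀ T ∉ s, f.prob T = 0) : f.mass = s.encard * c := by
  rw [mass_eq_tsum, ← ENNReal.tsum_set_const, tsum_subtype s fun _ => c]
  refine tsum_congr fun T => ?_
  by_cases hT : T ∈ s
  · rw [h1 T hT, Set.indicator_of_mem hT]
  · rw [h2 T hT, Set.indicator_of_notMem hT]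

/-- The probabilities sum to 1 and equal a positive constant on the set of trees and 0 elsewhere, so
the set is finite and its size is the inverse of the constant. -/
theorem finite_incTrees_and_treeCount {l : ℕ} (hl : 1 ≤ l) :
    (incTrees (2 * l - 1)).Finite ∧ (treeCount (2 * l - 1) : ℝ) = treeNumber l := by
  have h := tsum_prob_of_const (fun T hT => prob_sampler_of_mem hl hT)
    (fun T hT => prob_sampler_of_notMem hl hT)
  rw [mass_sampler hl] at h
  have hpos := treeNumber_pos hl
  have hc : ENNReal.ofReal (treeNumber l)⁻¹ ≠ 0 := by
    rw [Ne, ENNReal.ofReal_eq_zero, not_le]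
    positivity
  have hfin : (incTrees (2 * l - 1)).Finite := by
    rw [← Set.encard_ne_top_iff]
    intro htop
    rw [htop] at h
    simp [hc] at h
  refine ⟨hfin, ?_⟩
  rw [← hfin.cast_ncard_eq] at h
  have h' := congrArg ENNReal.toReal h
  rw [ENNReal.toReal_mul, ENNReal.toReal_ofReal (by positivity)] at h'
  simp only [ENNReal.toReal_one, ENat.toENNReal_coe, ENNReal.toReal_natCast] at h'
  rw [treeCount]
  field_simp at h'
  exact h'.symm

theorem isUniformSampler_sampler {l : ℕ} (hl : 1 ≤ l) :
    IsUniformSampler (2 * l - 1) (sampler (2 * l - 1)) := by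
  refine ⟨fun T hT => ?_, fun T hT => prob_sampler_of_notMem hl hT⟩
  rw [prob_sampler_of_mem hl hT, ← (finite_incTrees_and_treeCount hl).2,
    ENNReal.ofReal_inv_of_pos, ENNReal.ofReal_natCast]
  rw [(finite_incTrees_and_treeCount hl).2]
  exact treeNumber_pos hl

theorem size_le_log {n : ℕ} (hn : 3 ≤ n) : (Nat.size n : ℝ) + 1 ≤ 4 * Real.log n := by
  have hn0 : (0 : ℝ) < n := by exact_mod_cast (by omega : 0 < n)
  have h3 : (1 : ℝ) ≤ Real.log n := by
    rw [Real.le_log_iff_exp_le hn0]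
    have : (3 : ℝ) ≤ n := by exact_mod_cast hn
    linarith [Real.exp_one_lt_d9]
  obtain ⟨s, hs⟩ : ∃ s, Nat.size n = s + 1 :=
    Nat.exists_eq_succ_of_ne_zero (Nat.size_pos.2 (by omega)).ne'
  have h1 : 2 ^ s ≤ n := Nat.lt_size.1 (by omega)
  have h2 : (s : ℝ) * Real.log 2 ≤ Real.log n := by
    rw [← Real.log_pow]
    refine Real.log_le_log (by positivity) ?_
    exact_mod_cast h1
  rw [hs]
  push_cast
  nlinarith [Real.log_two_gt_d9, Nat.cast_nonneg (α := ℝ) s]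

theorem exists_expectedTime_sampler_le : ∃ C : ℝ, 0 < C ∧ ∀ n : ℕ, Odd n → 3 ≤ n →
    (sampler n).expectedTime ≤ ENNReal.ofReal (C * (n * Real.log n)) := by
  obtain ⟨C, hC⟩ := exists_expectedTime_leftSize_le
  refine ⟨150 + 1500 + 4 * C + 76, by positivity, fun n hodd hn => ?_⟩
  obtain ⟨m, rfl⟩ := hodd
  obtain ⟨l, hl, hlm⟩ : ∃ l, 1 ≤ l ∧ 2 * m + 1 = 2 * l - 1 := ⟨m + 1, by omega, by omega⟩
  rw [hlm] at hn ⊢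
  set n := 2 * l - 1 with hnl
  have hw : 1 ≤ Nat.size n := Nat.size_pos.2 (by omega)
  have hnw : n ≤ 2 ^ Nat.size n := (Nat.lt_size_self n).le
  have hn0 : (3 : ℝ) ≤ n := by exact_mod_cast hn
  have hcast : (2 * l - 1 : ℝ) = n := by
    rw [hnl, Nat.cast_sub (by omega)]
    push_cast
    ring
  have h1 := expectedTime_recursiveMethod_le hC hw hl hnw
    (L := (List.range' 1 n).map BigNat.mk) (by simp [hnl])
  rw [hcast, ← hnl] at h1
  have hW : words (Nat.size n) (n + 1) ^ 2 ≤ 25 :=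
    Nat.pow_le_pow_left ((words_mono (by omega)).trans (words_four_mul_le hw hnw)) 2
  have hup : 3 * (n + 1) * words (Nat.size n) (n + 1) ^ 2 ≤ 150 * n := by nlinarith
  have hlog := size_le_log hn
  have hlog1 : (1 : ℝ) ≤ Real.log n := by
    have : (1 : ℝ) ≤ Nat.size n := by exact_mod_cast hw
    rw [Real.le_log_iff_exp_le (by linarith)]
    linarith [Real.exp_one_lt_d9]
  refine ((sampler_delays n).expectedTime_le ((isAlgorithm_recursiveMethod _ _).bind fun _ =>
    isAlgorithm_pure _)).trans ((add_le_add (Nat.cast_le.2 hup)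
      ((expectedTime_map_le (isAlgorithm_recursiveMethod _ _) _).trans h1)).trans ?_)
  rw [← ENNReal.ofReal_natCast, ← ENNReal.ofReal_add (Nat.cast_nonneg _)
    (potential_nonneg (Nat.cast_nonneg _) (by linarith))]
  refine ENNReal.ofReal_le_ofReal ?_
  rw [potential]
  push_cast
  have e1 : (n : ℝ) ≤ n * Real.log n := by nlinarith
  have e2 : (C : ℝ) * (Nat.size n + 1) * n ≤ C * (4 * Real.log n) * n := by gcongr
  linarith

/-! ## Lower bounds -/

/-- Each run of length j alone gives its value probability at least 2⁻ʲ, and no value has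
probability above 1/t_n. So the bound holds run by run, and averaging needs only that the total mass
is 1. -/
theorem logb_le_expectedBits {n : ℕ} {S : RComp (BTree ℕ)} (hn : (incTrees n).Finite)
    (ht : 0 < treeCount n) (hS : IsUniformSampler n S) :
    ENNReal.ofReal (Real.logb 2 (treeCount n)) ≤ S.expectedBits := by
  have hmass : S.mass = 1 := by
    rw [tsum_prob_of_const hS.1 hS.2, ← hn.cast_ncard_eq, ENat.toENNReal_coe]
    exact ENNReal.mul_inv_cancel (by exact_mod_cast ht.ne') (ENNReal.natCast_ne_top _)
  have hrun : ∀ ρ : S.runs, ENNReal.ofReal (Real.logb 2 (treeCount n)) ≤ ρ.1.bits.length := by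
    intro ρ
    have h1 : (2⁻¹ : ℝ≥0∞) ^ ρ.1.bits.length ≤ S.prob ρ.1.value :=
      ENNReal.le_tsum (f := fun σ : {σ : Run (BTree ℕ) // σ ∈ S.runs ∧ σ.value = ρ.1.value} =>
        (2⁻¹ : ℝ≥0∞) ^ σ.1.bits.length) ⟨ρ.1, ρ.2, rfl⟩
    have h2 : S.prob ρ.1.value ≤ (treeCount n : ℝ≥0∞)⁻¹ := by
      by_cases hT : ρ.1.value ∈ incTrees n
      · exact (hS.1 _ hT).le
      · rw [hS.2 _ hT]
        exact bot_le
    have h3 := h1.trans h2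
    rw [← ENNReal.inv_pow, ENNReal.inv_le_inv] at h3
    have h4 : treeCount n ≤ 2 ^ ρ.1.bits.length := by exact_mod_cast h3
    rw [← ENNReal.ofReal_natCast]
    refine ENNReal.ofReal_le_ofReal ?_
    rw [Real.logb_le_iff_le_rpow (by norm_num) (by exact_mod_cast ht), Real.rpow_natCast]
    exact_mod_cast h4
  calc ENNReal.ofReal (Real.logb 2 (treeCount n))
      = S.mass * ENNReal.ofReal (Real.logb 2 (treeCount n)) := by rw [hmass, one_mul]
    _ = ∑' ρ : S.runs, (2⁻¹ : ℝ≥0∞) ^ ρ.1.bits.length * 1 *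
        ENNReal.ofReal (Real.logb 2 (treeCount n)) := ENNReal.tsum_mul_right.symm
    _ ≤ S.expectedBits := ENNReal.tsum_le_tsum fun ρ => by
        rw [mul_one]
        exact mul_le_mul' le_rfl (hrun ρ)

theorem RComp.IsAlgorithm.expectedBits_le_expectedTime {α : Type} {S : RComp α} (hS : S.IsAlgorithm) :
    S.expectedBits ≤ S.expectedTime :=
  ENNReal.tsum_le_tsum fun ρ => mul_le_mul' le_rfl (Nat.cast_le.2 (hS.bits_le_time ρ.1 ρ.2))

/-- Only the term of the recurrence with a right subtree of size 1 is kept. -/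
theorem mul_treeNumber_le {l : ℕ} (hl : 1 ≤ l) : 2 * l * treeNumber l ≤ treeNumber (l + 1) := by
  have h := sum_tangentCoeff (by omega : 2 ≤ l + 1)
  have h1 : tangentCoeff l * tangentCoeff (l + 1 - l) ≤ _ :=
    Finset.single_le_sum (f := fun k => tangentCoeff k * tangentCoeff (l + 1 - k))
      (s := Finset.Icc 1 (l + 1 - 1)) (fun k hk => by
        rw [Finset.mem_Icc] at hk
        exact (mul_pos (tangentCoeff_pos hk.1) (tangentCoeff_pos (by omega))).le)
      (Finset.mem_Icc.2 ⟨hl, by omega⟩)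
  rw [h, Nat.add_sub_cancel_left, tangentCoeff_one, mul_one] at h1
  have h2 : (2 * l).factorial = 2 * l * (2 * l - 1).factorial :=
    (Nat.mul_factorial_pred (by omega)).symm
  have h3 : (2 * (l + 1) - 1).factorial = (2 * l + 1) * (2 * l).factorial := by
    rw [show 2 * (l + 1) - 1 = 2 * l + 1 by omega, Nat.factorial_succ]
  have hpos : (0 : ℝ) ≤ (2 * l).factorial := by positivity
  calc 2 * l * treeNumber l = (2 * l).factorial * tangentCoeff l := by
        rw [treeNumber, h2]
        push_cast
        ring
    _ ≤ (2 * l).factorial * ((2 * (l + 1 : ℕ) - 1) * tangentCoeff (l + 1)) :=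
        mul_le_mul_of_nonneg_left h1 hpos
    _ = treeNumber (l + 1) := by
        rw [treeNumber, h3]
        push_cast
        ring

theorem two_pow_mul_factorial_le (m : ℕ) : 2 ^ m * (m.factorial : ℝ) ≤ treeNumber (m + 1) := by
  induction m with
  | zero => simp [treeNumber_one]
  | succ m ih =>
    refine le_trans ?_ (mul_treeNumber_le (by omega : 1 ≤ m + 1))
    rw [Nat.factorial_succ]
    push_cast
    have h0 : (0 : ℝ) ≤ 2 * (m + 1) := by positivity
    have := mul_le_mul_of_nonneg_left ih h0
    rw [pow_succ]
    linarith

/-- Pair the factors k + 1 and m - k of the two copies of m!: each product is at least m. -/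
theorem pow_self_le_factorial_sq (m : ℕ) : m ^ m ≤ m.factorial ^ 2 := by
  have h : m.factorial ^ 2 = ∏ k ∈ Finset.range m, ((k + 1) * (m - 1 - k + 1)) := by
    rw [sq, Finset.prod_mul_distrib, Finset.prod_range_reflect (fun k => k + 1) m,
      Finset.prod_range_add_one_eq_factorial]
  rw [h]
  calc m ^ m = ∏ _k ∈ Finset.range m, m := by simp
    _ ≤ _ := Finset.prod_le_prod' fun k hk => by
      rw [Finset.mem_range] at hk
      obtain ⟨j, rfl⟩ := Nat.exists_eq_add_of_lt hk
      rw [show k + j + 1 - 1 - k = j by omega]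
      nlinarith [Nat.zero_le (k * j)]

/-- With n = 2m + 1 ≤ 4m, nᵐ ≤ 4ᵐ mᵐ ≤ (2ᵐ m!)² ≤ t_n². Taking logarithms and using n ≤ 3m gives the
constant 1/6; passing to base 2 only helps, since log 2 < 1. -/
theorem mul_log_le_logb_treeNumber {m : ℕ} (hm : 1 ≤ m) :
    1 / 6 * (((2 * m + 1 : ℕ) : ℝ) * Real.log (2 * m + 1 : ℕ)) ≤
      Real.logb 2 (treeNumber (m + 1)) := by
  have h1 := two_pow_mul_factorial_le m
  have hp := treeNumber_pos (by omega : 1 ≤ m + 1)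
  have hm1 : (1 : ℝ) ≤ m := by exact_mod_cast hm
  have hsq : ((2 * m + 1 : ℕ) : ℝ) ^ m ≤ treeNumber (m + 1) ^ 2 := by
    have h2 : ((m : ℝ)) ^ m ≤ (m.factorial : ℝ) ^ 2 := by exact_mod_cast pow_self_le_factorial_sq m
    calc ((2 * m + 1 : ℕ) : ℝ) ^ m ≤ (4 * m) ^ m := by
          gcongr
          push_cast
          linarith
      _ = (2 ^ m) ^ 2 * (m : ℝ) ^ m := by
          rw [mul_pow, ← pow_mul, mul_comm m 2, pow_mul]
          norm_num
      _ ≤ (2 ^ m) ^ 2 * (m.factorial : ℝ) ^ 2 := by gcongr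
      _ = (2 ^ m * (m.factorial : ℝ)) ^ 2 := by ring
      _ ≤ _ := by gcongr
  have hlog := Real.log_le_log (by positivity) hsq
  rw [Real.log_pow, Real.log_pow] at hlog
  have hL : 0 ≤ Real.log (2 * m + 1 : ℕ) := Real.log_natCast_nonneg _
  have h3 : 1 / 6 * (((2 * m + 1 : ℕ) : ℝ) * Real.log (2 * m + 1 : ℕ)) ≤
      Real.log (treeNumber (m + 1)) := by
    have : (((2 * m + 1 : ℕ) : ℝ)) ≤ 3 * m := by
      push_cast
      linarith
    have h4 := mul_le_mul_of_nonneg_right this hL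
    push_cast at hlog h4 ⊢
    linarith
  have h5 : 0 ≤ Real.log (treeNumber (m + 1)) := le_trans (by positivity) h3
  refine h3.trans ?_
  rw [Real.logb, le_div_iff₀ (Real.log_pos (by norm_num))]
  nlinarith [Real.log_two_lt_d9]

end RandTree

theorem mainTheorem1 :
    -- the Monte-Carlo procedure returns `2k - 1` with a probability proportional to `f_k`
    (∀ w l : ℕ, 2 ≤ l →
      (∀ k ∈ Finset.Icc 1 (l - 1),
        (leftSize (⟨2 * l - 1⟩ : BigNat w)).prob ⟨2 * k - 1⟩ =
          ENNReal.ofReal (weight l k / ∑ j ∈ Finset.Icc 1 (l - 1), weight l j))) ∧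
    -- the recursive sampler is a randomized algorithm, and its output is uniform
    (∀ n : ℕ, Odd n → (sampler n).IsAlgorithm ∧ IsUniformSampler n (sampler n)) ∧
    -- its expected running time is `O(n log n)`
    (∃ C : ℝ, 0 < C ∧ ∀ n : ℕ, Odd n → 3 ≤ n →
      (sampler n).expectedTime ≤ ENNReal.ofReal (C * (n * Real.log n))) ∧
    -- every uniform sampler reads at least `log₂ t_n` random bits on average, and so takes at
    -- least this time
    (∀ n : ℕ, Odd n → ∀ S : RComp (BTree ℕ), S.IsAlgorithm → IsUniformSampler n S →
      ENNReal.ofReal (Real.logb 2 (treeCount n)) ≤ S.expectedBits ∧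
        S.expectedBits ≤ S.expectedTime) ∧
    -- and `log₂ t_n = Ω(n log n)`
    (∃ c : ℝ, 0 < c ∧ ∀ n : ℕ, Odd n → 3 ≤ n →
      c * (n * Real.log n) ≤ Real.logb 2 (treeCount n)) := by
  refine ⟨fun w l _ k hk => prob_leftSize_of_mem hk, fun n hn => ?_, exists_expectedTime_sampler_le,
    fun n hn S hS hU => ⟨?_, hS.expectedBits_le_expectedTime⟩,
    1 / 6, by norm_num, fun n hn hn3 => ?_⟩
  · obtain ⟨m, rfl⟩ := hn
    exact ⟨isAlgorithm_sampler _, isUniformSampler_sampler (l := m + 1) (by omega)⟩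
  · obtain ⟨m, rfl⟩ := hn
    obtain ⟨hfin, ht⟩ := finite_incTrees_and_treeCount (l := m + 1) (by omega)
    have hpos := treeNumber_pos (l := m + 1) (by omega)
    rw [← ht] at hpos
    exact logb_le_expectedBits hfin (by exact_mod_cast hpos) hU
  · obtain ⟨m, rfl⟩ := hn
    have ht := (finite_incTrees_and_treeCount (l := m + 1) (by omega)).2
    rw [show 2 * (m + 1) - 1 = 2 * m + 1 by omega] at ht
    rw [ht]
    exact mul_log_le_logb_treeNumber (by omega)
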